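/- Let $\mathbf k$ be an algebraically closed field of arbitrary characteristic $p\ge 0$. A *Campana orbifold* $(X,\Delta_\epsilon)$ over $\mathbf k$ is a smooth projective variety $\underline X$ with a strict normal crossings divisor $\Delta=\bigcup_i\Delta_i$ (the $\Delta_i$ irreducible), its associated divisorial log structure, and multiplicities $m_i\in\{1,2,\dots\}\cup\{\infty\}$, where $\Delta_\epsilon=\sum_i(1-\frac1{m_i})\Delta_i$. It is *klt* if all $m_i$ are finite. A finite collection $\varsigma=(\mathbf c_j)_{j=1}^n$ of contact orders $\mathbf c_j=(c_{j,i})_i\in\mathbb Z_{\ge0}^{\{i\}}$, all of them nonzero, is *of Campana type* if for every $i$: when $m_i<\infty$, every $j$ has $c_{j,i}=0$ or $c_{j,i}\ge m_i$; when $m_i=\infty$, at most one $j$ has $c_{j,i}>0$. It is *good* if no $\mathbf c_j$ is divisible by $p$, i.e. for each $j$ there is an $i$ with $p\nmid c_{j,i}$ (where $0$ divides only $0$). Say that $X$ is *separably $\varsigma$-rationally connected* if there are a variety $W$ and a family over $W$ of genus zero non-degenerate stable log maps to $X$ with contact orders $\varsigma$ whose underlying family of curves is $\mathcal U=W\times\mathbb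 P^1\to W$ — that is, $n$ pairwise disjoint sections $p_j$ of $W\times\mathbb P^1\to W$ and a log morphism $ev:\mathcal U\to X$ over $\mathbf k$, for the log structure on $\mathcal U$ defined by the markings, with $ev^*\Delta_i=\sum_j c_{j,i}\,p_j(W)$ for all $i$, such that on each fibre $ev$ is non-constant or $n\ge3$ — for which the morphism of varieties $$ev^{(2)}:\mathcal U\times_W\mathcal U\to X\times X$$ is dominant and separable (its extension of function fields is separably generated). The orbifold $(X,\Delta_\epsilon)$ is *separably Campana rationally connected by good contact orders* if $X$ is separably $\varsigma$-rationally connected for some good $\varsigma$ of Campana type consisting of nonzero contact orders. **Corollary.** Let $\Sigma$ be a fan in $\mathbb R^d$ with respect to the lattice $\mathbb Z^d$, $d\ge1$, let $X_\Sigma$ be its toric variety over $\mathbf k$, and let $\Delta_\Sigma=\bigcup_{\rho\in\Sigma^{(1)}}\Delta_\rho$ be its toric boundary. Let $(X,\Delta_\epsilon)$ be a klt Campana orbifold over $\mathbf k$ whose log scheme is that of $(X_\Sigma,\Delta_\Sigma)$, i.e. there is an isomorphism $\underline X\cong X_\Sigma$ over $\mathbf k$ that identifies $\Delta$ with $\Delta_\Sigma$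 (so $X_\Sigma$ is smooth and projective). Then $(X,\Delta_\epsilon)$ is separably Campana rationally connected by good contact orders. -/

import Mathlib

open CategoryTheory CategoryTheory.Limits AlgebraicGeometry

universe u

namespace Campana

noncomputable section

/-! ## Fans in the lattice `N = ℤ ^ d` and their toric varieties -/

/-- The pairing of a character `m ∈ M = ℤ ^ d` with a vector `v ∈ N_ℝ = ℝ ^ d`. -/
def pairing {d : ℕ} (m : Fin d → ℤ) (v : Fin d → ℝ) : ℝ := ∑ i, (m i : ℝ) * v i

lemma pairing_add {d : ℕ} (a b : Fin d → ℤ) (v : Fin d → ℝ) :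
    pairing (a + b) v = pairing a v + pairing b v := by
  simp [pairing, add_mul, Finset.sum_add_distrib]

/-- The monoid `σ^∨ ∩ M` of the characters that are nonnegative on the cone `σ`. -/
def dualMonoid {d : ℕ} (σ : PointedCone ℝ (Fin d → ℝ)) : AddSubmonoid (Fin d → ℤ) where
  carrier := {m | ∀ v ∈ σ, 0 ≤ pairing m v}
  zero_mem' := by intro v _; simp [pairing]
  add_mem' := by
    intro a b ha hb v hv
    rw [pairing_add]; exact add_nonneg (ha v hv) (hb v hv)

/-- A cone is rational polyhedral if it is generated by finitely many lattice vectors. -/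
def IsRationalPolyhedral {d : ℕ} (σ : PointedCone ℝ (Fin d → ℝ)) : Prop :=
  ∃ S : Finset (Fin d → ℤ), σ = PointedCone.hull ℝ ((fun u i => (u i : ℝ)) '' (S : Set (Fin d → ℤ)))

/-- `τ` is a face of the rational cone `σ`: `τ = σ ∩ m^⊥` for some `m ∈ σ^∨ ∩ M`. -/
def IsFace {d : ℕ} (τ σ : PointedCone ℝ (Fin d → ℝ)) : Prop :=
  ∃ m ∈ dualMonoid σ, ∀ v, v ∈ τ ↔ v ∈ σ ∧ pairing m v = 0

/-- A fan in `N_ℝ = ℝ ^ d` with respect to the lattice `N = ℤ ^ d`. -/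
structure Fan (d : ℕ) where
  cones : Set (PointedCone ℝ (Fin d → ℝ))
  finite : cones.Finite
  nonempty : cones.Nonempty
  rational : ∀ σ ∈ cones, IsRationalPolyhedral σ
  stronglyConvex : ∀ σ ∈ cones, ∀ v ∈ σ, -v ∈ σ → v = 0
  face_mem : ∀ σ ∈ cones, ∀ τ, IsFace τ σ → τ ∈ cones
  inter_face : ∀ σ ∈ cones, ∀ τ ∈ cones, IsFace (σ ⊓ τ) σ ∧ IsFace (σ ⊓ τ) τ

lemma dualMonoid_anti {d : ℕ} {τ σ : PointedCone ℝ (Fin d → ℝ)} (h : τ ≤ σ) :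
    dualMonoid σ ≤ dualMonoid τ := fun _ hm v hv => hm v (h hv)

/-- The restriction map `k[σ^∨ ∩ M] → k[τ^∨ ∩ M]` for `τ ≤ σ`. -/
def chartMap (k : Type u) [Field k] {d : ℕ} {τ σ : PointedCone ℝ (Fin d → ℝ)} (h : τ ≤ σ) :
    AddMonoidAlgebra k (dualMonoid σ) →+* AddMonoidAlgebra k (dualMonoid τ) :=
  AddMonoidAlgebra.mapDomainRingHom k (AddSubmonoid.inclusion (dualMonoid_anti h))

/-- The affine toric variety `U_σ = Spec k[σ^∨ ∩ M]`. -/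
abbrev chart (k : Type u) [Field k] {d : ℕ} (σ : PointedCone ℝ (Fin d → ℝ)) : Scheme.{u} :=
  Spec (.of (AddMonoidAlgebra k (dualMonoid σ)))

lemma pairing_nsmul {d : ℕ} (n : ℕ) (a : Fin d → ℤ) (v : Fin d → ℝ) :
    pairing (n • a) v = n * pairing a v := by
  simp [pairing, Finset.mul_sum, mul_assoc]

lemma pairing_neg {d : ℕ} (a : Fin d → ℤ) (v : Fin d → ℝ) :
    pairing (-a) v = - pairing a v := by
  simp [pairing]

/-- `m ↦ ⟨m, v⟩` is linear in `v`. -/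
def pairingLin {d : ℕ} (m : Fin d → ℤ) : (Fin d → ℝ) →ₗ[ℝ] ℝ where
  toFun := pairing m
  map_add' x y := by simp [pairing, mul_add, Finset.sum_add_distrib]
  map_smul' c x := by simp [pairing, Finset.mul_sum, mul_left_comm]

/-- Every character in `τ^∨` becomes a character in `σ^∨` after adding a multiple of the
character that cuts out the face `τ`. -/
lemma exists_add_nsmul_mem {d : ℕ} {τ σ : PointedCone ℝ (Fin d → ℝ)}
    (hσ : IsRationalPolyhedral σ) {m : Fin d → ℤ} (hm : m ∈ dualMonoid σ)
    (hτ : ∀ v, v ∈ τ ↔ v ∈ σ ∧ pairing m v = 0) {w : Fin d → ℤ} (hw : w ∈ dualMonoid τ) :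
    ∃ n : ℕ, w + n • m ∈ dualMonoid σ := by
  obtain ⟨S, rfl⟩ := hσ
  set c : (Fin d → ℤ) → (Fin d → ℝ) := fun u i => (u i : ℝ) with hc
  have hS : ∀ u ∈ S, c u ∈ PointedCone.hull ℝ (c '' (S : Set (Fin d → ℤ))) := fun u hu =>
    Submodule.subset_span ⟨u, hu, rfl⟩
  have key : ∀ u ∈ S, ∃ n : ℕ, ∀ n' ≥ n, 0 ≤ pairing (w + n' • m) (c u) := by
    intro u hu
    have h0 := hm _ (hS u hu)
    rcases h0.eq_or_lt with h | h
    · refine ⟨0, fun n' _ => ?_⟩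
      rw [pairing_add, pairing_nsmul, ← h, mul_zero, add_zero]
      exact hw _ ((hτ _).2 ⟨hS u hu, h.symm⟩)
    · obtain ⟨n, hn⟩ := exists_nat_gt (-(pairing w (c u)) / pairing m (c u))
      refine ⟨n, fun n' hn' => ?_⟩
      rw [pairing_add, pairing_nsmul]
      rw [div_lt_iff₀ h] at hn
      have : (n : ℝ) * pairing m (c u) ≤ n' * pairing m (c u) := by
        gcongr
      linarith
  choose! f hf using key
  refine ⟨S.sup f, fun v hv => ?_⟩
  refine Submodule.span_induction (p := fun v _ => 0 ≤ pairing (w + (S.sup f) • m) v)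
    ?_ ?_ ?_ ?_ hv
  · rintro _ ⟨u, hu, rfl⟩
    exact hf u hu _ (Finset.le_sup (f := f) hu)
  · simp [pairing]
  · intro x y _ _ hx hy
    have := (pairingLin (w + (S.sup f) • m)).map_add x y
    change pairing _ _ = pairing _ _ + pairing _ _ at this
    rw [this]; exact add_nonneg hx hy
  · intro a x _ hx
    have := (pairingLin (w + (S.sup f) • m)).map_smul (a : ℝ) x
    change pairing _ _ = (a : ℝ) * pairing _ _ at this
    change 0 ≤ pairing _ ((a : ℝ) • x)
    rw [this]; exact mul_nonneg a.2 hx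

lemma chartMap_single (k : Type u) [Field k] {d : ℕ} {τ σ : PointedCone ℝ (Fin d → ℝ)}
    (h : τ ≤ σ) (a : dualMonoid σ) (r : k) :
    chartMap k h (AddMonoidAlgebra.single a r) =
      AddMonoidAlgebra.single (AddSubmonoid.inclusion (dualMonoid_anti h) a) r := by
  simp [chartMap, AddMonoidAlgebra.mapDomainRingHom]

lemma chartMap_refl (k : Type u) [Field k] {d : ℕ} (σ : PointedCone ℝ (Fin d → ℝ)) :
    chartMap k (le_refl σ) = RingHom.id _ := by
  refine AddMonoidAlgebra.ringHom_ext (fun r => ?_) (fun m => ?_) <;>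
    rw [chartMap_single] <;> rfl

lemma chartMap_comp (k : Type u) [Field k] {d : ℕ} {ρ τ σ : PointedCone ℝ (Fin d → ℝ)}
    (h : ρ ≤ τ) (h' : τ ≤ σ) :
    (chartMap k h).comp (chartMap k h') = chartMap k (h.trans h') := by
  refine AddMonoidAlgebra.ringHom_ext (fun r => ?_) (fun m => ?_) <;>
    rw [RingHom.comp_apply, chartMap_single, chartMap_single, chartMap_single] <;> rfl

lemma isLocalization_chartMap (k : Type u) [Field k] {d : ℕ} {τ σ : PointedCone ℝ (Fin d → ℝ)}
    (hσ : IsRationalPolyhedral σ) (h : τ ≤ σ) {m : Fin d → ℤ} (hm : m ∈ dualMonoid σ)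
    (hτ : ∀ v, v ∈ τ ↔ v ∈ σ ∧ pairing m v = 0) :
    @IsLocalization.Away _ _ (AddMonoidAlgebra.single (⟨m, hm⟩ : dualMonoid σ) (1 : k))
      (AddMonoidAlgebra k (dualMonoid τ)) _ (chartMap k h).toAlgebra := by
  let _ := (chartMap k h).toAlgebra
  have halg : ∀ x, algebraMap (AddMonoidAlgebra k (dualMonoid σ))
    (AddMonoidAlgebra k (dualMonoid τ)) x = chartMap k h x := fun _ => rfl
  have hsingle := chartMap_single k h
  have hneg : -m ∈ dualMonoid τ := fun v hv => by
    rw [pairing_neg, ((hτ v).1 hv).2, neg_zero]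
  have hpow : ∀ n : ℕ, (AddMonoidAlgebra.single (⟨m, hm⟩ : dualMonoid σ) (1 : k)) ^ n =
      AddMonoidAlgebra.single (n • (⟨m, hm⟩ : dualMonoid σ)) (1 : k) := by
    intro n; rw [AddMonoidAlgebra.single_pow, one_pow]
  refine IsLocalization.Away.mk _ ?_ ?_ ?_
  · rw [halg, hsingle]
    refine IsUnit.of_mul_eq_one (AddMonoidAlgebra.single (⟨-m, hneg⟩ : dualMonoid τ) 1) ?_
    rw [AddMonoidAlgebra.single_mul_single, AddMonoidAlgebra.one_def]
    congr 1
    · ext; simp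
    · simp
  · intro z
    induction z using AddMonoidAlgebra.induction_linear with
    | zero => exact ⟨0, 0, by simp⟩
    | add f g hf hg =>
      obtain ⟨n, a, ha⟩ := hf
      obtain ⟨n', b, hb⟩ := hg
      refine ⟨n + n', a * (AddMonoidAlgebra.single (⟨m, hm⟩ : dualMonoid σ) (1 : k)) ^ n' +
        b * (AddMonoidAlgebra.single (⟨m, hm⟩ : dualMonoid σ) (1 : k)) ^ n, ?_⟩
      simp only [map_add, map_mul, map_pow, ← ha, ← hb]
      ring
    | single w r =>
      obtain ⟨n, hn⟩ := exists_add_nsmul_mem hσ hm hτ w.2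
      refine ⟨n, AddMonoidAlgebra.single ⟨_, hn⟩ r, ?_⟩
      rw [← map_pow, hpow, halg, halg, hsingle, hsingle, AddMonoidAlgebra.single_mul_single,
        mul_one]
      congr 1
  · intro a b hab
    refine ⟨0, ?_⟩
    rw [pow_zero, one_mul, one_mul]
    exact AddMonoidAlgebra.mapDomain_injective
      (AddSubmonoid.inclusion_injective (dualMonoid_anti h)) hab

namespace Fan

variable {d : ℕ} (F : Fan d)

lemma isFace_of_le {τ σ : PointedCone ℝ (Fin d → ℝ)} (hτ : τ ∈ F.cones) (hσ : σ ∈ F.cones)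
    (h : τ ≤ σ) : IsFace τ σ := by
  have := (F.inter_face σ hσ τ hτ).1
  rwa [inf_eq_right.2 h] at this

/-- The charts `U_σ`, `σ ∈ Σ`, with the open immersions `U_τ → U_σ` for `τ ≤ σ`. -/
def diagram (k : Type u) [Field k] : F.cones ⥤ Scheme.{u} where
  obj σ := chart k σ.1
  map f := Spec.map (CommRingCat.ofHom (chartMap k (leOfHom f)))
  map_id σ := by
    change Spec.map (CommRingCat.ofHom (chartMap k (le_refl σ.1))) = 𝟙 (chart k σ.1)
    rw [chartMap_refl]; exact Spec.map_id _
  map_comp {ρ τ σ} f g := by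
    rw [← Spec.map_comp, ← CommRingCat.ofHom_comp, chartMap_comp]

instance (k : Type u) [Field k] {τ σ : F.cones} (f : τ ⟶ σ) :
    IsOpenImmersion ((F.diagram k).map f) := by
  obtain ⟨m, hm, hτ⟩ := F.isFace_of_le τ.2 σ.2 (leOfHom f)
  let _ := (chartMap k (leOfHom f)).toAlgebra
  have := isLocalization_chartMap k (F.rational _ σ.2) (leOfHom f) hm hτ
  exact IsOpenImmersion.of_isLocalization
    (AddMonoidAlgebra.single (⟨m, hm⟩ : dualMonoid σ.1) (1 : k))

lemma range_diagram_map (k : Type u) [Field k] {τ σ : F.cones} (f : τ ⟶ σ) {m : Fin d → ℤ}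
    (hm : m ∈ dualMonoid σ.1) (hτ : ∀ v, v ∈ τ.1 ↔ v ∈ σ.1 ∧ pairing m v = 0) :
    Set.range ((F.diagram k).map f) =
      (PrimeSpectrum.basicOpen (AddMonoidAlgebra.single (⟨m, hm⟩ : dualMonoid σ.1) (1 : k)) :
        Set (PrimeSpectrum (AddMonoidAlgebra k (dualMonoid σ.1)))) := by
  let _ := (chartMap k (leOfHom f)).toAlgebra
  have := isLocalization_chartMap k (F.rational _ σ.2) (leOfHom f) hm hτ
  exact PrimeSpectrum.localization_away_comap_range (AddMonoidAlgebra k (dualMonoid τ.1))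
    (AddMonoidAlgebra.single (⟨m, hm⟩ : dualMonoid σ.1) (1 : k))

instance (k : Type u) [Field k] : (F.diagram k ⋙ Scheme.forget).IsLocallyDirected where
  cond {τ τ' σ} f g x y hxy := by
    obtain ⟨m, hm, hτ⟩ := F.isFace_of_le τ.2 σ.2 (leOfHom f)
    obtain ⟨m', hm', hτ'⟩ := F.isFace_of_le τ'.2 σ.2 (leOfHom g)
    let ρ : F.cones := ⟨τ.1 ⊓ τ'.1, F.face_mem _ τ.2 _ (F.inter_face _ τ.2 _ τ'.2).1⟩
    let a : ρ ⟶ τ := homOfLE (show τ.1 ⊓ τ'.1 ≤ τ.1 from inf_le_left)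
    let b : ρ ⟶ τ' := homOfLE (show τ.1 ⊓ τ'.1 ≤ τ'.1 from inf_le_right)
    have hρ : ∀ v, v ∈ ρ.1 ↔ v ∈ σ.1 ∧ pairing (m + m') v = 0 := by
      intro v
      change v ∈ τ.1 ∧ v ∈ τ'.1 ↔ _
      rw [hτ, hτ', pairing_add]
      constructor
      · rintro ⟨⟨h1, h2⟩, _, h3⟩
        exact ⟨h1, by rw [h2, h3, add_zero]⟩
      · rintro ⟨h1, h2⟩
        have := hm v h1
        have := hm' v h1
        exact ⟨⟨h1, by linarith⟩, h1, by linarith⟩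
    change (F.diagram k).map f x = (F.diagram k).map g y at hxy
    have hx := (F.range_diagram_map k f hm hτ).le ⟨x, rfl⟩
    have hy := (F.range_diagram_map k g hm' hτ').le ⟨y, rfl⟩
    rw [← hxy] at hy
    have hz : (F.diagram k).map f x ∈ Set.range ((F.diagram k).map (a ≫ f)) := by
      rw [F.range_diagram_map k (a ≫ f) (add_mem hm hm') hρ]
      have : (AddMonoidAlgebra.single (⟨m + m', add_mem hm hm'⟩ : dualMonoid σ.1) (1 : k)) =
          AddMonoidAlgebra.single ⟨m, hm⟩ 1 * AddMonoidAlgebra.single ⟨m', hm'⟩ 1 := by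
        rw [AddMonoidAlgebra.single_mul_single, mul_one]; rfl
      rw [this, PrimeSpectrum.basicOpen_mul]
      exact ⟨hx, hy⟩
    obtain ⟨z, hz⟩ := hz
    refine ⟨ρ, a, b, z, ?_, ?_⟩
    · apply ((F.diagram k).map f).isOpenEmbedding.injective
      change (F.diagram k).map f ((F.diagram k).map a z) = _
      rw [← hz, Functor.map_comp, Scheme.Hom.comp_apply]
    · apply ((F.diagram k).map g).isOpenEmbedding.injective
      change (F.diagram k).map g ((F.diagram k).map b z) = _
      have : a ≫ f = b ≫ g := Subsingleton.elim _ _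
      rw [← hxy, ← hz, this, Functor.map_comp, Scheme.Hom.comp_apply]

/-- The toric variety `X_Σ` of the fan `Σ` over `k`, glued from the charts `U_σ`. -/
def toricVariety (k : Type u) [Field k] : Scheme.{u} := colimit (F.diagram k)

/-- The open immersion `U_σ → X_Σ`. -/
def chartι (k : Type u) [Field k] (σ : F.cones) : chart k σ.1 ⟶ F.toricVariety k :=
  colimit.ι (F.diagram k) σ

/-- The structure morphism `X_Σ → Spec k`. -/
def toricStr (k : Type u) [Field k] : F.toricVariety k ⟶ Spec (.of k) :=
  colimit.desc (F.diagram k)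
    { pt := Spec (.of k)
      ι :=
        { app := fun σ => Spec.map (CommRingCat.ofHom
            (algebraMap k (AddMonoidAlgebra k (dualMonoid σ.1))))
          naturality := by
            intro τ σ f
            change Spec.map _ ≫ Spec.map _ = _ ≫ 𝟙 _
            rw [← Spec.map_comp, ← CommRingCat.ofHom_comp, Category.comp_id]
            congr 2
            ext; simp [chartMap] } }

/-- The rays of the fan: its one-dimensional cones. -/
def rays : Set F.cones :=
  {ρ | Module.finrank ℝ (Submodule.span ℝ (ρ.1 : Set (Fin d → ℝ))) = 1}

/-- The torus orbit in `U_σ` that corresponds to the cone `σ`: the locus in `U_σ` where all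
characters `χ^m` with `m ∈ σ^∨ ∩ M` and `m ∉ σ^⊥` vanish. -/
def orbit (k : Type u) [Field k] (σ : F.cones) :
    Set (PrimeSpectrum (AddMonoidAlgebra k (dualMonoid σ.1))) :=
  PrimeSpectrum.zeroLocus
    {f | ∃ m : dualMonoid σ.1, (∃ v ∈ σ.1, pairing m.1 v ≠ 0) ∧ f = AddMonoidAlgebra.single m 1}

/-- The torus invariant divisor `Δ_ρ ⊆ X_Σ` of a ray `ρ`: the closure of its orbit. -/
def toricDivisor (k : Type u) [Field k] (ρ : F.cones) : Set (F.toricVariety k) :=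
  closure (F.chartι k ρ '' F.orbit k ρ)

/-- The toric boundary `Δ_Σ`, the union of the divisors `Δ_ρ` over all rays `ρ`. -/
def toricBoundary (k : Type u) [Field k] : Set (F.toricVariety k) :=
  ⋃ ρ ∈ F.rays, F.toricDivisor k ρ

end Fan

/-! ## Projective space -/

attribute [instance] MvPolynomial.gradedAlgebra

/-- Projective space `ℙ^n` over `k`. -/
def projectiveSpace (n : ℕ) (k : Type u) [Field k] : Scheme.{u} :=
  Proj (MvPolynomial.homogeneousSubmodule (Fin (n + 1)) k)

/-- The structure morphism `ℙ^n → Spec k`. -/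
def projectiveStr (n : ℕ) (k : Type u) [Field k] : projectiveSpace n k ⟶ Spec (.of k) :=
  Proj.toSpecZero (MvPolynomial.homogeneousSubmodule (Fin (n + 1)) k) ≫
    Spec.map (CommRingCat.ofHom
      (algebraMap k (MvPolynomial.homogeneousSubmodule (Fin (n + 1)) k 0)))

/-- A `k`-scheme is projective if it is a closed subscheme of some `ℙ^n`. -/
def IsProjective {k : Type u} [Field k] {X : Scheme.{u}} (str : X ⟶ Spec (.of k)) : Prop :=
  ∃ (n : ℕ) (i : X ⟶ projectiveSpace n k), IsClosedImmersion i ∧ i ≫ projectiveStr n k = str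

/-! ## Divisorial log structures -/

/-- The ideal in `𝒪_{X,x}` of the germs that vanish on the closed set `Z`, i.e. the stalk at `x`
of the radical ideal sheaf of `Z` (the unit ideal if `x ∉ Z`). -/
def stalkIdeal {X : Scheme.{u}} (Z : Set X) (x : X) : Ideal (X.presheaf.stalk x) :=
  PrimeSpectrum.vanishingIdeal ((X.fromSpecStalk x) ⁻¹' Z)

/-- The log structure of a pair `(X, D)`: over an open `U`, the functions on `U` that are
invertible on `U \ D`. -/
def logStructure {X : Scheme.{u}} (D : Set X) (U : X.Opens) : Set Γ(X, U) :=
  {s | ∀ x ∈ U, x ∉ D → x ∈ X.basicOpen s}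

/-- `f : Y → X` is a morphism of the log schemes of `(Y, E)` and `(X, D)`: the pullback of
functions maps the log structure of `X` to the one of `Y`. -/
def IsLogMorphism {Y X : Scheme.{u}} (f : Y ⟶ X) (E : Set Y) (D : Set X) : Prop :=
  ∀ (U : X.Opens), ∀ s ∈ logStructure D U, f.app U s ∈ logStructure E (f ⁻¹ᵁ U)

/-- `D = ⋃ Δ_i` is a strict normal crossings divisor with irreducible components `Δ_i`: the `Δ_i`
are distinct irreducible closed subsets and at every point `x` the ideals of the `Δ_i` through
`x` are generated by single elements `t_i` whose classes in the cotangent space `𝔪 / 𝔪²` are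
linearly independent. To be used on regular schemes, where this says that the `t_i` are part of
a regular system of parameters. -/
structure IsSNC {X : Scheme.{u}} {ι : Type} (Δ : ι → TopologicalSpace.Closeds X) : Prop where
  injective : Function.Injective Δ
  irreducible : ∀ i, IsIrreducible (Δ i : Set X)
  parameters : ∀ x : X, ∃ t : {i // x ∈ Δ i} → IsLocalRing.maximalIdeal (X.presheaf.stalk x),
    (∀ i, stalkIdeal (Δ i.1 : Set X) x = Ideal.span {(t i : X.presheaf.stalk x)}) ∧
    LinearIndependent (IsLocalRing.ResidueField (X.presheaf.stalk x))
      (fun i => (IsLocalRing.maximalIdeal (X.presheaf.stalk x)).toCotangent (t i))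

/-! ## Campana orbifolds -/

/-- A Campana orbifold over `k`: a smooth projective variety `X` with a strict normal crossings
divisor `Δ = ⋃ Δ_i` and multiplicities `m_i ∈ {1, 2, …} ∪ {∞}`, which encode the `ℚ`-divisor
`Δ_ε = ∑ (1 - 1 / m_i) Δ_i`. -/
structure Orbifold (k : Type u) [Field k] where
  X : Scheme.{u}
  str : X ⟶ Spec (.of k)
  isIntegral : IsIntegral X
  smooth : Smooth str
  projective : IsProjective str
  ι : Type
  finite : Finite ι
  Δ : ι → TopologicalSpace.Closeds X
  snc : IsSNC Δ
  mult : ι → ℕ∞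
  one_le_mult : ∀ i, 1 ≤ mult i

namespace Orbifold

variable {k : Type u} [Field k] (O : Orbifold k)

/-- The support `⋃ Δ_i` of the boundary. -/
def boundary : Set O.X := ⋃ i, (O.Δ i : Set O.X)

/-- The orbifold is klt if all multiplicities are finite. -/
def IsKlt : Prop := ∀ i, O.mult i ≠ ⊤

/-- A collection of contact orders `c_{j,i}` (at the `j`-th marking along `Δ_i`) is of Campana
type. -/
def IsCampanaType {n : ℕ} (c : Fin n → O.ι → ℕ) : Prop :=
  ∀ i, (O.mult i ≠ ⊤ → ∀ j, c j i = 0 ∨ O.mult i ≤ (c j i : ℕ∞)) ∧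
    (O.mult i = ⊤ → ∀ j j', 0 < c j i → 0 < c j' i → j = j')

/-- A family, over a variety `W`, of non-degenerate genus zero stable log maps to `X` with `n`
markings of contact orders `c`, whose underlying family of curves is `W × ℙ^1 → W`. Since the
log structure of `W` is trivial, the log structure of the family of curves is the divisorial one
of the markings. -/
structure LogFamily {n : ℕ} (c : Fin n → O.ι → ℕ) where
  W : Scheme.{u}
  strW : W ⟶ Spec (.of k)
  isIntegral : IsIntegral W
  isSeparated : IsSeparated strW
  locallyOfFiniteType : LocallyOfFiniteType strW
  quasiCompact : QuasiCompact strW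
  /-- the markings, disjoint sections of `W × ℙ^1 → W` -/
  mark : Fin n → (W ⟶ pullback strW (projectiveStr 1 k))
  mark_fst : ∀ j, mark j ≫ pullback.fst strW (projectiveStr 1 k) = 𝟙 W
  mark_disjoint : ∀ j j', j ≠ j' → Disjoint (Set.range (mark j)) (Set.range (mark j'))
  /-- the evaluation morphism, the log map on the total space of the family -/
  ev : pullback strW (projectiveStr 1 k) ⟶ O.X
  ev_str : ev ≫ O.str = pullback.fst strW (projectiveStr 1 k) ≫ strW
  isLogMorphism : IsLogMorphism ev (⋃ j, Set.range (mark j)) O.boundary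
  /-- the contact orders: `ev^* Δ_i = ∑ j, c_{j,i} p_j` as divisors on `W × ℙ^1` -/
  contact : ∀ i, ∀ x : (pullback strW (projectiveStr 1 k) : Scheme.{u}),
    (stalkIdeal (O.Δ i : Set O.X) (ev x)).map (ev.stalkMap x).hom =
      ∏ j, stalkIdeal (Set.range (mark j)) x ^ c j i
  /-- stability of the underlying maps: on each fibre the map is not constant, or there are at
  least three markings -/
  stable : ∀ w : W, 3 ≤ n ∨
    ¬ (ev '' (pullback.fst strW (projectiveStr 1 k) ⁻¹' {w})).Subsingleton

end Orbifold

/-! ## Separable dominant morphisms -/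

/-- A field extension is separable (separably generated): it is separable algebraic over a purely
transcendental extension. -/
def IsSeparablyGenerated (K L : Type u) [Field K] [Field L] (φ : K →+* L) : Prop :=
  letI := φ.toAlgebra
  ∃ s : Set L, IsTranscendenceBasis K ((↑) : s → L) ∧
    Algebra.IsSeparable (IntermediateField.adjoin K s) L

lemma genericPoint_specializes_genericPoint {Y Z : Scheme.{u}} [IsIntegral Y] [IsIntegral Z]
    (f : Y ⟶ Z) [IsDominant f] : f (genericPoint Y) ⤳ genericPoint Z := by
  have h : IsGenericPoint (f (genericPoint Y)) Set.univ := by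
    have := (genericPoint_spec Y).image f.continuous
    rwa [Set.image_univ, f.denseRange.closure_range] at this
  exact h.specializes (Set.mem_univ _)

/-- The extension of function fields `k(Z) → k(Y)` of a dominant morphism `Y → Z`. -/
def functionFieldMap {Y Z : Scheme.{u}} [IsIntegral Y] [IsIntegral Z] (f : Y ⟶ Z)
    [IsDominant f] : Z.functionField →+* Y.functionField :=
  (Z.presheaf.stalkSpecializes (genericPoint_specializes_genericPoint f) ≫
    f.stalkMap (genericPoint Y)).hom

/-- A morphism of varieties is dominant and separable: it is dominant and the extension of
function fields is separable. -/
def IsDominantSeparable {Y Z : Scheme.{u}} (f : Y ⟶ Z) : Prop :=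
  ∃ (_ : IsIntegral Y) (_ : IsIntegral Z) (_ : IsDominant f),
    IsSeparablyGenerated Z.functionField Y.functionField (functionFieldMap f)

namespace Orbifold

variable {k : Type u} [Field k] (O : Orbifold k)

/-- The two-point evaluation morphism `ev^(2) : U ×_W U → X × X`, for `U = W × ℙ^1`. -/
def LogFamily.ev₂ {O : Orbifold k} {n : ℕ} {c : Fin n → O.ι → ℕ} (F : O.LogFamily c) :
    pullback (pullback.fst F.strW (projectiveStr 1 k)) (pullback.fst F.strW (projectiveStr 1 k)) ⟶
      pullback O.str O.str :=
  pullback.lift (pullback.fst _ _ ≫ F.ev) (pullback.snd _ _ ≫ F.ev) (by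
    rw [Category.assoc, Category.assoc, F.ev_str, pullback.condition_assoc])

/-- `X` is separably rationally connected with respect to the collection `c` of contact orders. -/
def IsSeparablyRationallyConnected {n : ℕ} (c : Fin n → O.ι → ℕ) : Prop :=
  ∃ F : O.LogFamily c, IsDominantSeparable F.ev₂

/-- The orbifold is separably Campana rationally connected by good contact orders: there is a
collection of positive contact orders of Campana type, none of them divisible by the
characteristic, with respect to which `X` is separably rationally connected. -/
def IsSeparablyCampanaRationallyConnectedByGoodContactOrders : Prop :=
  ∃ (n : ℕ) (c : Fin n → O.ι → ℕ),
    (∀ j, c j ≠ 0) ∧ O.IsCampanaType c ∧ (∀ j, ¬ ∀ i, ringChar k ∣ c j i) ∧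
      O.IsSeparablyRationallyConnected c

end Orbifold

end

end Campana

namespace Campana

open scoped TensorProduct

noncomputable section

/-! ## Rational cones -/

/-- The pairing of a character with a lattice vector. -/
def intPairing {d : ℕ} (m u : Fin d → ℤ) : ℤ := ∑ i, m i * u i

lemma pairing_intCast {d : ℕ} (m u : Fin d → ℤ) :
    pairing m (fun i => (u i : ℝ)) = (intPairing m u : ℝ) := by
  simp [pairing, intPairing]

lemma pairing_vadd {d : ℕ} (m : Fin d → ℤ) (v w : Fin d → ℝ) :
    pairing m (v + w) = pairing m v + pairing m w := (pairingLin m).map_add v w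

lemma pairing_smul {d : ℕ} (m : Fin d → ℤ) (a : ℝ) (v : Fin d → ℝ) :
    pairing m (a • v) = a * pairing m v := (pairingLin m).map_smul a v

lemma pairing_zero_right {d : ℕ} (m : Fin d → ℤ) : pairing m 0 = 0 := (pairingLin m).map_zero

/-- The face `σ ∩ m^⊥`. -/
def faceCone {d : ℕ} (σ : PointedCone ℝ (Fin d → ℝ)) (m : Fin d → ℤ) :
    PointedCone ℝ (Fin d → ℝ) :=
  σ ⊓ (LinearMap.ker (pairingLin m)).restrictScalars _

lemma mem_faceCone {d : ℕ} {σ : PointedCone ℝ (Fin d → ℝ)} {m : Fin d → ℤ} {v : Fin d → ℝ} :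
    v ∈ faceCone σ m ↔ v ∈ σ ∧ pairing m v = 0 := Iff.rfl

lemma faceCone_le {d : ℕ} (σ : PointedCone ℝ (Fin d → ℝ)) (m : Fin d → ℤ) :
    faceCone σ m ≤ σ := fun _ hv => hv.1

lemma isFace_faceCone {d : ℕ} {σ : PointedCone ℝ (Fin d → ℝ)} {m : Fin d → ℤ}
    (hm : m ∈ dualMonoid σ) : IsFace (faceCone σ m) σ := ⟨m, hm, fun _ => mem_faceCone⟩

lemma mem_dualMonoid_hull {d : ℕ} {S : Set (Fin d → ℝ)} {m : Fin d → ℤ}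
    (h : ∀ v ∈ S, 0 ≤ pairing m v) : m ∈ dualMonoid (PointedCone.hull ℝ S) := by
  intro v hv
  induction hv using Submodule.span_induction with
  | mem x hx => exact h x hx
  | zero => rw [pairing_zero_right]
  | add x y _ _ hx hy => rw [pairing_vadd]; exact add_nonneg hx hy
  | smul a x _ hx =>
    change 0 ≤ pairing m ((a : ℝ) • x)
    rw [pairing_smul]; exact mul_nonneg a.2 hx

lemma exists_int_pos_of_exists_real_pos {d : ℕ} (S : Finset (Fin d → ℤ)) (y : Fin d → ℝ)
    (hy : ∀ u ∈ S, 0 < ∑ i, y i * (u i : ℝ)) : ∃ m : Fin d → ℤ, ∀ u ∈ S, 0 < intPairing m u := by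
  have hopen : IsOpen (⋂ u ∈ S, {y : Fin d → ℝ | 0 < ∑ i, y i * (u i : ℝ)}) := by
    refine isOpen_biInter_finset fun u _ => isOpen_lt continuous_const ?_
    fun_prop
  have hdense : DenseRange (Pi.map (fun _ => ((↑) : ℚ → ℝ)) : (Fin d → ℚ) → (Fin d → ℝ)) :=
    DenseRange.piMap fun _ => Rat.denseRange_cast
  obtain ⟨q, hq⟩ := hdense.exists_mem_open hopen ⟨y, by simpa using hy⟩
  simp only [Set.mem_iInter, Set.mem_ofPred_eq, Pi.map_apply] at hq
  obtain ⟨b, hb⟩ := IsLocalization.exist_integer_multiples_of_finset (nonZeroDivisors ℤ)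
    (Finset.univ.image q)
  have hb' : ∀ i, ∃ z : ℤ, (z : ℚ) = |(b : ℤ)| * q i := by
    intro i
    obtain ⟨z, hz⟩ := hb (q i) (by simp)
    have hz' : (z : ℚ) = (b : ℤ) * q i := by simpa [Algebra.smul_def] using hz
    rcases abs_choice (b : ℤ) with h | h
    · exact ⟨z, by rw [h, hz']⟩
    · exact ⟨-z, by rw [h]; push_cast; rw [hz']; ring⟩
  choose m hm using hb'
  have hbpos : (0 : ℝ) < |(b : ℤ)| := by
    exact_mod_cast abs_pos.2 (nonZeroDivisors.coe_ne_zero b)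
  refine ⟨m, fun u hu => ?_⟩
  have h1 := mul_pos hbpos (hq u hu)
  have h2 : ((intPairing m u : ℤ) : ℝ) = (|(b : ℤ)| : ℤ) * ∑ i, (q i : ℝ) * (u i : ℝ) := by
    rw [intPairing, Finset.mul_sum]
    push_cast
    refine Finset.sum_congr rfl fun i _ => ?_
    have : ((m i : ℚ) : ℝ) = ((|(b : ℤ)| : ℤ) : ℝ) * (q i : ℝ) := by
      rw [hm i]; push_cast; rfl
    rw [← mul_assoc, show ((m i : ℤ) : ℝ) = ((m i : ℚ) : ℝ) by push_cast; rfl, this]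
    push_cast; rfl
  have h3 : (0 : ℝ) < (intPairing m u : ℤ) := by rw [h2]; exact h1
  exact_mod_cast h3

/-- A strongly convex rational cone has an integral functional that is positive away from `0`. -/
lemma exists_pos_dualMonoid {d : ℕ} {σ : PointedCone ℝ (Fin d → ℝ)}
    (hσ : IsRationalPolyhedral σ) (hs : ∀ v ∈ σ, -v ∈ σ → v = 0) :
    ∃ m ∈ dualMonoid σ, ∀ v ∈ σ, pairing m v = 0 → v = 0 := by
  classical
  obtain ⟨S, rfl⟩ := hσ
  set c : (Fin d → ℤ) → (Fin d → ℝ) := fun u i => (u i : ℝ) with hc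
  set σ := PointedCone.hull ℝ (c '' (S : Set (Fin d → ℤ))) with hσ
  set S' := S.filter fun u => c u ≠ 0 with hS'
  have hmem : ∀ u ∈ S, c u ∈ σ := fun u hu => Submodule.subset_span ⟨u, hu, rfl⟩
  have hsmul : ∀ (a : ℝ), 0 ≤ a → ∀ v ∈ σ, a • v ∈ σ := fun a ha v hv =>
    σ.smul_mem ha hv
  have hconv : Convex ℝ {v | v ∈ σ ∧ v ≠ 0} := by
    rintro x ⟨hx, hx0⟩ y ⟨hy, hy0⟩ a b ha hb hab
    refine ⟨add_mem (hsmul a ha x hx) (hsmul b hb y hy), fun h => ?_⟩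
    have h1 : a • x = 0 := by
      refine hs _ (hsmul a ha x hx) ?_
      rw [show -(a • x) = b • y from neg_eq_of_add_eq_zero_right h]
      exact hsmul b hb y hy
    have h2 : b • y = 0 := by rw [h1, zero_add] at h; exact h
    rcases smul_eq_zero.1 h1 with rfl | h
    · rcases smul_eq_zero.1 h2 with rfl | h
      · norm_num at hab
      · exact hy0 h
    · exact hx0 h
  have hsub : convexHull ℝ (c '' (S' : Set (Fin d → ℤ))) ⊆ {v | v ∈ σ ∧ v ≠ 0} := by
    refine convexHull_min ?_ hconv
    rintro _ ⟨u, hu, rfl⟩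
    rw [Finset.mem_coe, Finset.mem_filter] at hu
    exact ⟨hmem u hu.1, hu.2⟩
  have hcomp : IsCompact (convexHull ℝ (c '' (S' : Set (Fin d → ℤ)))) :=
    (S'.finite_toSet.image c).isCompact_convexHull ℝ
  obtain ⟨f, r, hr0, hr⟩ := geometric_hahn_banach_point_closed (x := (0 : Fin d → ℝ))
    (convex_convexHull ℝ (c '' (S' : Set (Fin d → ℤ)))) hcomp.isClosed
    (fun h => (hsub h).2 rfl)
  rw [map_zero] at hr0
  obtain ⟨m, hm⟩ := exists_int_pos_of_exists_real_pos S' (fun i => f (Pi.single i 1)) (by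
    intro u hu
    have h1 := hr0.trans (hr (c u) (subset_convexHull ℝ _ ⟨u, hu, rfl⟩))
    have h2 : f (c u) = ∑ i, f (Pi.single i 1) * (u i : ℝ) := by
      conv_lhs => rw [pi_eq_sum_univ' (c u)]
      rw [map_sum]
      refine Finset.sum_congr rfl fun i _ => ?_
      rw [map_smul, smul_eq_mul, mul_comm]
    rwa [h2] at h1)
  have key : ∀ v ∈ σ, 0 < pairing m v ∨ v = 0 := by
    intro v hv
    induction hv using Submodule.span_induction with
    | mem x hx =>
      obtain ⟨u, hu, rfl⟩ := hx
      by_cases h : c u = 0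
      · exact Or.inr h
      · left
        rw [hc, pairing_intCast]
        exact_mod_cast hm u (Finset.mem_filter.2 ⟨hu, h⟩)
    | zero => exact Or.inr rfl
    | add x y _ _ hx hy =>
      rcases hx with hx | rfl
      · rcases hy with hy | rfl
        · left; rw [pairing_vadd]; exact add_pos hx hy
        · left; rwa [add_zero]
      · rwa [zero_add]
    | smul a x _ hx =>
      change 0 < pairing m ((a : ℝ) • x) ∨ (a : ℝ) • x = 0
      rcases hx with hx | rfl
      · rcases a.2.eq_or_lt with h | h
        · right; rw [← h, zero_smul]
        · left; rw [pairing_smul]; exact mul_pos h hx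
      · right; rw [smul_zero]
  refine ⟨m, fun v hv => ?_, fun v hv h => ?_⟩
  · rcases key v hv with h | rfl
    · exact h.le
    · rw [pairing_zero_right]
  · rcases key v hv with h' | rfl
    · exact absurd h h'.ne'
    · rfl

namespace Fan

variable {d : ℕ} (F : Fan d)

lemma isFace_bot {σ : PointedCone ℝ (Fin d → ℝ)} (hσ : σ ∈ F.cones) : IsFace ⊥ σ := by
  obtain ⟨m, hm, h⟩ := exists_pos_dualMonoid (F.rational σ hσ) (F.stronglyConvex σ hσ)
  refine ⟨m, hm, fun v => ⟨?_, fun hv => h v hv.1 hv.2⟩⟩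
  rintro rfl
  exact ⟨zero_mem _, pairing_zero_right m⟩

lemma bot_mem : ⊥ ∈ F.cones := by
  obtain ⟨σ, hσ⟩ := F.nonempty
  exact F.face_mem σ hσ ⊥ (F.isFace_bot hσ)

/-- The cone `{0}` of the fan. -/
def zeroCone : F.cones := ⟨⊥, F.bot_mem⟩

/-- Every nonzero cone of a fan contains a ray of the fan. -/
lemma exists_ray_le {τ : PointedCone ℝ (Fin d → ℝ)} (hτ : τ ∈ F.cones) (h0 : τ ≠ ⊥) :
    ∃ ρ ∈ F.rays, ρ.1 ≤ τ := by
  have hfin : {ρ | ρ ∈ F.cones ∧ ρ ≤ τ ∧ ρ ≠ ⊥}.Finite := F.finite.subset fun _ h => h.1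
  obtain ⟨ρ, ⟨hρ, hρτ, hρ0⟩, hmin⟩ := hfin.exists_minimal ⟨τ, hτ, le_rfl, h0⟩
  refine ⟨⟨ρ, hρ⟩, ?_, hρτ⟩
  obtain ⟨m, hm, hpos⟩ := exists_pos_dualMonoid (F.rational ρ hρ) (F.stronglyConvex ρ hρ)
  obtain ⟨S, hS⟩ := F.rational ρ hρ
  set c : (Fin d → ℤ) → (Fin d → ℝ) := fun u i => (u i : ℝ) with hc
  have hmem : ∀ u ∈ S, c u ∈ ρ := fun u hu => by
    rw [hS]; exact Submodule.subset_span ⟨u, hu, rfl⟩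
  obtain ⟨u₀, hu₀, hu₀0⟩ : ∃ u ∈ S, c u ≠ 0 := by
    by_contra! h
    refine hρ0 (le_bot_iff.1 ?_)
    rw [hS]
    refine Submodule.span_le.2 ?_
    rintro _ ⟨u, hu, rfl⟩
    exact h u hu
  have hmpos : ∀ u ∈ S, c u ≠ 0 → 0 < intPairing m u := by
    intro u hu h
    have h1 : 0 < pairing m (c u) :=
      lt_of_le_of_ne (hm _ (hmem u hu)) fun h' => h (hpos _ (hmem u hu) h'.symm)
    rw [hc, pairing_intCast] at h1
    exact_mod_cast h1
  have hprop : ∀ u ∈ S, ∀ i, u i * intPairing m u₀ = u₀ i * intPairing m u := by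
    classical
    intro u₁ hu₁ i
    obtain ⟨us, hus, hmin'⟩ := (S.filter fun u => c u ≠ 0).exists_min_image
      (fun u => (u i : ℚ) / (intPairing m u : ℚ)) ⟨u₀, Finset.mem_filter.2 ⟨hu₀, hu₀0⟩⟩
    rw [Finset.mem_filter] at hus
    have hmus := hmpos us hus.1 hus.2
    set l : Fin d → ℤ := intPairing m us • Pi.single i 1 - us i • m with hl
    have hlp : ∀ u, intPairing l u = intPairing m us * u i - us i * intPairing m u := by
      intro u
      simp only [hl, intPairing, Pi.sub_apply, Pi.smul_apply, smul_eq_mul, sub_mul,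
        Finset.sum_sub_distrib]
      rw [Finset.sum_eq_single i (by intro j _ hj; simp [Pi.single_eq_of_ne hj]) (by simp)]
      simp [Finset.mul_sum, mul_assoc]
    have hle : l ∈ dualMonoid ρ := by
      rw [hS]
      refine mem_dualMonoid_hull ?_
      rintro _ ⟨u, hu, rfl⟩
      rw [pairing_intCast, hlp]
      by_cases h : c u = 0
      · have hu0 : u = 0 := by
          ext j
          have := congrFun h j
          simpa [hc] using this
        subst hu0
        simp [intPairing]
      · have h1 := hmin' u (Finset.mem_filter.2 ⟨hu, h⟩)
        have h2 := hmpos u hu h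
        have hc1 : (0 : ℚ) < intPairing m us := by exact_mod_cast hmus
        have hc2 : (0 : ℚ) < intPairing m u := by exact_mod_cast h2
        rw [div_le_div_iff₀ hc1 hc2] at h1
        have h3 : us i * intPairing m u ≤ u i * intPairing m us := by exact_mod_cast h1
        have : (0 : ℤ) ≤ intPairing m us * u i - us i * intPairing m u := by linarith
        exact_mod_cast this
    have hface : faceCone ρ l ∈ F.cones := F.face_mem ρ hρ _ (isFace_faceCone hle)
    have hne : faceCone ρ l ≠ ⊥ := by
      intro h
      refine hus.2 ?_
      have : c us ∈ faceCone ρ l := by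
        refine mem_faceCone.2 ⟨hmem us hus.1, ?_⟩
        rw [pairing_intCast, hlp]
        push_cast; ring
      rw [h] at this
      exact this
    have heq : ρ ≤ faceCone ρ l :=
      hmin ⟨hface, (faceCone_le ρ l).trans hρτ, hne⟩ (faceCone_le ρ l)
    have hz : ∀ u ∈ S, intPairing m us * u i = us i * intPairing m u := by
      intro u hu
      have := (mem_faceCone.1 (heq (hmem u hu))).2
      rw [pairing_intCast, hlp] at this
      have h' : intPairing m us * u i - us i * intPairing m u = 0 := by exact_mod_cast this
      linarith
    have e1 := hz u₁ hu₁
    have e0 := hz u₀ hu₀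
    refine mul_left_cancel₀ hmus.ne' ?_
    linear_combination (intPairing m u₀) * e1 - (intPairing m u₁) * e0
  have hspan : Submodule.span ℝ (ρ : Set (Fin d → ℝ)) = Submodule.span ℝ {c u₀} := by
    refine le_antisymm (Submodule.span_le.2 fun v hv => ?_)
      (Submodule.span_mono (Set.singleton_subset_iff.2 (hmem u₀ hu₀)))
    rw [SetLike.mem_coe, hS] at hv
    induction hv using Submodule.span_induction with
    | mem x hx =>
      obtain ⟨u, hu, rfl⟩ := hx
      refine Submodule.mem_span_singleton.2
        ⟨(intPairing m u : ℝ) / (intPairing m u₀ : ℝ), ?_⟩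
      have h0 : ((intPairing m u₀ : ℤ) : ℝ) ≠ 0 := by
        exact_mod_cast (hmpos u₀ hu₀ hu₀0).ne'
      ext i
      have := hprop u hu i
      have h' : ((u i : ℤ) : ℝ) * (intPairing m u₀ : ℤ) = (u₀ i : ℤ) * (intPairing m u : ℤ) := by
        exact_mod_cast this
      simp only [hc, Pi.smul_apply, smul_eq_mul]
      field_simp
      linarith
    | zero => exact zero_mem _
    | add x y _ _ hx hy => exact add_mem hx hy
    | smul a x _ hx => exact Submodule.smul_mem _ (a : ℝ) hx
  change Module.finrank ℝ (Submodule.span ℝ (ρ : Set (Fin d → ℝ))) = 1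
  rw [hspan]
  exact finrank_span_singleton hu₀0

end Fan

namespace Fan

variable {d : ℕ} (F : Fan d) (k : Type u) [Field k]

instance (σ : F.cones) : IsOpenImmersion (F.chartι k σ) :=
  inferInstanceAs (IsOpenImmersion (colimit.ι (F.diagram k) σ))

lemma exists_chartι_eq (x : F.toricVariety k) : ∃ σ, ∃ p, F.chartι k σ p = x :=
  Scheme.IsLocallyDirected.ι_jointly_surjective (F.diagram k) x

lemma map_chartι {τ σ : F.cones} (f : τ ⟶ σ) :
    (F.diagram k).map f ≫ F.chartι k σ = F.chartι k τ := colimit.w _ f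

lemma SpecMap_chartMap_chartι {τ σ : F.cones} (h : τ.1 ≤ σ.1) :
    Spec.map (CommRingCat.ofHom (chartMap k h)) ≫ F.chartι k σ = F.chartι k τ :=
  F.map_chartι k (homOfLE h)

lemma chartι_comap {τ σ : F.cones} (h : τ.1 ≤ σ.1)
    (q : PrimeSpectrum (AddMonoidAlgebra k (dualMonoid τ.1))) :
    F.chartι k σ (PrimeSpectrum.comap (chartMap k h) q) = F.chartι k τ q :=
  congrArg (fun f : chart k τ.1 ⟶ F.toricVariety k => f q) (F.SpecMap_chartMap_chartι k h)

lemma chartι_toricStr (σ : F.cones) : F.chartι k σ ≫ F.toricStr k =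
    Spec.map (CommRingCat.ofHom (algebraMap k (AddMonoidAlgebra k (dualMonoid σ.1)))) :=
  colimit.ι_desc _ _

lemma zeroCone_le (σ : F.cones) : F.zeroCone.1 ≤ σ.1 := bot_le

/-- The torus as a subset of the toric variety. -/
def torus : Set (F.toricVariety k) := Set.range (F.chartι k F.zeroCone)

lemma isOpen_torus : IsOpen (F.torus k) := (F.chartι k F.zeroCone).isOpenEmbedding.isOpen_range

/-- In the chart of `σ`, the torus is where a character positive on `σ \ {0}` does not vanish. -/
lemma chartι_mem_torus_iff {σ : F.cones} {m : Fin d → ℤ} (hm : m ∈ dualMonoid σ.1)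
    (h0 : ∀ v ∈ σ.1, pairing m v = 0 → v = 0)
    (p : PrimeSpectrum (AddMonoidAlgebra k (dualMonoid σ.1))) :
    F.chartι k σ p ∈ F.torus k ↔
      AddMonoidAlgebra.single (⟨m, hm⟩ : dualMonoid σ.1) (1 : k) ∉ p.asIdeal := by
  have hr := F.range_diagram_map k (homOfLE (F.zeroCone_le σ) : F.zeroCone ⟶ σ) hm (by
    intro v
    constructor
    · intro hv
      obtain rfl : v = 0 := hv
      exact ⟨zero_mem _, pairing_zero_right m⟩
    · exact fun hv => h0 v hv.1 hv.2)
  rw [← PrimeSpectrum.mem_basicOpen, ← SetLike.mem_coe, ← hr]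
  constructor
  · rintro ⟨q, hq⟩
    refine ⟨q, (F.chartι k σ).isOpenEmbedding.injective ?_⟩
    exact (F.chartι_comap k (F.zeroCone_le σ) q).trans hq
  · rintro ⟨q, rfl⟩
    exact ⟨q, (F.chartι_comap k (F.zeroCone_le σ) q).symm⟩

lemma disjoint_torus_toricDivisor {ρ : F.cones} (hρ : ρ ∈ F.rays) :
    Disjoint (F.torus k) (F.toricDivisor k ρ) := by
  refine Disjoint.closure_right (Set.disjoint_left.2 ?_) (F.isOpen_torus k)
  rintro _ hx ⟨p, hp, rfl⟩
  obtain ⟨m, hm, h0⟩ := exists_pos_dualMonoid (F.rational _ ρ.2) (F.stronglyConvex _ ρ.2)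
  refine (F.chartι_mem_torus_iff k hm h0 p).1 hx (hp ⟨⟨m, hm⟩, ?_, rfl⟩)
  by_contra! h
  have : (ρ.1 : Set (Fin d → ℝ)) ⊆ {0} := fun v hv => h0 v hv (h v hv)
  change Module.finrank ℝ (Submodule.span ℝ (ρ.1 : Set (Fin d → ℝ))) = 1 at hρ
  rw [Submodule.span_eq_bot.2 (fun v hv => this hv), finrank_bot] at hρ
  exact zero_ne_one hρ

lemma single_mul_mem_iff {σ : PointedCone ℝ (Fin d → ℝ)}
    (p : PrimeSpectrum (AddMonoidAlgebra k (dualMonoid σ))) (a b : dualMonoid σ) :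
    (AddMonoidAlgebra.single (a + b) (1 : k)) ∈ p.asIdeal ↔
      AddMonoidAlgebra.single a (1 : k) ∈ p.asIdeal ∨
      AddMonoidAlgebra.single b (1 : k) ∈ p.asIdeal := by
  rw [← p.isPrime.mul_mem_iff_mem_or_mem, AddMonoidAlgebra.single_mul_single, one_mul]

/-- If all characters of `σ^∨` that are nonzero on the ray `ρ` of `σ` vanish at `p`,
then `p` lies in `Δ_ρ`. -/
lemma chartι_mem_toricDivisor {ρ σ : F.cones} (h : ρ.1 ≤ σ.1)
    (p : PrimeSpectrum (AddMonoidAlgebra k (dualMonoid σ.1)))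
    (hp : ∀ m : dualMonoid σ.1, (∃ v ∈ ρ.1, pairing m.1 v ≠ 0) →
      AddMonoidAlgebra.single m (1 : k) ∈ p.asIdeal) :
    F.chartι k σ p ∈ F.toricDivisor k ρ := by
  have horb : F.orbit k ρ = PrimeSpectrum.zeroLocus (Ideal.span (AddMonoidAlgebra.of' k _ ''
      {m : dualMonoid ρ.1 | ∃ v ∈ ρ.1, pairing m.1 v ≠ 0}) :
        Set (AddMonoidAlgebra k (dualMonoid ρ.1))) := by
    rw [PrimeSpectrum.zeroLocus_span, orbit]
    congr 1
    ext f
    constructor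
    · rintro ⟨m, hm, rfl⟩
      exact ⟨m, hm, rfl⟩
    · rintro ⟨m, hm, rfl⟩
      exact ⟨m, hm, rfl⟩
  have hcl : p ∈ closure (PrimeSpectrum.comap (chartMap k h) '' F.orbit k ρ) := by
    rw [horb, PrimeSpectrum.closure_image_comap_zeroLocus]
    intro f hf
    rw [SetLike.mem_coe, Ideal.mem_comap, AddMonoidAlgebra.mem_ideal_span_of'_image] at hf
    rw [SetLike.mem_coe, ← AddMonoidAlgebra.sum_coeff_single f]
    refine Ideal.sum_mem _ fun a ha => ?_
    have hinj := AddSubmonoid.inclusion_injective (dualMonoid_anti h)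
    have hco : (chartMap k h f).coeff (AddSubmonoid.inclusion (dualMonoid_anti h) a) =
        f.coeff a := by
      change (Finsupp.mapDomain _ f.coeff) _ = _
      exact Finsupp.mapDomain_apply hinj _ _
    obtain ⟨m', ⟨v, hv, hne⟩, e, hae⟩ := hf (AddSubmonoid.inclusion (dualMonoid_anti h) a) (by
      rw [Finsupp.mem_support_iff, hco]; exact Finsupp.mem_support_iff.1 ha)
    have hae' : a.1 = e.1 + m'.1 := congrArg Subtype.val hae
    have hmem := hp a ⟨v, hv, by
      rw [hae', pairing_add]
      have h1 := e.2 v hv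
      have h2 : 0 < pairing m'.1 v := lt_of_le_of_ne (m'.2 v hv) (Ne.symm hne)
      exact (add_pos_of_nonneg_of_pos h1 h2).ne'⟩
    have := Ideal.mul_mem_left p.asIdeal (AddMonoidAlgebra.single 0 (f.coeff a)) hmem
    rwa [AddMonoidAlgebra.single_mul_single, zero_add, mul_one] at this
  have h1 := image_closure_subset_closure_image (F.chartι k σ).continuous ⟨p, hcl, rfl⟩
  refine closure_mono ?_ h1
  rintro _ ⟨_, ⟨q, hq, rfl⟩, rfl⟩
  exact ⟨q, hq, (F.chartι_comap k h q).symm⟩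

/-- A point outside the torus lies on some toric divisor. -/
lemma exists_mem_toricDivisor (x : F.toricVariety k) (hx : x ∉ F.torus k) :
    ∃ ρ ∈ F.rays, x ∈ F.toricDivisor k ρ := by
  obtain ⟨σ, p, rfl⟩ := F.exists_chartι_eq k x
  let p' : PrimeSpectrum (AddMonoidAlgebra k (dualMonoid σ.1)) := p
  obtain ⟨m₀, hm₀, h₀⟩ := exists_pos_dualMonoid (F.rational _ σ.2) (F.stronglyConvex _ σ.2)
  have hx' : AddMonoidAlgebra.single (⟨m₀, hm₀⟩ : dualMonoid σ.1) (1 : k) ∈ p'.asIdeal := by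
    have := (F.chartι_mem_torus_iff k hm₀ h₀ p').not.1 hx
    rwa [not_not] at this
  have hfin : {τ | ∃ m : dualMonoid σ.1, AddMonoidAlgebra.single m (1 : k) ∉ p'.asIdeal ∧
      τ = faceCone σ.1 m.1}.Finite := by
    refine F.finite.subset ?_
    rintro _ ⟨m, -, rfl⟩
    exact F.face_mem _ σ.2 _ (isFace_faceCone m.2)
  obtain ⟨τ, ⟨mG, hmG, rfl⟩, hmin⟩ := hfin.exists_minimal
    ⟨_, 0, by rw [← AddMonoidAlgebra.one_def]; exact (Ideal.ne_top_iff_one _).1 p'.isPrime.ne_top,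
      rfl⟩
  have hτ : faceCone σ.1 mG.1 ∈ F.cones := F.face_mem _ σ.2 _ (isFace_faceCone mG.2)
  have hvan : ∀ m : dualMonoid σ.1, AddMonoidAlgebra.single m (1 : k) ∉ p'.asIdeal →
      ∀ v ∈ faceCone σ.1 mG.1, pairing m.1 v = 0 := by
    intro m hm v hv
    have hle : faceCone σ.1 (m + mG).1 ≤ faceCone σ.1 mG.1 := by
      intro w hw
      have h1 := m.2 w hw.1
      have h2 := mG.2 w hw.1
      have h3 : pairing (m.1 + mG.1) w = 0 := hw.2
      rw [pairing_add] at h3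
      exact ⟨hw.1, show pairing mG.1 w = 0 by linarith⟩
    have hge := hmin ⟨m + mG, by
      rw [single_mul_mem_iff]; exact not_or.2 ⟨hm, hmG⟩, rfl⟩ hle
    have h3 : pairing (m.1 + mG.1) v = 0 := (hge hv).2
    have h4 : pairing mG.1 v = 0 := hv.2
    rw [pairing_add, h4, add_zero] at h3
    exact h3
  have hne : faceCone σ.1 mG.1 ≠ ⊥ := by
    intro hbot
    obtain ⟨n, hn⟩ := exists_add_nsmul_mem (τ := ⊥) (F.rational _ σ.2) mG.2
      (by intro v; rw [← hbot]; exact mem_faceCone) (w := -m₀) (by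
        intro v hv
        obtain rfl : v = 0 := hv
        rw [pairing_zero_right])
    have hpow : AddMonoidAlgebra.single (n • mG) (1 : k) ∉ p'.asIdeal := by
      have : AddMonoidAlgebra.single (n • mG) (1 : k) = AddMonoidAlgebra.single mG 1 ^ n := by
        rw [AddMonoidAlgebra.single_pow, one_pow]
      rw [this]
      exact fun h => hmG (p'.isPrime.mem_of_pow_mem n h)
    refine hpow ?_
    have : n • mG = ⟨m₀, hm₀⟩ + ⟨_, hn⟩ := by
      ext i; simp
    rw [this, single_mul_mem_iff]
    exact Or.inl hx'
  obtain ⟨ρ, hρ, hρτ⟩ := F.exists_ray_le hτ hne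
  refine ⟨ρ, hρ, F.chartι_mem_toricDivisor k (hρτ.trans (faceCone_le _ _)) p' fun m => ?_⟩
  rintro ⟨v, hv, hv0⟩
  by_contra hm
  exact hv0 (hvan m hm v (hρτ hv))

/-- The toric boundary is the complement of the torus. -/
lemma toricBoundary_eq_compl : F.toricBoundary k = (F.torus k)ᶜ := by
  ext x
  rw [toricBoundary, Set.mem_iUnion₂, Set.mem_compl_iff]
  constructor
  · rintro ⟨ρ, hρ, hx⟩ hx'
    exact Set.disjoint_left.1 (F.disjoint_torus_toricDivisor k hρ) hx' hx
  · intro hx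
    obtain ⟨ρ, hρ, h⟩ := F.exists_mem_toricDivisor k x hx
    exact ⟨ρ, hρ, h⟩

end Fan

/-! ## Projective schemes are proper -/

lemma isIso_SpecMap_algebraMap_homogeneousSubmodule_zero (n : ℕ) (k : Type u) [Field k] :
    IsIso (Spec.map (CommRingCat.ofHom
      (algebraMap k (MvPolynomial.homogeneousSubmodule (Fin (n + 1)) k 0)))) := by
  have hb : Function.Bijective
      (algebraMap k (MvPolynomial.homogeneousSubmodule (Fin (n + 1)) k 0)) := by
    refine ⟨fun x y h => MvPolynomial.C_injective _ k (congrArg Subtype.val h), fun ⟨x, hx⟩ => ?_⟩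
    rw [MvPolynomial.homogeneousSubmodule_zero, Submodule.mem_one] at hx
    obtain ⟨y, hy⟩ := hx
    exact ⟨y, Subtype.ext hy⟩
  have : IsIso (CommRingCat.ofHom
      (algebraMap k (MvPolynomial.homogeneousSubmodule (Fin (n + 1)) k 0))) :=
    (ConcreteCategory.isIso_iff_bijective _).2 hb
  infer_instance

instance (n : ℕ) (k : Type u) [Field k] : IsProper (projectiveStr n k) := by
  have : Algebra.FiniteType (MvPolynomial.homogeneousSubmodule (Fin (n + 1)) k 0)
      (MvPolynomial (Fin (n + 1)) k) := by
    have : IsScalarTower k (MvPolynomial.homogeneousSubmodule (Fin (n + 1)) k 0)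
      (MvPolynomial (Fin (n + 1)) k) := ⟨fun a b c => smul_mul_assoc a b.1 c⟩
    exact Algebra.FiniteType.of_restrictScalars_finiteType k _ _
  have := isIso_SpecMap_algebraMap_homogeneousSubmodule_zero n k
  have : IsProper (Proj.toSpecZero (MvPolynomial.homogeneousSubmodule (Fin (n + 1)) k)) :=
    inferInstance
  exact MorphismProperty.comp_mem _ _ _ this inferInstance

lemma IsProjective.isProper {k : Type u} [Field k] {X : Scheme.{u}} {str : X ⟶ Spec (.of k)}
    (h : IsProjective str) : IsProper str := by
  obtain ⟨n, i, hi, rfl⟩ := h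
  infer_instance

/-! ## Morphisms to toric varieties -/

/-- The homomorphism `k[σ^∨ ∩ M] → R` given by a monoid homomorphism on characters. -/
def charHom {k : Type u} [Field k] {d : ℕ} (σ : PointedCone ℝ (Fin d → ℝ)) {R : Type u}
    [CommRing R] [Algebra k R] (χ : Multiplicative (dualMonoid σ) →* R) :
    AddMonoidAlgebra k (dualMonoid σ) →ₐ[k] R := AddMonoidAlgebra.lift k R _ χ

lemma charHom_single {k : Type u} [Field k] {d : ℕ} (σ : PointedCone ℝ (Fin d → ℝ)) {R : Type u}
    [CommRing R] [Algebra k R] (χ : Multiplicative (dualMonoid σ) →* R) (m : dualMonoid σ) :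
    charHom (k := k) σ χ (AddMonoidAlgebra.single m 1) = χ (Multiplicative.ofAdd m) := by
  rw [charHom, AddMonoidAlgebra.lift_single, one_smul]

lemma algHom_ext_single {k : Type u} [Field k] {A : Type*} [AddMonoid A] {R : Type*} [CommRing R]
    [Algebra k R] {f g : AddMonoidAlgebra k A →ₐ[k] R}
    (h : ∀ m, f (AddMonoidAlgebra.single m 1) = g (AddMonoidAlgebra.single m 1)) : f = g :=
  AddMonoidAlgebra.algHom_ext h (Subsingleton.elim _ _)

/-- The restriction of a character homomorphism along `σ^∨ ∩ M → M`. -/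
def restrictChar {d : ℕ} (σ : PointedCone ℝ (Fin d → ℝ)) {R : Type*} [CommRing R]
    (χ : Multiplicative (Fin d → ℤ) →* R) : Multiplicative (dualMonoid σ) →* R :=
  χ.comp (AddMonoidHom.toMultiplicative (dualMonoid σ).subtype)

lemma restrictChar_apply {d : ℕ} (σ : PointedCone ℝ (Fin d → ℝ)) {R : Type*} [CommRing R]
    (χ : Multiplicative (Fin d → ℤ) →* R) (m : dualMonoid σ) :
    restrictChar σ χ (Multiplicative.ofAdd m) = χ (Multiplicative.ofAdd m.1) := rfl

section Charts

variable {d : ℕ} (F : Fan d) {k : Type u} [Field k] {X : Scheme.{u}} (e : X ≅ F.toricVariety k)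

/-- The chart `U_σ` of a scheme identified with the toric variety. -/
def chartTo (σ : F.cones) : chart k σ.1 ⟶ X := F.chartι k σ ≫ e.inv

instance (σ : F.cones) : IsOpenImmersion (chartTo F e σ) := by
  unfold chartTo; infer_instance

lemma exists_chartTo_eq (x : X) : ∃ σ, ∃ p, chartTo F e σ p = x := by
  obtain ⟨σ, p, hp⟩ := F.exists_chartι_eq k (e.hom x)
  refine ⟨σ, p, ?_⟩
  rw [chartTo, Scheme.Hom.comp_apply, hp, ← Scheme.Hom.comp_apply, e.hom_inv_id]
  rfl

lemma SpecMap_chartMap_chartTo {τ σ : F.cones} (h : τ.1 ≤ σ.1) :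
    Spec.map (CommRingCat.ofHom (chartMap k h)) ≫ chartTo F e σ = chartTo F e τ := by
  rw [chartTo, ← Category.assoc, F.SpecMap_chartMap_chartι k h, chartTo]

lemma chartTo_comp {str : X ⟶ Spec (.of k)} (he : e.hom ≫ F.toricStr k = str) (σ : F.cones) :
    chartTo F e σ ≫ str =
      Spec.map (CommRingCat.ofHom (algebraMap k (AddMonoidAlgebra k (dualMonoid σ.1)))) := by
  rw [← he, chartTo, Category.assoc, e.inv_hom_id_assoc, F.chartι_toricStr]

/-- The torus in a scheme identified with the toric variety. -/
def torusIn : Set X := Set.range (chartTo F e F.zeroCone)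

lemma torusIn_eq_compl {D : Set X} (hD : e.hom ⁻¹' F.toricBoundary k = D) :
    torusIn F e = Dᶜ := by
  have h1 : (torusIn F e) = e.hom ⁻¹' F.torus k := by
    ext x
    constructor
    · rintro ⟨p, rfl⟩
      refine ⟨p, ?_⟩
      rw [← Scheme.Hom.comp_apply, chartTo, Category.assoc, e.inv_hom_id, Category.comp_id]
    · rintro ⟨p, hp⟩
      refine ⟨p, ?_⟩
      rw [chartTo, Scheme.Hom.comp_apply, hp, ← Scheme.Hom.comp_apply, e.hom_inv_id]
      rfl
  rw [h1, ← hD, F.toricBoundary_eq_compl k, Set.preimage_compl, compl_compl]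

/-- A morphism given by characters of the torus can be computed in every chart. -/
lemma SpecMap_charHom_chartTo {R : Type u} [CommRing R] [Algebra k R]
    (χ : Multiplicative (Fin d → ℤ) →* R) (σ : F.cones) :
    Spec.map (CommRingCat.ofHom (charHom (k := k) σ.1 (restrictChar σ.1 χ)).toRingHom) ≫
        chartTo F e σ =
      Spec.map (CommRingCat.ofHom
        (charHom (k := k) F.zeroCone.1 (restrictChar F.zeroCone.1 χ)).toRingHom) ≫
        chartTo F e F.zeroCone := by
  rw [← SpecMap_chartMap_chartTo F e (F.zeroCone_le σ), ← Spec.map_comp_assoc,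
    ← CommRingCat.ofHom_comp]
  congr 3
  refine AddMonoidAlgebra.ringHom_ext (fun r => ?_) (fun m => ?_)
  · rw [RingHom.comp_apply, chartMap_single]
    change (charHom _ _) _ = (charHom _ _) _
    rw [charHom, charHom, AddMonoidAlgebra.lift_single, AddMonoidAlgebra.lift_single]
    rfl
  · rw [RingHom.comp_apply, chartMap_single]
    change (charHom _ _) _ = (charHom _ _) _
    rw [charHom_single, charHom_single]
    rfl

/-- The characters of a one-parameter subgroup, with values in the Laurent series. -/
def laurentChar (k : Type u) [Field k] (u : Fin d → ℤ) :
    Multiplicative (Fin d → ℤ) →* LaurentSeries k where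
  toFun m := HahnSeries.single (intPairing m.toAdd u) 1
  map_one' := by simp [intPairing]
  map_mul' a b := by
    rw [HahnSeries.single_mul_single, one_mul]
    simp [intPairing, add_mul, Finset.sum_add_distrib]

/-- A proper toric variety has a complete fan: every lattice vector is nonnegative on `σ^∨ ∩ M`
for some cone `σ` of the fan. -/
lemma exists_cone_nonneg {str : X ⟶ Spec (.of k)} (he : e.hom ≫ F.toricStr k = str)
    [UniversallyClosed str] (u : Fin d → ℤ) :
    ∃ σ : F.cones, ∀ m ∈ dualMonoid σ.1, 0 ≤ intPairing m u := by
  have hex : ValuativeCriterion.Existence str :=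
    (UniversallyClosed.eq_valuativeCriterion.le _ _ _ ‹_›).1
  have halg : (algebraMap (PowerSeries k) (LaurentSeries k)).comp
      (algebraMap k (PowerSeries k)) = algebraMap k (LaurentSeries k) := by
    rfl
  let i₁ : Spec (.of (LaurentSeries k)) ⟶ X :=
    Spec.map (CommRingCat.ofHom
        (charHom (k := k) F.zeroCone.1 (restrictChar F.zeroCone.1 (laurentChar k u))).toRingHom) ≫
        chartTo F e F.zeroCone
  let S : ValuativeCommSq str :=
    { R := PowerSeries k
      K := LaurentSeries k
      i₁ := i₁
      i₂ := Spec.map (CommRingCat.ofHom (algebraMap k (PowerSeries k)))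
      commSq := ⟨by
        rw [Category.assoc, chartTo_comp F e he, ← Spec.map_comp, ← Spec.map_comp,
          ← CommRingCat.ofHom_comp, ← CommRingCat.ofHom_comp, halg]
        congr 2
        exact (charHom (k := k) F.zeroCone.1 _).comp_algebraMap⟩ }
  obtain ⟨⟨l, hl, -⟩⟩ := (hex S).exists_lift
  change Spec.map (CommRingCat.ofHom (algebraMap (PowerSeries k) (LaurentSeries k))) ≫ l = i₁ at hl
  change Spec (.of (PowerSeries k)) ⟶ X at l
  obtain ⟨σ, p, hp⟩ := exists_chartTo_eq F e (l (IsLocalRing.closedPoint (PowerSeries k)))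
  refine ⟨σ, fun m hm => ?_⟩
  have hrange : Set.range l ⊆ Set.range (chartTo F e σ) := by
    rintro _ ⟨x, rfl⟩
    have hsp : l x ⤳ l (IsLocalRing.closedPoint (PowerSeries k)) :=
      (IsLocalRing.specializes_closedPoint x).map l.continuous
    exact hsp.mem_open (chartTo F e σ).isOpenEmbedding.isOpen_range ⟨p, hp⟩
  obtain ⟨φ, hφ⟩ := Spec.map_surjective (IsOpenImmersion.lift (chartTo F e σ) l hrange)
  have hl' : Spec.map φ ≫ chartTo F e σ = l := by
    rw [hφ, IsOpenImmersion.lift_fac]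
  rw [← hl', ← Category.assoc, ← (SpecMap_charHom_chartTo F e (laurentChar k u) σ).trans (show _ = i₁ from rfl),
    cancel_mono, ← Spec.map_comp] at hl
  have h2 := congrArg CommRingCat.Hom.hom (Spec.map_injective hl)
  have h3 := congrArg (fun f => f (AddMonoidAlgebra.single (⟨m, hm⟩ : dualMonoid σ.1) 1)) h2
  change algebraMap (PowerSeries k) (LaurentSeries k) (φ.hom _) =
    charHom (k := k) σ.1 _ _ at h3
  rw [charHom_single, restrictChar_apply] at h3
  change _ = HahnSeries.single (intPairing m u) 1 at h3
  by_contra! hneg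
  have h4 := congrArg (fun f : LaurentSeries k => f.coeff (intPairing m u)) h3
  dsimp only at h4
  rw [HahnSeries.coeff_single_same, LaurentSeries.coe_algebraMap, PowerSeries.coeff_coe,
    if_pos hneg] at h4
  exact zero_ne_one h4

end Charts

/-! ## Locally principal ideals and orders along a prime element -/

/-- An ideal is locally principal: at every prime it is generated by one of its elements. -/
def IsLocallyPrincipal {A : Type*} [CommRing A] (I : Ideal A) : Prop :=
  ∀ p : Ideal A, p.IsPrime → ∃ t ∈ I, ∀ a ∈ I, ∃ b ∉ p, t ∣ b * a

lemma IsLocallyPrincipal.map {A B : Type*} [CommRing A] [CommRing B] {I : Ideal A}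
    (h : IsLocallyPrincipal I) (f : A →+* B) : IsLocallyPrincipal (I.map f) := by
  intro p hp
  obtain ⟨t, ht, hI⟩ := h (p.comap f) (hp.comap f)
  refine ⟨f t, Ideal.mem_map_of_mem f ht, fun a ha => ?_⟩
  induction ha using Submodule.span_induction with
  | mem x hx =>
    obtain ⟨y, hy, rfl⟩ := hx
    obtain ⟨b, hb, hdvd⟩ := hI y hy
    exact ⟨f b, hb, by rw [← map_mul]; exact map_dvd f hdvd⟩
  | zero => exact ⟨1, (Ideal.ne_top_iff_one p).1 hp.ne_top, by simp⟩
  | add x y _ _ hx hy =>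
    obtain ⟨b, hb, c, hc⟩ := hx
    obtain ⟨b', hb', c', hc'⟩ := hy
    refine ⟨b * b', fun h => (hp.mem_or_mem h).elim hb hb', b' * c + b * c', ?_⟩
    linear_combination b' * hc + b * hc'
  | smul r x _ hx =>
    obtain ⟨b, hb, c, hc⟩ := hx
    refine ⟨b, hb, r * c, ?_⟩
    rw [smul_eq_mul]
    linear_combination r * hc

/-- A locally principal ideal containing a power of a prime element `s` is generated by a power
of `s`. -/
lemma IsLocallyPrincipal.exists_eq_span_pow {S : Type*} [CommRing S] [IsDomain S] {s : S}
    (hs : Prime s) {J : Ideal S} (hJ : IsLocallyPrincipal J) (hrad : s ∈ J.radical) :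
    ∃ c : ℕ, J = Ideal.span {s ^ c} := by
  classical
  obtain ⟨n, hn⟩ := hrad
  have hex : ∃ c, ¬ J ≤ Ideal.span {s ^ (c + 1)} := by
    refine ⟨n, fun h => ?_⟩
    have h1 := Ideal.mem_span_singleton.1 (h hn)
    rw [pow_dvd_pow_iff hs.ne_zero hs.not_isUnit] at h1
    omega
  set c := Nat.find hex with hc
  have hnot : ¬ J ≤ Ideal.span {s ^ (c + 1)} := Nat.find_spec hex
  have hle : J ≤ Ideal.span {s ^ c} := by
    rcases Nat.eq_zero_or_pos c with h0 | h0
    · rw [h0, pow_zero, Ideal.span_singleton_one]; exact le_top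
    · have := Nat.find_min hex (m := c - 1) (by omega)
      rw [not_not, Nat.sub_add_cancel h0] at this
      exact this
  refine ⟨c, le_antisymm hle ?_⟩
  rw [Ideal.span_singleton_le_iff_mem]
  set J' : Ideal S := J.colon {s ^ c} with hJ'
  have hmem : ∀ x, x ∈ J' ↔ s ^ c * x ∈ J := by
    intro x
    rw [hJ', Submodule.mem_colon_singleton, smul_eq_mul, mul_comm]
  by_contra hcon
  have hne : J' ≠ ⊤ := fun h => hcon (by
    have := (hmem 1).1 (h ▸ Submodule.mem_top)
    rwa [mul_one] at this)
  obtain ⟨z, hz, hzJ⟩ := Ideal.exists_le_maximal J' hne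
  have hzp := hz.isPrime
  have hsn : s ^ n ∈ J' := (hmem _).2 (J.mul_mem_left _ hn)
  have hsz : s ∈ z := hzp.mem_of_pow_mem n (hzJ hsn)
  have hdz : ∀ b ∉ z, ¬ s ∣ b := fun b hb ⟨c, h⟩ => hb (h ▸ z.mul_mem_right _ hsz)
  obtain ⟨t, ht, hloc⟩ := hJ z hzp
  obtain ⟨t', rfl⟩ := Ideal.mem_span_singleton.1 (hle ht)
  have hscne : s ^ c ≠ 0 := pow_ne_zero _ hs.ne_zero
  have hloc' : ∀ a ∈ J', ∃ b ∉ z, t' ∣ b * a := by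
    intro a ha
    obtain ⟨b, hb, q, hq⟩ := hloc _ ((hmem a).1 ha)
    refine ⟨b, hb, q, mul_left_cancel₀ hscne ?_⟩
    linear_combination hq
  have hst' : ¬ s ∣ t' := by
    intro hdvd
    refine hnot fun x hx => ?_
    obtain ⟨a, rfl⟩ := Ideal.mem_span_singleton.1 (hle hx)
    obtain ⟨b, hb, hba⟩ := hloc' a ((hmem a).2 hx)
    have := (hs.dvd_or_dvd (hdvd.trans hba)).resolve_left (hdz b hb)
    rw [Ideal.mem_span_singleton, pow_succ]
    exact mul_dvd_mul_left _ this
  obtain ⟨b, hb, q, hq⟩ := hloc' _ hsn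
  have h1 : s ^ n ∣ t' * q := ⟨b, by rw [← hq, mul_comm]⟩
  obtain ⟨q', rfl⟩ := hs.pow_dvd_of_dvd_mul_left n hst' h1
  have : b = t' * q' := by
    refine mul_left_cancel₀ (pow_ne_zero n hs.ne_zero) ?_
    linear_combination hq
  exact hb (this ▸ z.mul_mem_right _ (hzJ ((hmem t').2 ht)))

/-- Let `I_i` be locally principal primes of a noetherian domain `A` whose pullbacks along
`Ψ : A → S` are the ideals `(s ^ c_i)` for a prime element `s`. If the zero locus of `f` is contained
in the union of those of the `I_i` and all `c_i` vanish in `k`, then the order of `Ψ f` along `s`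
vanishes in `k`. -/
lemma natCast_order_eq_zero {A S k ι : Type*} [CommRing A] [IsDomain A] [IsNoetherianRing A]
    [CommRing S] [IsDomain S] [AddMonoidWithOne k] (Ψ : A →+* S) {s : S} (hs : Prime s)
    (I : ι → Ideal A) (hprime : ∀ i, I i ≠ ⊤ → (I i).IsPrime) (hne : ∀ i, I i ≠ ⊥)
    (hlp : ∀ i, IsLocallyPrincipal (I i)) (c : ι → ℕ)
    (hc : ∀ i, (I i).map Ψ = Ideal.span {s ^ c i}) (hck : ∀ i, (c i : k) = 0)
    (e : ℕ) (f : A) (hf : ∀ q : Ideal A, q.IsPrime → q ≤ (Ideal.span {s}).comap Ψ → f ∈ q →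
      ∃ i, I i ≤ q) (w : S) (hw : ¬ s ∣ w) (hfw : Ψ f = s ^ e * w) : (e : k) = 0 := by
  induction e using Nat.strong_induction_on generalizing f w with
  | _ e ih =>
  rcases Nat.eq_zero_or_pos e with rfl | he
  · simp
  set p := (Ideal.span {s}).comap Ψ with hp
  have hsp : (Ideal.span {s}).IsPrime := (Ideal.span_singleton_prime hs.ne_zero).2 hs
  have hpp : p.IsPrime := hsp.comap Ψ
  have hpmem : ∀ a, a ∈ p ↔ s ∣ Ψ a := fun a => by
    rw [hp, Ideal.mem_comap, Ideal.mem_span_singleton]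
  have hfp : f ∈ p := (hpmem f).2 (hfw ▸ (dvd_pow_self s he.ne').mul_right w)
  obtain ⟨q, hq, hqp⟩ := Ideal.exists_minimalPrimes_le ((Ideal.span_singleton_le_iff_mem p).2 hfp)
  have hqprime : q.IsPrime := hq.1.1
  have hfq : f ∈ q := (Ideal.span_singleton_le_iff_mem q).1 hq.1.2
  have hht := Ideal.height_le_one_of_isPrincipal_of_mem_minimalPrimes _ q hq
  obtain ⟨i, hi⟩ := hf q hqprime hqp hfq
  have hip : (I i).IsPrime := hprime i fun h => hqprime.ne_top (top_le_iff.1 (h ▸ hi))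
  have hiq : I i = q := by
    by_contra hne'
    have hlt : I i < q := lt_of_le_of_ne hi hne'
    have h1 : (⊥ : Ideal A) < I i := bot_lt_iff_ne_bot.2 (hne i)
    have h2 := Ideal.height_add_one_le_of_lt_of_isPrime hlt
    have h3 := Ideal.height_add_one_le_of_lt_of_isPrime h1
    rw [Ideal.height_bot, zero_add] at h3
    have h4 := (add_le_add_left h3 1).trans (h2.trans hht)
    exact absurd h4 (by decide)
  have hle : I i ≤ p := hiq ▸ hqp
  obtain ⟨t, ht, hloc⟩ := hlp i p hpp
  obtain ⟨b, hb, g, hg⟩ := hloc f (hiq ▸ hfq)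
  have hΨt : Ψ t ∈ Ideal.span {s ^ c i} := by
    rw [← hc]; exact Ideal.mem_map_of_mem Ψ ht
  obtain ⟨t', ht'⟩ := Ideal.mem_span_singleton.1 hΨt
  have hst' : ¬ s ∣ t' := by
    intro h
    have hall : (I i).map Ψ ≤ Ideal.span {s ^ (c i + 1)} := by
      rw [Ideal.map_le_iff_le_comap]
      intro a ha
      obtain ⟨b', hb', hdvd⟩ := hloc a ha
      rw [Ideal.mem_comap, Ideal.mem_span_singleton]
      have h1 : s ^ (c i + 1) ∣ Ψ b' * Ψ a := by
        rw [← map_mul]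
        refine dvd_trans ?_ (map_dvd Ψ hdvd)
        rw [ht', pow_succ]
        exact mul_dvd_mul_left _ h
      exact hs.pow_dvd_of_dvd_mul_left _ (fun h => hb' ((hpmem b').2 h)) h1
    rw [hc, Ideal.span_singleton_le_span_singleton,
      pow_dvd_pow_iff hs.ne_zero hs.not_isUnit] at hall
    omega
  have hci : 0 < c i := by
    by_contra h0
    have h0' : c i = 0 := by omega
    rw [h0', pow_zero, one_mul] at ht'
    exact hst' (ht' ▸ (hpmem t).1 (hle ht))
  have hsb : ¬ s ∣ Ψ b := fun h => hb ((hpmem b).2 h)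
  have heq : s ^ e * (Ψ b * w) = s ^ c i * (t' * Ψ g) := by
    have := congrArg Ψ hg
    rw [map_mul, map_mul, ht', hfw] at this
    linear_combination this
  have hbw : ¬ s ∣ Ψ b * w := fun h => (hs.dvd_or_dvd h).elim hsb hw
  have hcie : c i ≤ e := by
    by_contra hlt
    push Not at hlt
    obtain ⟨r, hr⟩ := Nat.exists_eq_add_of_lt hlt
    refine hbw ⟨s ^ r * (t' * Ψ g), mul_left_cancel₀ (pow_ne_zero e hs.ne_zero) ?_⟩
    rw [heq, hr]; ring
  obtain ⟨e', rfl⟩ := Nat.exists_eq_add_of_le hcie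
  have heq' : s ^ e' * (Ψ b * w) = t' * Ψ g := by
    refine mul_left_cancel₀ (pow_ne_zero (c i) hs.ne_zero) ?_
    rw [← heq]; ring
  obtain ⟨w', hw'⟩ := hs.pow_dvd_of_dvd_mul_left e' hst' ⟨_, heq'.symm⟩
  rw [Nat.cast_add, hck, zero_add]
  refine ih e' (by omega) g (fun q hq hqp hgq => ?_) w' (fun h => hbw ?_) hw'
  · refine hf q hq hqp ?_
    have h1 : b * f ∈ q := hg ▸ q.mul_mem_left _ hgq
    exact (hq.mem_or_mem h1).resolve_left fun h => hb (hqp h)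
  · have : Ψ b * w = t' * w' := by
      refine mul_left_cancel₀ (pow_ne_zero e' hs.ne_zero) ?_
      rw [heq', hw']; ring
    rw [this]
    exact h.mul_left _

/-! ## Stalks of ideals of closed subsets -/

/-- The localization map `R → 𝒪_{Spec R, x}`. -/
def specToStalk (R : Type u) [CommRing R] (x : Spec (.of R)) :
    R →+* (Spec (.of R)).presheaf.stalk x :=
  ((Scheme.ΓSpecIso (.of R)).inv ≫ (Spec (.of R)).presheaf.germ ⊤ x trivial).hom

lemma fromSpecStalk_spec (R : Type u) [CommRing R] (x : Spec (.of R)) :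
    (Spec (.of R)).fromSpecStalk x = Spec.map (CommRingCat.ofHom (specToStalk R x)) :=
  Spec.fromSpecStalk_eq _ _

lemma isLocalization_specToStalk (R : Type u) [CommRing R] (x : PrimeSpectrum R) :
    @IsLocalization R _ x.asIdeal.primeCompl ((Spec (.of R)).presheaf.stalk x) _
      (specToStalk R x).toAlgebra :=
  StructureSheaf.IsLocalization.to_stalk R x

lemma specToStalk_stalkMap {R S : Type u} [CommRing R] [CommRing S] (f : R →+* S)
    (x : Spec (.of S)) :
    ((Spec.map (CommRingCat.ofHom f)).stalkMap x).hom.comp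
      (specToStalk R (Spec.map (CommRingCat.ofHom f) x)) = (specToStalk S x).comp f := by
  have h := Scheme.SpecMap_stalkMap_fromSpecStalk (Spec.map (CommRingCat.ofHom f)) (x := x)
  rw [fromSpecStalk_spec, fromSpecStalk_spec, ← Spec.map_comp, ← Spec.map_comp] at h
  exact congrArg CommRingCat.Hom.hom (Spec.map_injective h)

lemma stalkIdeal_eq_top {X : Scheme.{u}} {Z : Set X} (hZ : IsClosed Z) {x : X} (hx : x ∉ Z) :
    stalkIdeal Z x = ⊤ := by
  rw [stalkIdeal]
  convert PrimeSpectrum.vanishingIdeal_empty (R := X.presheaf.stalk x)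
  rw [Set.eq_empty_iff_forall_notMem]
  intro q hq
  have h1 : X.fromSpecStalk x q ⤳ X.fromSpecStalk x (IsLocalRing.closedPoint _) :=
    (IsLocalRing.specializes_closedPoint q).map (X.fromSpecStalk x).continuous
  rw [Scheme.fromSpecStalk_closedPoint] at h1
  exact hx (h1.mem_closed hZ hq)

lemma stalkIdeal_ne_top {X : Scheme.{u}} {Z : Set X} {x : X} (hx : x ∈ Z) :
    stalkIdeal Z x ≠ ⊤ := by
  intro h
  have h1 : (1 : X.presheaf.stalk x) ∈ stalkIdeal Z x := h ▸ Submodule.mem_top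
  rw [stalkIdeal, PrimeSpectrum.mem_vanishingIdeal] at h1
  have h2 := h1 (IsLocalRing.closedPoint _) (by
    change X.fromSpecStalk x (IsLocalRing.closedPoint _) ∈ Z
    rw [Scheme.fromSpecStalk_closedPoint]; exact hx)
  exact (Ideal.ne_top_iff_one _).1 (IsLocalRing.closedPoint (X.presheaf.stalk x)).isPrime.ne_top h2

/-- The stalk at `y` of the inverse image ideal of a closed subset. -/
def pulledIdeal {Y X : Scheme.{u}} (f : Y ⟶ X) (Z : Set X) (y : Y) :
    Ideal (Y.presheaf.stalk y) :=
  (stalkIdeal Z (f y)).map (f.stalkMap y).hom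

lemma pulledIdeal_comp {W Y X : Scheme.{u}} (f : W ⟶ Y) (g : Y ⟶ X) (Z : Set X) (w : W) :
    pulledIdeal (f ≫ g) Z w = (pulledIdeal g Z (f w)).map (f.stalkMap w).hom := by
  rw [pulledIdeal, pulledIdeal, Scheme.Hom.stalkMap_comp, Ideal.map_map]
  rfl

lemma pulledIdeal_of_isOpenImmersion {Y X : Scheme.{u}} (f : Y ⟶ X) [IsOpenImmersion f]
    (Z : Set X) (y : Y) : pulledIdeal f Z y = stalkIdeal (f ⁻¹' Z) y := by
  let E : X.presheaf.stalk (f y) ≃+* Y.presheaf.stalk y :=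
    (asIso (f.stalkMap y)).commRingCatIsoToRingEquiv
  have hE : (f.stalkMap y).hom = (E : X.presheaf.stalk (f y) →+* Y.presheaf.stalk y) := rfl
  have hfac : ∀ q : PrimeSpectrum (Y.presheaf.stalk y),
      X.fromSpecStalk (f y) (PrimeSpectrum.comap (f.stalkMap y).hom q) =
        f (Y.fromSpecStalk y q) := fun q =>
    congrArg (fun g : Spec (Y.presheaf.stalk y) ⟶ X => g q)
      (Scheme.SpecMap_stalkMap_fromSpecStalk f (x := y))
  rw [pulledIdeal, hE, Ideal.map_comap_of_equiv]
  ext a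
  rw [Ideal.mem_comap, stalkIdeal, stalkIdeal, PrimeSpectrum.mem_vanishingIdeal,
    PrimeSpectrum.mem_vanishingIdeal]
  constructor
  · intro h q hq
    have := h (PrimeSpectrum.comap (f.stalkMap y).hom q) (by
      change X.fromSpecStalk (f y) (PrimeSpectrum.comap (f.stalkMap y).hom q) ∈ Z
      rw [hfac]; exact hq)
    change E (E.symm a) ∈ q.asIdeal at this
    rwa [E.apply_symm_apply] at this
  · intro h q hq
    have hq' : PrimeSpectrum.comap (f.stalkMap y).hom
        (PrimeSpectrum.comap (E.symm : Y.presheaf.stalk y →+* _) q) = q := by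
      ext b
      change E.symm (E b) ∈ q.asIdeal ↔ _
      rw [E.symm_apply_apply]
    exact h (PrimeSpectrum.comap (E.symm : Y.presheaf.stalk y →+* _) q) (by
      change f (Y.fromSpecStalk y _) ∈ Z
      rw [← hfac, hq']; exact hq)

/-- The radical ideal of a closed subset of an affine scheme. -/
def idealOn {R : Type u} [CommRing R] (Z : Set (Spec (.of R))) : Ideal R :=
  PrimeSpectrum.vanishingIdeal (R := R) Z

lemma vanishingIdeal_comap_preimage {R S : Type*} [CommRing R] [CommRing S] [Algebra R S]
    (M : Submonoid R) [IsLocalization M S] {Z : Set (PrimeSpectrum R)} (hZ : IsClosed Z) :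
    PrimeSpectrum.vanishingIdeal (PrimeSpectrum.comap (algebraMap R S) ⁻¹' Z) =
      (PrimeSpectrum.vanishingIdeal Z).map (algebraMap R S) := by
  have hZ' : Z = PrimeSpectrum.zeroLocus (PrimeSpectrum.vanishingIdeal Z) := by
    rw [PrimeSpectrum.zeroLocus_vanishingIdeal_eq_closure, hZ.closure_eq]
  have hpre : PrimeSpectrum.comap (algebraMap R S) ⁻¹' Z =
      PrimeSpectrum.zeroLocus ((PrimeSpectrum.vanishingIdeal Z).map (algebraMap R S) :
        Set S) := by
    conv_lhs => rw [hZ', PrimeSpectrum.preimage_comap_zeroLocus]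
    rw [Ideal.map, PrimeSpectrum.zeroLocus_span]
  have hrad : (PrimeSpectrum.vanishingIdeal Z).radical = PrimeSpectrum.vanishingIdeal Z := by
    conv_lhs => rw [← PrimeSpectrum.vanishingIdeal_zeroLocus_eq_radical, ← hZ']
  rw [hpre, PrimeSpectrum.vanishingIdeal_zeroLocus_eq_radical, ← IsLocalization.map_radical M,
    hrad]

lemma stalkIdeal_spec {R : Type u} [CommRing R] {Z : Set (Spec (.of R))} (hZ : IsClosed Z)
    (x : Spec (.of R)) :
    stalkIdeal Z x = (idealOn Z).map (specToStalk R x) := by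
  let _ := (specToStalk R x).toAlgebra
  let x' : PrimeSpectrum R := x
  have : IsLocalization x'.asIdeal.primeCompl ((Spec (.of R)).presheaf.stalk x) :=
    isLocalization_specToStalk R x'
  have h : ((Spec (.of R)).fromSpecStalk x) ⁻¹' Z =
      PrimeSpectrum.comap (specToStalk R x) ⁻¹' Z := by
    rw [fromSpecStalk_spec]; rfl
  exact (congrArg PrimeSpectrum.vanishingIdeal h).trans
    (vanishingIdeal_comap_preimage (R := R) x'.asIdeal.primeCompl hZ)

lemma pulledIdeal_SpecMap_comp {R A : Type u} [CommRing R] [CommRing A] {X : Scheme.{u}}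
    (g : Spec (.of A) ⟶ X) [IsOpenImmersion g] {Z : Set X} (hZ : IsClosed Z) (θ : A →+* R)
    (w : Spec (.of R)) :
    pulledIdeal (Spec.map (CommRingCat.ofHom θ) ≫ g) Z w =
      ((idealOn (g ⁻¹' Z)).map θ).map (specToStalk R w) := by
  rw [pulledIdeal_comp, pulledIdeal_of_isOpenImmersion,
    stalkIdeal_spec (hZ.preimage g.continuous), Ideal.map_map, specToStalk_stalkMap,
    Ideal.map_map]

lemma isLocallyPrincipal_vanishingIdeal {A : Type u} [CommRing A] [IsDomain A] {X : Scheme.{u}}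
    (g : Spec (.of A) ⟶ X) [IsOpenImmersion g] {Z : Set X} (hZ : IsClosed Z)
    (hprinc : ∀ x ∈ Z, ∃ t, stalkIdeal Z x = Ideal.span {t}) :
    IsLocallyPrincipal (idealOn (g ⁻¹' Z)) := by
  intro p hp
  let x : Spec (.of A) := (⟨p, hp⟩ : PrimeSpectrum A)
  let _ := (specToStalk A x).toAlgebra
  have hloc : IsLocalization p.primeCompl ((Spec (.of A)).presheaf.stalk x) :=
    isLocalization_specToStalk A ⟨p, hp⟩
  have hp' : ∃ t, stalkIdeal Z (g x) = Ideal.span {t} := by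
    by_cases h : g x ∈ Z
    · exact hprinc _ h
    · exact ⟨1, by rw [stalkIdeal_eq_top hZ h, Ideal.span_singleton_one]⟩
  obtain ⟨t, ht⟩ := hp'
  set I := idealOn (g ⁻¹' Z) with hI
  have h1 : I.map (algebraMap A ((Spec (.of A)).presheaf.stalk x)) =
      Ideal.span {(g.stalkMap x).hom t} := by
    have := pulledIdeal_of_isOpenImmersion g Z x
    rw [pulledIdeal, ht, Ideal.map_span, Set.image_singleton,
      stalkIdeal_spec (hZ.preimage g.continuous)] at this
    exact this.symm
  have hinj : Function.Injective (algebraMap A ((Spec (.of A)).presheaf.stalk x)) :=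
    IsLocalization.injective _ (M := p.primeCompl) (le_nonZeroDivisors_of_noZeroDivisors
      fun h => h (zero_mem p))
  have hmem : (g.stalkMap x).hom t ∈ I.map (algebraMap A ((Spec (.of A)).presheaf.stalk x)) := by
    rw [h1]; exact Ideal.mem_span_singleton_self _
  obtain ⟨⟨a, b⟩, hab⟩ := (IsLocalization.mem_map_algebraMap_iff p.primeCompl _).1 hmem
  refine ⟨a.1, a.2, fun a' ha' => ?_⟩
  have h2 : algebraMap A ((Spec (.of A)).presheaf.stalk x) a' ∈
      Ideal.span {(g.stalkMap x).hom t} := h1 ▸ Ideal.mem_map_of_mem _ ha'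
  obtain ⟨r, hr⟩ := Ideal.mem_span_singleton.1 h2
  obtain ⟨⟨n, m⟩, hnm⟩ := IsLocalization.surj p.primeCompl r
  refine ⟨b.1 * m.1, fun h => (hp.mem_or_mem h).elim b.2 m.2, n, hinj ?_⟩
  simp only [map_mul]
  dsimp only at hab hnm
  rw [← hab, ← hnm, hr]
  ring

/-! ## Contact orders of one-parameter subgroups -/

instance {k : Type u} [Field k] {d : ℕ} (σ : PointedCone ℝ (Fin d → ℝ)) :
    IsDomain (AddMonoidAlgebra k (dualMonoid σ)) := by
  have : UniqueSums (dualMonoid σ) :=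
    UniqueSums.of_injective_addHom (dualMonoid σ).subtype.toAddHom Subtype.val_injective
      inferInstance
  have : NoZeroDivisors (AddMonoidAlgebra k (dualMonoid σ)) := inferInstance
  exact NoZeroDivisors.to_isDomain _

instance {k : Type u} [Field k] {d : ℕ} : IsDomain (AddMonoidAlgebra k (Fin d → ℤ)) := by
  have : NoZeroDivisors (AddMonoidAlgebra k (Fin d → ℤ)) := inferInstance
  exact NoZeroDivisors.to_isDomain _

lemma intPairing_add {d : ℕ} (a b u : Fin d → ℤ) :
    intPairing (a + b) u = intPairing a u + intPairing b u := by
  simp [intPairing, add_mul, Finset.sum_add_distrib]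

lemma intPairing_zero {d : ℕ} (u : Fin d → ℤ) : intPairing 0 u = 0 := by
  simp [intPairing]

lemma intPairing_nsmul {d : ℕ} (n : ℕ) (a u : Fin d → ℤ) :
    intPairing (n • a) u = n * intPairing a u := by
  simp [intPairing, Finset.mul_sum, mul_assoc]

/-- For a lattice vector `u` nonnegative on `σ^∨ ∩ M`, the characters of
`T × 𝔸^1 → U_σ`, `(τ, s) ↦ τ s^u`. -/
def oneParamChar (k : Type u) [Field k] {d : ℕ} (σ : PointedCone ℝ (Fin d → ℝ)) (u : Fin d → ℤ)
    (hu : ∀ m ∈ dualMonoid σ, 0 ≤ intPairing m u) :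
    Multiplicative (dualMonoid σ) →* Polynomial (AddMonoidAlgebra k (Fin d → ℤ)) where
  toFun m := Polynomial.X ^ (intPairing m.toAdd.1 u).toNat *
    Polynomial.C (AddMonoidAlgebra.single m.toAdd.1 1)
  map_one' := by
    change Polynomial.X ^ (intPairing 0 u).toNat * Polynomial.C (AddMonoidAlgebra.single 0 1) = _
    rw [intPairing_zero, ← AddMonoidAlgebra.one_def]; simp
  map_mul' a b := by
    change Polynomial.X ^ (intPairing (a.toAdd.1 + b.toAdd.1) u).toNat *
      Polynomial.C (AddMonoidAlgebra.single (a.toAdd.1 + b.toAdd.1) 1) = _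
    rw [intPairing_add, Int.toNat_add (hu _ a.toAdd.2) (hu _ b.toAdd.2), pow_add,
      show AddMonoidAlgebra.single (a.toAdd.1 + b.toAdd.1) (1 : k) =
        AddMonoidAlgebra.single a.toAdd.1 1 * AddMonoidAlgebra.single b.toAdd.1 1 by
        rw [AddMonoidAlgebra.single_mul_single, one_mul], Polynomial.C_mul]
    ring

/-- The comorphism of `T × 𝔸^1 → U_σ`, `(τ, s) ↦ τ s^u`. -/
def oneParam (k : Type u) [Field k] {d : ℕ} (σ : PointedCone ℝ (Fin d → ℝ)) (u : Fin d → ℤ)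
    (hu : ∀ m ∈ dualMonoid σ, 0 ≤ intPairing m u) :
    AddMonoidAlgebra k (dualMonoid σ) →ₐ[k] Polynomial (AddMonoidAlgebra k (Fin d → ℤ)) :=
  charHom σ (oneParamChar k σ u hu)

lemma oneParam_single (k : Type u) [Field k] {d : ℕ} (σ : PointedCone ℝ (Fin d → ℝ))
    (u : Fin d → ℤ) (hu : ∀ m ∈ dualMonoid σ, 0 ≤ intPairing m u) (m : dualMonoid σ) :
    oneParam k σ u hu (AddMonoidAlgebra.single m 1) =
      Polynomial.X ^ (intPairing m.1 u).toNat * Polynomial.C (AddMonoidAlgebra.single m.1 1) :=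
  charHom_single _ _ _

lemma isUnit_single {k : Type u} [Field k] {A : Type*} [AddCommGroup A] (m : A) :
    IsUnit (AddMonoidAlgebra.single m (1 : k)) := by
  refine IsUnit.of_mul_eq_one (AddMonoidAlgebra.single (-m) 1) ?_
  rw [AddMonoidAlgebra.single_mul_single, AddMonoidAlgebra.one_def]; simp

section

variable {d : ℕ} (F : Fan d) {k : Type u} [Field k] {X : Scheme.{u}} (e : X ≅ F.toricVariety k)

lemma chartTo_mem_torusIn_iff {σ : F.cones} {m : Fin d → ℤ} (hm : m ∈ dualMonoid σ.1)
    (h0 : ∀ v ∈ σ.1, pairing m v = 0 → v = 0)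
    (p : PrimeSpectrum (AddMonoidAlgebra k (dualMonoid σ.1))) :
    chartTo F e σ p ∈ torusIn F e ↔
      AddMonoidAlgebra.single (⟨m, hm⟩ : dualMonoid σ.1) (1 : k) ∉ p.asIdeal := by
  rw [← F.chartι_mem_torus_iff k hm h0 p]
  constructor
  · rintro ⟨q, hq⟩
    exact ⟨q, e.inv.isOpenEmbedding.injective hq⟩
  · rintro ⟨q, hq⟩
    exact ⟨q, congrArg e.inv hq⟩

lemma mem_iff_vanishingIdeal_le {R : Type*} [CommRing R] {Z : Set (PrimeSpectrum R)}
    (hZ : IsClosed Z) (p : PrimeSpectrum R) :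
    p ∈ Z ↔ PrimeSpectrum.vanishingIdeal Z ≤ p.asIdeal := by
  conv_lhs => rw [← hZ.closure_eq, ← PrimeSpectrum.zeroLocus_vanishingIdeal_eq_closure]
  rfl

end

/-- For every lattice vector `u` some cone `σ` of a complete smooth fan contains it; the map
`T × 𝔸^1 → U_σ`, `(τ, s) ↦ τ s^u` pulls back `Δ_i` to a multiple `c_i` of `s = 0`, and if all `c_i`
vanish in `k` then so does `u`. -/
lemma exists_contact {d : ℕ} (F : Fan d) {k : Type u} [Field k] (O : Orbifold k)
    (e : O.X ≅ F.toricVariety k) (he : e.hom ≫ F.toricStr k = O.str)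
    (hΔ : e.hom ⁻¹' F.toricBoundary k = O.boundary) (u : Fin d → ℤ) :
    ∃ (σ : F.cones) (hu : ∀ m ∈ dualMonoid σ.1, 0 ≤ intPairing m u) (c : O.ι → ℕ),
      (∀ i, (idealOn (chartTo F e σ ⁻¹' (O.Δ i : Set O.X))).map (oneParam k σ.1 u hu).toRingHom =
        Ideal.span {Polynomial.X ^ c i}) ∧
      ((∀ i, (c i : k) = 0) → ∀ m : Fin d → ℤ, ((intPairing m u : ℤ) : k) = 0) := by
  have hproper : IsProper O.str := O.projective.isProper
  obtain ⟨σ, hu⟩ := exists_cone_nonneg F e he u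
  set A := AddMonoidAlgebra k (dualMonoid σ.1) with hA
  set S := Polynomial (AddMonoidAlgebra k (Fin d → ℤ)) with hS
  set Ψ := (oneParam k σ.1 u hu).toRingHom with hΨ
  set g : Spec (.of A) ⟶ O.X := chartTo F e σ with hg
  set I : O.ι → Ideal A := fun i => idealOn (g ⁻¹' (O.Δ i : Set O.X)) with hI
  have hcl : ∀ i, IsClosed (g ⁻¹' (O.Δ i : Set O.X)) := fun i =>
    (O.Δ i).isClosed.preimage g.continuous
  obtain ⟨m₀, hm₀, h₀⟩ := exists_pos_dualMonoid (F.rational _ σ.2) (F.stronglyConvex _ σ.2)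
  have htor : torusIn F e = O.boundaryᶜ := torusIn_eq_compl F e hΔ
  have hmem : ∀ p : PrimeSpectrum A, AddMonoidAlgebra.single (⟨m₀, hm₀⟩ : dualMonoid σ.1) (1 : k) ∈
      p.asIdeal ↔ ∃ i, I i ≤ p.asIdeal := by
    intro p
    rw [← not_iff_not, ← chartTo_mem_torusIn_iff F e hm₀ h₀ p, htor, Set.mem_compl_iff, not_iff_not,
      Orbifold.boundary, Set.mem_iUnion]
    exact exists_congr fun i => mem_iff_vanishingIdeal_le (R := A) (hcl i) p
  have hΨs : ∀ m : dualMonoid σ.1, Ψ (AddMonoidAlgebra.single m 1) =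
      Polynomial.X ^ (intPairing m.1 u).toNat * Polynomial.C (AddMonoidAlgebra.single m.1 1) :=
    oneParam_single k σ.1 u hu
  have hXp : Prime (Polynomial.X : S) := Polynomial.prime_X
  have hlp : ∀ i, IsLocallyPrincipal (I i) := fun i =>
    isLocallyPrincipal_vanishingIdeal g (O.Δ i).isClosed fun x hx => by
      obtain ⟨t, ht, -⟩ := O.snc.parameters x
      exact ⟨_, ht ⟨i, hx⟩⟩
  have hunit : ∀ m : Fin d → ℤ,
      IsUnit (Polynomial.C (AddMonoidAlgebra.single m (1 : k)) : S) := fun m =>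
    (isUnit_single m).map Polynomial.C
  have hc : ∀ i, ∃ c : ℕ, (I i).map Ψ = Ideal.span {Polynomial.X ^ c} := by
    intro i
    refine ((hlp i).map Ψ).exists_eq_span_pow hXp ?_
    rw [Ideal.radical_eq_sInf, Ideal.mem_sInf]
    rintro z ⟨hz, hzp⟩
    have h1 : I i ≤ z.comap Ψ := Ideal.map_le_iff_le_comap.1 hz
    have h2 := (hmem ⟨z.comap Ψ, hzp.comap Ψ⟩).2 ⟨i, h1⟩
    change Ψ _ ∈ z at h2
    rw [hΨs] at h2
    rcases hzp.mem_or_mem h2 with h | h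
    · exact hzp.mem_of_pow_mem _ h
    · exact absurd (Ideal.eq_top_of_isUnit_mem _ h (hunit _)) hzp.ne_top
  choose c hc using hc
  refine ⟨σ, hu, c, hc, fun hck m => ?_⟩
  have hnoeth : IsNoetherianRing A := by
    have h1 : LocallyOfFiniteType (g ≫ O.str) := inferInstance
    rw [hg, chartTo_comp F e he σ, HasRingHomProperty.Spec_iff (P := @LocallyOfFiniteType)] at h1
    have : Algebra.FiniteType k A := RingHom.finiteType_algebraMap.1 h1
    exact Algebra.FiniteType.isNoetherianRing k A
  have hprime : ∀ i, I i ≠ ⊤ → (I i).IsPrime := by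
    intro i hi
    have hne : (g ⁻¹' (O.Δ i : Set O.X)).Nonempty := by
      by_contra h
      rw [Set.not_nonempty_iff_eq_empty] at h
      refine hi ?_
      rw [hI]
      dsimp only
      rw [h]
      exact PrimeSpectrum.vanishingIdeal_empty
    exact PrimeSpectrum.isIrreducible_iff_vanishingIdeal_isPrime.1
      ⟨hne, (O.snc.irreducible i).2.preimage g.isOpenEmbedding⟩
  have hbot : ∀ i, I i ≠ ⊥ := by
    intro i hi
    have := (hmem ⟨⊥, Ideal.isPrime_bot⟩).2 ⟨i, hi.le⟩
    change _ = (0 : A) at this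
    rw [AddMonoidAlgebra.single_eq_zero] at this
    exact one_ne_zero this
  have hdual : ∀ m ∈ dualMonoid σ.1, ((intPairing m u : ℤ) : k) = 0 := by
    intro m hm
    have := natCast_order_eq_zero (k := k) Ψ hXp I hprime hbot hlp c hc hck
      (intPairing m u).toNat (AddMonoidAlgebra.single (⟨m, hm⟩ : dualMonoid σ.1) 1) ?_ _ ?_
      (hΨs ⟨m, hm⟩)
    · rw [← Int.toNat_of_nonneg (hu m hm)]
      exact_mod_cast this
    · intro q hq _ hmq
      refine (hmem ⟨q, hq⟩).1 ?_
      obtain ⟨n, hn⟩ := exists_add_nsmul_mem (τ := ⊥) (F.rational _ σ.2) hm₀ (by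
        intro v
        constructor
        · rintro rfl
          exact ⟨zero_mem _, pairing_zero_right m₀⟩
        · exact fun hv => h₀ v hv.1 hv.2) (w := -m) (by
          intro v hv
          obtain rfl : v = 0 := hv
          rw [pairing_zero_right])
      refine hq.mem_of_pow_mem n ?_
      rw [AddMonoidAlgebra.single_pow, one_pow, show n • (⟨m₀, hm₀⟩ : dualMonoid σ.1) =
        ⟨m, hm⟩ + ⟨_, hn⟩ by ext i; simp, Fan.single_mul_mem_iff k ⟨q, hq⟩]
      exact Or.inl hmq
    · exact fun h => hXp.not_isUnit (isUnit_of_dvd_unit h (hunit m))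
  obtain ⟨n, hn⟩ := exists_add_nsmul_mem (τ := ⊥) (F.rational _ σ.2) hm₀ (by
    intro v
    constructor
    · rintro rfl
      exact ⟨zero_mem _, pairing_zero_right m₀⟩
    · exact fun hv => h₀ v hv.1 hv.2) (w := m) (by
      intro v hv
      obtain rfl : v = 0 := hv
      rw [pairing_zero_right])
  have h1 := hdual _ hn
  have h2 := hdual _ hm₀
  rw [intPairing_add, intPairing_nsmul] at h1
  push_cast at h1
  rwa [h2, mul_zero, add_zero] at h1

/-! ## The projective line over a field -/

section

variable (k : Type u) [Field k]

/-- The grading of `k[X_0, X_1]`. -/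
abbrev lineGrading : ℕ → Submodule k (MvPolynomial (Fin (1 + 1)) k) :=
  MvPolynomial.homogeneousSubmodule (Fin (1 + 1)) k

lemma X_mem_lineGrading (i : Fin (1 + 1)) : MvPolynomial.X i ∈ lineGrading k 1 :=
  MvPolynomial.isHomogeneous_X k i

/-- `k → k[X_0, X_1]_{(f)}`. -/
def toAway (f : MvPolynomial (Fin (1 + 1)) k) :
    k →+* HomogeneousLocalization.Away (lineGrading k) f :=
  (HomogeneousLocalization.fromZeroRingHom (lineGrading k) _).comp
    (algebraMap k (lineGrading k 0))

lemma val_toAway (f : MvPolynomial (Fin (1 + 1)) k) (c : k) :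
    (toAway k f c).val =
      algebraMap (MvPolynomial (Fin (1 + 1)) k) (Localization.Away f) (MvPolynomial.C c) := rfl

/-- The coordinate `X_j / X_i`, `j ≠ i`, on `X_i ≠ 0`. -/
def lineCoord (i : Fin (1 + 1)) : HomogeneousLocalization.Away (lineGrading k) (MvPolynomial.X i) :=
  HomogeneousLocalization.Away.mk _ (X_mem_lineGrading k i) 1 (MvPolynomial.X i.rev)
    (by rw [one_smul]; exact X_mem_lineGrading k _)

/-- `k[X] → k[X_0, X_1]_{(X_i)}`, `X ↦ X_j / X_i`. -/
def lineChartHom (i : Fin (1 + 1)) :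
    Polynomial k →+* HomogeneousLocalization.Away (lineGrading k) (MvPolynomial.X i) :=
  Polynomial.eval₂RingHom (toAway k _) (lineCoord k i)

lemma lineChartHom_C (i : Fin (1 + 1)) (c : k) :
    lineChartHom k i (Polynomial.C c) = toAway k _ c := Polynomial.eval₂_C _ _

lemma lineChartHom_X (i : Fin (1 + 1)) :
    lineChartHom k i Polynomial.X = lineCoord k i := Polynomial.eval₂_X _ _

lemma lineChartHom_surjective (i : Fin (1 + 1)) : Function.Surjective (lineChartHom k i) := by
  intro x
  have hgen : Algebra.adjoin (lineGrading k 0)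
      (Set.range (MvPolynomial.X : Fin (1 + 1) → MvPolynomial (Fin (1 + 1)) k)) = ⊤ := by
    rw [← top_le_iff]
    rintro p -
    have h : p ∈ Algebra.adjoin k
        (Set.range (MvPolynomial.X : Fin (1 + 1) → MvPolynomial (Fin (1 + 1)) k)) := by
      rw [MvPolynomial.adjoin_range_X]; trivial
    induction h using Algebra.adjoin_induction with
    | mem x hx => exact Algebra.subset_adjoin hx
    | algebraMap r => exact Subalgebra.algebraMap_mem _ (algebraMap k (lineGrading k 0) r)
    | add x y _ _ hx hy => exact add_mem hx hy
    | mul x y _ _ hx hy => exact mul_mem hx hy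
  have hx : x ∈ (⊤ : Submodule (lineGrading k 0) _) := trivial
  rw [← HomogeneousLocalization.Away.span_mk_prod_pow_eq_top (X_mem_lineGrading k i)
    MvPolynomial.X hgen (fun _ => 1) (fun i => X_mem_lineGrading k i)] at hx
  change x ∈ (lineChartHom k i).range
  induction hx using Submodule.span_induction with
  | mem x hx =>
    obtain ⟨a, ai, hai, rfl⟩ := hx
    refine ⟨Polynomial.X ^ ai i.rev, HomogeneousLocalization.val_injective _ ?_⟩
    rw [map_pow, lineChartHom_X, HomogeneousLocalization.val_pow, lineCoord,
      HomogeneousLocalization.Away.val_mk, HomogeneousLocalization.Away.val_mk,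
      Localization.mk_pow, Localization.mk_eq_mk_iff, Localization.r_iff_exists]
    refine ⟨1, ?_⟩
    rw [Fin.sum_univ_two] at hai
    rw [Fin.prod_univ_two]
    simp only [smul_eq_mul, mul_one] at hai
    subst hai
    fin_cases i
    · simp [Fin.rev]; ring
    · simp [Fin.rev]; ring
  | zero => exact zero_mem _
  | add x y _ _ hx hy => exact add_mem hx hy
  | smul a x _ hx =>
    obtain ⟨a, ha⟩ := a
    rw [lineGrading, MvPolynomial.homogeneousSubmodule_zero, Submodule.mem_one] at ha
    obtain ⟨c, rfl⟩ := ha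
    rw [Algebra.smul_def]
    exact mul_mem ⟨Polynomial.C c, lineChartHom_C k i c⟩ hx

variable {k}

/-- The homomorphism `k[X_0, X_1]_{(f)} → R` given by elements of `R`. -/
def awayEval {R : Type u} [CommRing R] [Algebra k R] (v : Fin (1 + 1) → R)
    (f : MvPolynomial (Fin (1 + 1)) k) (hf : IsUnit (MvPolynomial.aeval v f)) :
    HomogeneousLocalization.Away (lineGrading k) f →+* R :=
  (Localization.awayLift (MvPolynomial.aeval (R := k) v).toRingHom f hf).comp
    (algebraMap _ (Localization.Away f))

lemma awayEval_toAway {R : Type u} [CommRing R] [Algebra k R] (v : Fin (1 + 1) → R)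
    (f : MvPolynomial (Fin (1 + 1)) k) (hf : IsUnit (MvPolynomial.aeval v f)) (c : k) :
    awayEval v f hf (toAway k f c) = algebraMap k R c := by
  change Localization.awayLift _ f hf (toAway k f c).val = _
  rw [val_toAway, Localization.awayLift, IsLocalization.Away.lift_eq]
  exact MvPolynomial.aeval_C _ _

lemma awayEval_mk_mul {R : Type u} [CommRing R] [Algebra k R] (v : Fin (1 + 1) → R)
    (f : MvPolynomial (Fin (1 + 1)) k) (hf : IsUnit (MvPolynomial.aeval v f)) {d : ℕ}
    (hfd : f ∈ lineGrading k d) (n : ℕ) (a : MvPolynomial (Fin (1 + 1)) k) (ha) :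
    awayEval v f hf (HomogeneousLocalization.Away.mk _ hfd n a ha) * MvPolynomial.aeval v f ^ n =
      MvPolynomial.aeval v a := by
  change Localization.awayLift _ f hf (HomogeneousLocalization.Away.mk _ hfd n a ha).val * _ = _
  rw [HomogeneousLocalization.Away.val_mk, ← map_pow]
  have h1 : MvPolynomial.aeval (R := k) v (f ^ n) = Localization.awayLift
      (MvPolynomial.aeval (R := k) v).toRingHom f hf (algebraMap _ _ (f ^ n)) :=
    (IsLocalization.Away.lift_eq _ _ _).symm
  have h2 : MvPolynomial.aeval (R := k) v a = Localization.awayLift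
      (MvPolynomial.aeval (R := k) v).toRingHom f hf (algebraMap _ _ a) :=
    (IsLocalization.Away.lift_eq _ _ _).symm
  rw [h1, h2, ← map_mul, Localization.mk_eq_mk', IsLocalization.mk'_spec]

variable (k)

lemma lineChartHom_injective (i : Fin (1 + 1)) : Function.Injective (lineChartHom k i) := by
  have hf : IsUnit (MvPolynomial.aeval (R := k)
      (fun j => if j = i then (1 : Polynomial k) else Polynomial.X)
      (MvPolynomial.X i : MvPolynomial (Fin (1 + 1)) k)) := by
    rw [MvPolynomial.aeval_X, if_pos rfl]; exact isUnit_one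
  have h : (awayEval _ _ hf).comp (lineChartHom k i) = RingHom.id _ := by
    refine Polynomial.ringHom_ext (fun c => ?_) ?_
    · rw [RingHom.comp_apply, lineChartHom_C, awayEval_toAway]; rfl
    · rw [RingHom.comp_apply, lineChartHom_X]
      have := awayEval_mk_mul _ _ hf (X_mem_lineGrading k i) 1 (MvPolynomial.X i.rev)
        (by rw [one_smul]; exact X_mem_lineGrading k _)
      rw [MvPolynomial.aeval_X, MvPolynomial.aeval_X, if_pos rfl, one_pow, mul_one, if_neg] at this
      · exact this
      · clear this hf; revert i; decide
  exact Function.LeftInverse.injective (g := awayEval _ _ hf) fun x => congrArg (fun f => f x) h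

/-- The isomorphism of `k[X]` with the ring of the chart `X_i ≠ 0`. -/
def lineChartEquiv (i : Fin (1 + 1)) :
    Polynomial k ≃+* HomogeneousLocalization.Away (lineGrading k) (MvPolynomial.X i) :=
  RingEquiv.ofBijective (lineChartHom k i)
    ⟨lineChartHom_injective k i, lineChartHom_surjective k i⟩

/-- The two standard charts of `Proj k[X_0, X_1]`. -/
def projChart (i : Fin (1 + 1)) : Spec (.of (Polynomial k)) ⟶ Proj (lineGrading k) :=
  Spec.map (CommRingCat.ofHom (lineChartEquiv k i).symm.toRingHom) ≫
    Proj.awayι (lineGrading k) (MvPolynomial.X i) (X_mem_lineGrading k i) one_pos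

lemma SpecMap_projChartHom_projChart (i : Fin (1 + 1)) :
    Spec.map (CommRingCat.ofHom (lineChartHom k i)) ≫ projChart k i =
      Proj.awayι (lineGrading k) (MvPolynomial.X i) (X_mem_lineGrading k i) one_pos := by
  rw [projChart, ← Category.assoc, ← Spec.map_comp, ← CommRingCat.ofHom_comp]
  have : (lineChartHom k i).comp (lineChartEquiv k i).symm.toRingHom = RingHom.id _ :=
    RingHom.ext fun x => (lineChartEquiv k i).apply_symm_apply x
  rw [this, CommRingCat.ofHom_id, Spec.map_id, Category.id_comp]

instance (i : Fin (1 + 1)) : IsOpenImmersion (projChart k i) := by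
  have : IsIso (CommRingCat.ofHom (lineChartEquiv k i).symm.toRingHom) :=
    (ConcreteCategory.isIso_iff_bijective _).2 (lineChartEquiv k i).symm.bijective
  unfold projChart
  infer_instance

lemma projChart_str (i : Fin (1 + 1)) :
    projChart k i ≫ Proj.toSpecZero (lineGrading k) ≫
      Spec.map (CommRingCat.ofHom (algebraMap k (lineGrading k 0))) =
      Spec.map (CommRingCat.ofHom Polynomial.C) := by
  rw [projChart, Category.assoc, Proj.awayι_toSpecZero_assoc, ← Spec.map_comp,
    ← Spec.map_comp, ← CommRingCat.ofHom_comp, ← CommRingCat.ofHom_comp]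
  congr 2
  refine RingHom.ext fun c => (lineChartEquiv k i).injective ?_
  rw [RingHom.comp_apply]
  refine ((lineChartEquiv k i).apply_symm_apply _).trans ?_
  exact (lineChartHom_C k i c).symm

lemma range_projChart (i : Fin (1 + 1)) : Set.range (projChart k i) =
    (Proj.basicOpen (lineGrading k) (MvPolynomial.X i) : Set (Proj (lineGrading k))) := by
  rw [← Proj.opensRange_awayι (lineGrading k) _ (X_mem_lineGrading k i) one_pos]
  apply Set.Subset.antisymm
  · rintro _ ⟨x, rfl⟩
    exact ⟨_, rfl⟩
  · rintro _ ⟨x, rfl⟩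
    rw [← SpecMap_projChartHom_projChart]
    exact ⟨_, rfl⟩

lemma range_projChart_union : Set.range (projChart k 0) ∪ Set.range (projChart k 1) =
    Set.univ := by
  have h := Proj.iSup_basicOpen_eq_top' (𝒜 := lineGrading k)
    (f := fun i : Fin (1 + 1) => MvPolynomial.X i) (fun i => ⟨1, X_mem_lineGrading k i⟩) (by
      rw [← top_le_iff]
      rintro p -
      have h : p ∈ Algebra.adjoin k
          (Set.range (MvPolynomial.X : Fin (1 + 1) → MvPolynomial (Fin (1 + 1)) k)) := by
        rw [MvPolynomial.adjoin_range_X]; trivial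
      induction h using Algebra.adjoin_induction with
      | mem x hx => exact Algebra.subset_adjoin hx
      | algebraMap r => exact Subalgebra.algebraMap_mem _ (algebraMap k (lineGrading k 0) r)
      | add x y _ _ hx hy => exact add_mem hx hy
      | mul x y _ _ hx hy => exact mul_mem hx hy)
  rw [Set.eq_univ_iff_forall]
  intro x
  have hx : x ∈ (⨆ i : Fin (1 + 1), Proj.basicOpen (lineGrading k) (MvPolynomial.X i)) := by
    rw [h]; trivial
  rw [TopologicalSpace.Opens.mem_iSup] at hx
  obtain ⟨i, hi⟩ := hx
  rw [range_projChart, range_projChart]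
  fin_cases i
  · exact Or.inl hi
  · exact Or.inr hi

/-- The change of coordinates `X ↦ X⁻¹` between the two charts. -/
lemma SpecMap_aeval_projChart {R : Type u} [CommRing R] [Algebra k R] {t s : R} (h : t * s = 1) :
    Spec.map (CommRingCat.ofHom (Polynomial.aeval (R := k) t).toRingHom) ≫ projChart k 0 =
      Spec.map (CommRingCat.ofHom (Polynomial.aeval (R := k) s).toRingHom) ≫ projChart k 1 := by
  set x : MvPolynomial (Fin (1 + 1)) k := MvPolynomial.X 0 * MvPolynomial.X 1 with hx
  have hx' : x = MvPolynomial.X 1 * MvPolynomial.X 0 := mul_comm _ _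
  set v : Fin (1 + 1) → R := ![1, t] with hv
  have hf : IsUnit (MvPolynomial.aeval (R := k) v x) := by
    rw [hx, map_mul, MvPolynomial.aeval_X, MvPolynomial.aeval_X]
    simpa [hv] using IsUnit.of_mul_eq_one s h
  have key : ∀ (i : Fin (1 + 1)) (hxi : x = MvPolynomial.X i * MvPolynomial.X i.rev) (r : R),
      r * v i = v i.rev →
      Spec.map (CommRingCat.ofHom (Polynomial.aeval (R := k) r).toRingHom) ≫ projChart k i =
      Spec.map (CommRingCat.ofHom (awayEval v x hf)) ≫
        Proj.awayι (lineGrading k) x (m := 2)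
          (hxi ▸ SetLike.mul_mem_graded (X_mem_lineGrading k i) (X_mem_lineGrading k i.rev))
          two_pos := by
    intro i hxi r hr
    rw [← Proj.SpecMap_awayMap_awayι (lineGrading k) (X_mem_lineGrading k i) one_pos
      (X_mem_lineGrading k i.rev) hxi, projChart, ← Category.assoc, ← Category.assoc,
      ← Spec.map_comp, ← Spec.map_comp, ← CommRingCat.ofHom_comp, ← CommRingCat.ofHom_comp]
    congr 3
    have h0 : (awayEval v x hf).comp ((HomogeneousLocalization.awayMap (lineGrading k)
        (X_mem_lineGrading k i.rev) hxi).comp (lineChartHom k i)) =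
        (Polynomial.aeval (R := k) r).toRingHom := by
      refine Polynomial.ringHom_ext (fun c => ?_) ?_
      · rw [RingHom.comp_apply, RingHom.comp_apply, lineChartHom_C]
        have : HomogeneousLocalization.awayMap (lineGrading k) (X_mem_lineGrading k i.rev) hxi
            (toAway k _ c) = toAway k x c :=
          HomogeneousLocalization.awayMap_fromZeroRingHom _ _ _ _
        rw [this, awayEval_toAway]
        exact (Polynomial.aeval_C _ _).symm
      · rw [RingHom.comp_apply, RingHom.comp_apply, lineChartHom_X, lineCoord,
          HomogeneousLocalization.awayMap_mk]
        have := awayEval_mk_mul v x hf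
          (hxi ▸ SetLike.mul_mem_graded (X_mem_lineGrading k i) (X_mem_lineGrading k i.rev)) 1
          (MvPolynomial.X i.rev * MvPolynomial.X i.rev ^ 1) (by
            rw [one_smul, pow_one]
            exact SetLike.mul_mem_graded (X_mem_lineGrading k _) (X_mem_lineGrading k _))
        refine (hf.pow 1).mul_right_cancel (this.trans ?_)
        change _ = Polynomial.aeval (R := k) r Polynomial.X * _
        rw [Polynomial.aeval_X, hxi]
        simp only [map_mul, MvPolynomial.aeval_X, pow_one]
        rw [← hr]; ring
    rw [← h0]
    refine RingHom.ext fun z => ?_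
    obtain ⟨z, rfl⟩ := (lineChartEquiv k i).surjective z
    change awayEval v x hf (HomogeneousLocalization.awayMap (lineGrading k)
      (X_mem_lineGrading k i.rev) hxi (lineChartHom k i
      ((lineChartEquiv k i).symm (lineChartEquiv k i z)))) = _
    rw [(lineChartEquiv k i).symm_apply_apply]
    rfl
  have h1 := key 0 hx t (by simp [hv])
  have h2 := key 1 hx' s (by
    change s * t = 1
    rw [mul_comm, h])
  rw [h1, h2]

lemma projChart_one_mem_range_zero (p : PrimeSpectrum (Polynomial k)) :
    projChart k 1 p ∈ Set.range (projChart k 0) ↔ Polynomial.X ∉ p.asIdeal := by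
  rw [range_projChart]
  have h := Proj.awayι_preimage_basicOpen (lineGrading k) (X_mem_lineGrading k 1) one_pos
    (X_mem_lineGrading k 0) one_pos
  have h1 : projChart k 1 p ∈ (Proj.basicOpen (lineGrading k) (MvPolynomial.X 0)) ↔
      Spec.map (CommRingCat.ofHom (lineChartEquiv k 1).symm.toRingHom) p ∈
        Proj.awayι (lineGrading k) (MvPolynomial.X 1) (X_mem_lineGrading k 1) one_pos ⁻¹ᵁ
          Proj.basicOpen (lineGrading k) (MvPolynomial.X 0) := Iff.rfl
  refine h1.trans ?_
  rw [h]
  change (lineChartEquiv k 1).symm _ ∉ p.asIdeal ↔ _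
  have h2 : (HomogeneousLocalization.Away.isLocalizationElem (X_mem_lineGrading k 1)
      (X_mem_lineGrading k 0)) = lineChartEquiv k 1 Polynomial.X := by
    refine HomogeneousLocalization.val_injective _ ?_
    change _ = (lineChartHom k 1 Polynomial.X).val
    rw [lineChartHom_X]
    simp [lineCoord, HomogeneousLocalization.Away.val_mk, Fin.rev]
  rw [h2, RingEquiv.symm_apply_apply]

/-- The identity `Proj k[X_0, X_1] → ℙ^1`. -/
def projToLine : Proj (lineGrading k) ⟶ projectiveSpace 1 k := 𝟙 (Proj (lineGrading k))

instance : IsIso (projToLine k) := inferInstanceAs (IsIso (𝟙 (Proj (lineGrading k))))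

lemma projToLine_projectiveStr : projToLine k ≫ projectiveStr 1 k =
    Proj.toSpecZero (lineGrading k) ≫
      Spec.map (CommRingCat.ofHom (algebraMap k (lineGrading k 0))) :=
  Category.id_comp _

/-- The two standard charts of the projective line. -/
def lineChart (i : Fin (1 + 1)) : Spec (.of (Polynomial k)) ⟶ projectiveSpace 1 k :=
  projChart k i ≫ projToLine k

instance (i : Fin (1 + 1)) : IsOpenImmersion (lineChart k i) := by
  unfold lineChart; infer_instance

lemma lineChart_projectiveStr (i : Fin (1 + 1)) :
    lineChart k i ≫ projectiveStr 1 k = Spec.map (CommRingCat.ofHom Polynomial.C) := by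
  rw [lineChart, Category.assoc, projToLine_projectiveStr, projChart_str]

lemma mem_range_lineChart (x : projectiveSpace 1 k) :
    x ∈ Set.range (lineChart k 0) ∨ x ∈ Set.range (lineChart k 1) := by
  have h : (show Proj (lineGrading k) from x) ∈ _ ∪ _ :=
    (range_projChart_union k).symm.le trivial
  exact h

lemma SpecMap_aeval_lineChart {R : Type u} [CommRing R] [Algebra k R] {t s : R} (h : t * s = 1) :
    Spec.map (CommRingCat.ofHom (Polynomial.aeval (R := k) t).toRingHom) ≫ lineChart k 0 =
      Spec.map (CommRingCat.ofHom (Polynomial.aeval (R := k) s).toRingHom) ≫ lineChart k 1 := by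
  rw [lineChart, lineChart, ← Category.assoc, SpecMap_aeval_projChart k h, Category.assoc]

lemma lineChart_one_mem_range_zero (p : PrimeSpectrum (Polynomial k)) :
    lineChart k 1 p ∈ Set.range (lineChart k 0) ↔ Polynomial.X ∉ p.asIdeal :=
  projChart_one_mem_range_zero k p

end

/-! ## Gluing along open covers by integral schemes -/

section

universe v

variable {U : Scheme.{u}} {J : Type v} {V : J → Scheme.{u}} (ι : ∀ j, V j ⟶ U)
  [∀ j, IsOpenImmersion (ι j)]

/-- The open cover given by a jointly surjective family of open immersions. -/
def openCoverOf (hcov : ∀ x, ∃ j, x ∈ Set.range (ι j)) :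
    Scheme.OpenCover.{v} U where
  I₀ := J
  X := V
  f := ι
  mem₀ := by
    rw [Scheme.presieve₀_mem_precoverage_iff]
    exact ⟨hcov, inferInstance⟩

lemma isIntegral_of_cover [Nonempty J] [∀ j, IsIntegral (V j)]
    (hcov : ∀ x, ∃ j, x ∈ Set.range (ι j))
    (hne : ∀ i j, (Set.range (ι i) ∩ Set.range (ι j)).Nonempty) : IsIntegral U := by
  have hV : ∀ j, AlgebraicGeometry.IsReduced ((openCoverOf ι hcov).X j) := fun j : J =>
    isReduced_of_isIntegral (V j)
  have hred : AlgebraicGeometry.IsReduced U := AlgebraicGeometry.IsReduced.of_openCover U (openCoverOf ι hcov)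
  have hirr : ∀ j, IsIrreducible (Set.range (ι j)) := fun j => by
    rw [← Set.image_univ]
    exact (irreducibleSpace_def _).1 inferInstance |>.image _ (ι j).continuous.continuousOn
  have hop : ∀ j, IsOpen (Set.range (ι j)) := fun j => (ι j).isOpenEmbedding.isOpen_range
  have hpre : IsPreirreducible (Set.univ : Set U) := by
    rintro A B hA hB ⟨a, -, ha⟩ ⟨b, -, hb⟩
    obtain ⟨i, hi⟩ := hcov a
    obtain ⟨j, hj⟩ := hcov b
    obtain ⟨c, hc⟩ := hne i j
    obtain ⟨x, hxi, hxA, hxj⟩ := (hirr i).2 A (Set.range (ι j)) hA (hop j) ⟨a, hi, ha⟩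
      ⟨c, hc.1, hc.2⟩
    obtain ⟨y, -, hyA, hyB⟩ := (hirr j).2 A B hA hB ⟨x, hxj, hxA⟩ ⟨b, hj, hb⟩
    exact ⟨y, trivial, hyA, hyB⟩
  have hnon : Nonempty U := (hirr (Classical.arbitrary J)).1.to_subtype.map Subtype.val
  have : IrreducibleSpace U := (irreducibleSpace_def _).2 ⟨Set.univ_nonempty, hpre⟩
  exact isIntegral_of_irreducibleSpace_of_isReduced U

/-- Morphisms to a separated scheme that agree at a common generic point can be glued. -/
lemma exists_glue [∀ j, IsIntegral (V j)] (hcov : ∀ x, ∃ j, x ∈ Set.range (ι j))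
    {T : Scheme.{u}} (η : ∀ j, T ⟶ V j) [∀ j, IsDominant (η j)]
    (hη : ∀ i j, η i ≫ ι i = η j ≫ ι j) {X S : Scheme.{u}} (str : X ⟶ S) [IsSeparated str]
    (g : U ⟶ S) (f : ∀ j, V j ⟶ X) (hf : ∀ j, f j ≫ str = ι j ≫ g)
    (hfη : ∀ i j, η i ≫ f i = η j ≫ f j) :
    ∃ ev : U ⟶ X, (∀ j, ι j ≫ ev = f j) ∧ ev ≫ str = g := by
  have hagree : ∀ i j, pullback.fst (ι i) (ι j) ≫ f i = pullback.snd (ι i) (ι j) ≫ f j := by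
    intro i j
    have hred : AlgebraicGeometry.IsReduced (pullback (ι i) (ι j)) :=
      isReduced_of_isOpenImmersion (pullback.fst (ι i) (ι j))
    have hdom : IsDominant (pullback.lift (η i) (η j) (hη i j)) := by
      refine ⟨fun z => ?_⟩
      rw [mem_closure_iff]
      intro o ho hz
      have hop : IsOpen (pullback.fst (ι i) (ι j) '' o) :=
        (pullback.fst (ι i) (ι j)).isOpenEmbedding.isOpenMap _ ho
      obtain ⟨_, ⟨y, hy, hyt⟩, t, rfl⟩ :=
        (η i).denseRange.inter_open_nonempty _ hop ⟨_, z, hz, rfl⟩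
      refine ⟨y, hy, t, (pullback.fst (ι i) (ι j)).isOpenEmbedding.injective ?_⟩
      rw [hyt, ← Scheme.Hom.comp_apply, pullback.lift_fst]
    refine ext_of_isDominant_of_isSeparated str ?_ (pullback.lift (η i) (η j) (hη i j)) ?_
    · rw [Category.assoc, Category.assoc, hf, hf, pullback.condition_assoc]
    · rw [pullback.lift_fst_assoc, pullback.lift_snd_assoc, hfη]
  let ev := Scheme.Cover.glueMorphisms (openCoverOf ι hcov) f hagree
  have hev : ∀ j, ι j ≫ ev = f j :=
    fun j => Scheme.Cover.ι_glueMorphisms (openCoverOf ι hcov) f hagree j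
  refine ⟨ev, hev, Scheme.Cover.hom_ext (openCoverOf ι hcov) _ _ fun j => ?_⟩
  exact (Category.assoc _ _ _).symm.trans ((congrArg (· ≫ str) (hev j)).trans (hf j))

end

/-! ## The projective line over an affine base -/

section

variable (k : Type u) [Field k] (B : Type u) [CommRing B] [Algebra k B]

/-- The structure morphism `Spec B → Spec k`. -/
abbrev baseStr : Spec (.of B) ⟶ Spec (.of k) := Spec.map (CommRingCat.ofHom (algebraMap k B))

/-- The projective line over `Spec B`. -/
abbrev relLine : Scheme.{u} := pullback (baseStr k B) (projectiveStr 1 k)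

/-- The two standard charts of the projective line over `Spec B`. -/
def relChart (i : Fin (1 + 1)) : Spec (.of (Polynomial B)) ⟶ relLine k B :=
  pullback.lift (Spec.map (CommRingCat.ofHom Polynomial.C))
    (Spec.map (CommRingCat.ofHom (Polynomial.mapRingHom (algebraMap k B))) ≫ lineChart k i) (by
      rw [Category.assoc, lineChart_projectiveStr, ← Spec.map_comp, ← Spec.map_comp,
        ← CommRingCat.ofHom_comp, ← CommRingCat.ofHom_comp, Polynomial.mapRingHom_comp_C])

lemma relChart_fst (i : Fin (1 + 1)) :
    relChart k B i ≫ pullback.fst _ _ = Spec.map (CommRingCat.ofHom Polynomial.C) :=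
  pullback.lift_fst _ _ _

lemma relChart_snd (i : Fin (1 + 1)) : relChart k B i ≫ pullback.snd _ _ =
    Spec.map (CommRingCat.ofHom (Polynomial.mapRingHom (algebraMap k B))) ≫ lineChart k i :=
  pullback.lift_snd _ _ _

attribute [local instance] Polynomial.algebra in
lemma isPullback_relChart (i : Fin (1 + 1)) : IsPullback (relChart k B i)
    (Spec.map (CommRingCat.ofHom (Polynomial.mapRingHom (algebraMap k B))))
    (pullback.snd (baseStr k B) (projectiveStr 1 k)) (lineChart k i) := by
  have h1 : IsPullback (Spec.map (CommRingCat.ofHom (Polynomial.C : B →+* _)))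
      (Spec.map (CommRingCat.ofHom (Polynomial.mapRingHom (algebraMap k B))))
      (baseStr k B) (Spec.map (CommRingCat.ofHom Polynomial.C)) :=
    isPullback_SpecMap_of_isPushout _ _ _ _
      (CommRingCat.isPushout_of_isPushout k B (Polynomial k) (Polynomial B))
  rw [← relChart_fst k B i, ← lineChart_projectiveStr k i] at h1
  exact IsPullback.of_right h1 (relChart_snd k B i)
    (IsPullback.of_hasPullback (baseStr k B) (projectiveStr 1 k))

instance (i : Fin (1 + 1)) : IsOpenImmersion (relChart k B i) :=
  MorphismProperty.of_isPullback (isPullback_relChart k B i).flip inferInstance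

lemma mem_range_relChart_iff (i : Fin (1 + 1)) (x : relLine k B) :
    x ∈ Set.range (relChart k B i) ↔
      pullback.snd (baseStr k B) (projectiveStr 1 k) x ∈ Set.range (lineChart k i) := by
  rw [← Set.mem_preimage, ← Scheme.Pullback.range_fst,
    ← (isPullback_relChart k B i).isoPullback_hom_fst]
  constructor
  · rintro ⟨y, rfl⟩
    exact ⟨_, rfl⟩
  · rintro ⟨y, rfl⟩
    refine ⟨(isPullback_relChart k B i).isoPullback.inv y, ?_⟩
    rw [← Scheme.Hom.comp_apply, Iso.inv_hom_id_assoc]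

lemma mem_range_relChart (x : relLine k B) :
    x ∈ Set.range (relChart k B 0) ∨ x ∈ Set.range (relChart k B 1) := by
  rw [mem_range_relChart_iff, mem_range_relChart_iff]
  exact mem_range_lineChart k _

lemma relChart_one_mem_range_zero (p : PrimeSpectrum (Polynomial B)) :
    relChart k B 1 p ∈ Set.range (relChart k B 0) ↔ Polynomial.X ∉ p.asIdeal := by
  rw [mem_range_relChart_iff]
  have h : pullback.snd (baseStr k B) (projectiveStr 1 k) (relChart k B 1 p) =
      lineChart k 1 (PrimeSpectrum.comap (Polynomial.mapRingHom (algebraMap k B)) p) :=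
    congrArg (fun f : Spec (.of (Polynomial B)) ⟶ projectiveSpace 1 k => f p) (relChart_snd k B 1)
  rw [h, lineChart_one_mem_range_zero]
  change Polynomial.mapRingHom (algebraMap k B) Polynomial.X ∉ p.asIdeal ↔ _
  rw [Polynomial.coe_mapRingHom, Polynomial.map_X]

/-- The change of coordinates `X ↦ X⁻¹` between the two charts. -/
lemma SpecMap_eval₂_relChart {R : Type u} [CommRing R] (g : B →+* R) {t s : R} (h : t * s = 1) :
    Spec.map (CommRingCat.ofHom (Polynomial.eval₂RingHom g t)) ≫ relChart k B 0 =
      Spec.map (CommRingCat.ofHom (Polynomial.eval₂RingHom g s)) ≫ relChart k B 1 := by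
  let _ := (g.comp (algebraMap k B)).toAlgebra
  have h1 : ∀ r : R, (Polynomial.eval₂RingHom g r).comp
      (Polynomial.mapRingHom (algebraMap k B)) = (Polynomial.aeval (R := k) r).toRingHom := by
    intro r
    refine Polynomial.ringHom_ext (fun c => ?_) ?_
    · simp [RingHom.algebraMap_toAlgebra]
    · simp
  apply pullback.hom_ext
  · rw [Category.assoc, Category.assoc, relChart_fst, relChart_fst, ← Spec.map_comp,
      ← Spec.map_comp, ← CommRingCat.ofHom_comp, ← CommRingCat.ofHom_comp]
    congr 2
    ext; simp
  · rw [Category.assoc, Category.assoc, relChart_snd, relChart_snd, ← Category.assoc,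
      ← Category.assoc, ← Spec.map_comp, ← Spec.map_comp, ← CommRingCat.ofHom_comp,
      ← CommRingCat.ofHom_comp, h1, h1]
    exact SpecMap_aeval_lineChart k h

end

/-! ## Morphisms from one-parameter families of characters -/

section

variable {d : ℕ}

/-- The character `m ↦ ∏ v_i ^ m_i`. -/
def unitChar {R : Type*} [CommRing R] (v : Fin d → Rˣ) : Multiplicative (Fin d → ℤ) →* R where
  toFun m := ((∏ i, v i ^ m.toAdd i : Rˣ) : R)
  map_one' := by simp
  map_mul' a b := by
    rw [← Units.val_mul, ← Finset.prod_mul_distrib]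
    simp [zpow_add]

lemma map_unitChar {R S : Type*} [CommRing R] [CommRing S] (f : R →+* S) (v : Fin d → Rˣ)
    (m : Multiplicative (Fin d → ℤ)) :
    f (unitChar v m) = unitChar (fun i => Units.map f (v i)) m := by
  change f ((∏ i, v i ^ m.toAdd i : Rˣ) : R) = ((∏ i, (Units.map f (v i)) ^ m.toAdd i : Sˣ) : S)
  have h : Units.map (f : R →* S) (∏ i, v i ^ m.toAdd i) =
      ∏ i, (Units.map (f : R →* S) (v i)) ^ m.toAdd i := by simp
  rw [← h]
  rfl

lemma unitChar_mul_zpow {L : Type*} [Field L] (v : Fin d → Lˣ) (z : Lˣ) (u : Fin d → ℤ)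
    (m : Multiplicative (Fin d → ℤ)) :
    unitChar (fun i => v i * z ^ u i) m =
      (z : L) ^ intPairing m.toAdd u * unitChar v m := by
  change ((∏ i, (v i * z ^ u i) ^ m.toAdd i : Lˣ) : L) = _ * ((∏ i, v i ^ m.toAdd i : Lˣ) : L)
  rw [← Units.val_zpow_eq_zpow_val, ← Units.val_mul]
  congr 1
  simp_rw [mul_zpow, Finset.prod_mul_distrib, ← zpow_mul, intPairing]
  rw [mul_comm]
  congr 1
  induction (Finset.univ : Finset (Fin d)) using Finset.induction_on with
  | empty => simp
  | insert a s ha ih =>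
    rw [Finset.prod_insert ha, Finset.sum_insert ha, zpow_add, ih, mul_comm (u a)]

variable {k : Type u} [Field k] {R : Type u} [CommRing R] [Algebra k R]

/-- The comorphism of the morphism to `T × 𝔸^1` given by units `v_i` and a function `z`. -/
def paramHom (v : Fin d → Rˣ) (z : R) : Polynomial (AddMonoidAlgebra k (Fin d → ℤ)) →+* R :=
  Polynomial.eval₂RingHom (AddMonoidAlgebra.lift k R _ (unitChar v)).toRingHom z

lemma paramHom_X (v : Fin d → Rˣ) (z : R) : paramHom (k := k) v z Polynomial.X = z :=
  Polynomial.eval₂_X _ _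

lemma paramHom_C_single (v : Fin d → Rˣ) (z : R) (m : Fin d → ℤ) :
    paramHom (k := k) v z (Polynomial.C (AddMonoidAlgebra.single m 1)) =
      unitChar v (Multiplicative.ofAdd m) := by
  refine (Polynomial.eval₂_C _ _).trans ?_
  change AddMonoidAlgebra.lift k R _ (unitChar v) _ = _
  rw [AddMonoidAlgebra.lift_single, one_smul]

/-- The comorphism of `τ s^u` evaluated at units `v` and at a function `z`. -/
def familyHom (σ : PointedCone ℝ (Fin d → ℝ)) (u : Fin d → ℤ)
    (hu : ∀ m ∈ dualMonoid σ, 0 ≤ intPairing m u) (v : Fin d → Rˣ) (z : R) :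
    AddMonoidAlgebra k (dualMonoid σ) →+* R :=
  (paramHom v z).comp (oneParam k σ u hu).toRingHom

lemma familyHom_single (σ : PointedCone ℝ (Fin d → ℝ)) (u : Fin d → ℤ)
    (hu : ∀ m ∈ dualMonoid σ, 0 ≤ intPairing m u) (v : Fin d → Rˣ) (z : R) (m : dualMonoid σ) :
    familyHom (k := k) σ u hu v z (AddMonoidAlgebra.single m 1) =
      z ^ (intPairing m.1 u).toNat * unitChar v (Multiplicative.ofAdd m.1) := by
  change paramHom v z (oneParam k σ u hu _) = _
  rw [oneParam_single, map_mul, map_pow, paramHom_X, paramHom_C_single]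

lemma familyHom_comp_algebraMap (σ : PointedCone ℝ (Fin d → ℝ)) (u : Fin d → ℤ)
    (hu : ∀ m ∈ dualMonoid σ, 0 ≤ intPairing m u) (v : Fin d → Rˣ) (z : R) :
    (familyHom (k := k) σ u hu v z).comp (algebraMap k _) = algebraMap k R := by
  refine RingHom.ext fun c => ?_
  change paramHom v z (oneParam k σ u hu (algebraMap k _ c)) = _
  rw [AlgHom.commutes]
  refine (Polynomial.eval₂_C _ _).trans ?_
  exact (AddMonoidAlgebra.lift k R _ (unitChar v)).commutes c

variable (F : Fan d) {X : Scheme.{u}} (e : X ≅ F.toricVariety k)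

/-- The morphism `τ s^u` evaluated at units `v` and at a function `z`. -/
def familyMap (σ : F.cones) (u : Fin d → ℤ)
    (hu : ∀ m ∈ dualMonoid σ.1, 0 ≤ intPairing m u) (v : Fin d → Rˣ) (z : R) :
    Spec (.of R) ⟶ X :=
  Spec.map (CommRingCat.ofHom (familyHom (k := k) σ.1 u hu v z)) ≫ chartTo F e σ

lemma familyMap_str {str : X ⟶ Spec (.of k)} (he : e.hom ≫ F.toricStr k = str) (σ : F.cones)
    (u : Fin d → ℤ) (hu : ∀ m ∈ dualMonoid σ.1, 0 ≤ intPairing m u) (v : Fin d → Rˣ) (z : R) :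
    familyMap F e σ u hu v z ≫ str = Spec.map (CommRingCat.ofHom (algebraMap k R)) := by
  rw [familyMap, Category.assoc, chartTo_comp F e he, ← Spec.map_comp, ← CommRingCat.ofHom_comp,
    familyHom_comp_algebraMap]

/-- The morphism to the torus with coordinates `v`. -/
def torusMap (v : Fin d → Rˣ) : Spec (.of R) ⟶ X :=
  Spec.map (CommRingCat.ofHom
    (charHom (k := k) F.zeroCone.1 (restrictChar F.zeroCone.1 (unitChar v))).toRingHom) ≫
      chartTo F e F.zeroCone

lemma familyMap_eq_torusMap {L : Type u} [Field L] [Algebra k L] (g : R →ₐ[k] L) (σ : F.cones)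
    (u : Fin d → ℤ) (hu : ∀ m ∈ dualMonoid σ.1, 0 ≤ intPairing m u) (v : Fin d → Rˣ) (z : R)
    (V : Fin d → Lˣ) (hz : g z ≠ 0) (hV : ∀ i, (V i : L) = g (v i) * g z ^ u i) :
    Spec.map (CommRingCat.ofHom g.toRingHom) ≫ familyMap F e σ u hu v z =
      torusMap (k := k) F e V := by
  rw [torusMap, ← SpecMap_charHom_chartTo F e (unitChar V) σ, familyMap, ← Category.assoc,
    ← Spec.map_comp, ← CommRingCat.ofHom_comp]
  congr 3
  refine AddMonoidAlgebra.ringHom_ext (fun c => ?_) (fun m => ?_)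
  · change g (familyHom (k := k) σ.1 u hu v z (algebraMap k _ c)) =
      charHom (k := k) σ.1 _ (algebraMap k _ c)
    have := congrArg (fun f => f c) (familyHom_comp_algebraMap σ.1 u hu v z)
    change familyHom (k := k) σ.1 u hu v z (algebraMap k _ c) = _ at this
    rw [this, AlgHom.commutes, AlgHom.commutes]
  · change g (familyHom (k := k) σ.1 u hu v z _) = charHom (k := k) σ.1 _ _
    rw [familyHom_single, charHom_single, restrictChar_apply, map_mul, map_pow]
    have h1 : V = fun i => Units.map g.toRingHom (v i) * (Units.mk0 _ hz) ^ u i :=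
      funext fun i => Units.ext (by rw [hV]; simp)
    rw [h1, unitChar_mul_zpow, ← map_unitChar]
    congr 1
    change _ = g z ^ intPairing m.1 u
    rw [← zpow_natCast, Int.toNat_of_nonneg (hu m.1 m.2)]

lemma pulledIdeal_familyMap (σ : F.cones) (u : Fin d → ℤ)
    (hu : ∀ m ∈ dualMonoid σ.1, 0 ≤ intPairing m u) (v : Fin d → Rˣ) (z : R) {Z : Set X}
    (hZ : IsClosed Z) {c : ℕ} (hc : (idealOn (chartTo F e σ ⁻¹' Z)).map
      (oneParam k σ.1 u hu).toRingHom = Ideal.span {Polynomial.X ^ c}) (w : Spec (.of R)) :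
    pulledIdeal (familyMap F e σ u hu v z) Z w =
      (Ideal.span {z}).map (specToStalk R w) ^ c := by
  rw [familyMap, pulledIdeal_SpecMap_comp _ hZ, familyHom, ← Ideal.map_map, hc, Ideal.map_span,
    Set.image_singleton, map_pow, paramHom_X, ← Ideal.span_singleton_pow, Ideal.map_pow]

end

/-! ## Markings of the projective line and charts around them -/

lemma X_sub_C_mem_iff_of_relChart_eq (k : Type u) [Field k] (B : Type u) [CommRing B]
    [Algebra k B] {p q : PrimeSpectrum (Polynomial B)} (h : relChart k B 1 p = relChart k B 0 q)
    (b : B) : Polynomial.X - Polynomial.C b ∈ q.asIdeal ↔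
      1 - Polynomial.C b * Polynomial.X ∈ p.asIdeal := by
  set g := algebraMap (Polynomial B) p.asIdeal.ResidueField with hg
  have hker : ∀ f, g f = 0 ↔ f ∈ p.asIdeal := fun f =>
    Ideal.algebraMap_residueField_eq_zero
  have hX : g Polynomial.X ≠ 0 := by
    rw [Ne, hker, ← relChart_one_mem_range_zero k B p]
    exact ⟨q, h.symm⟩
  let o : PrimeSpectrum p.asIdeal.ResidueField := ⊥
  have h1 := SpecMap_eval₂_relChart k B (g.comp Polynomial.C) (inv_mul_cancel₀ hX)
  have h2 : Polynomial.eval₂RingHom (g.comp Polynomial.C) (g Polynomial.X) = g := by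
    refine Polynomial.ringHom_ext (fun c => ?_) ?_
    · exact Polynomial.eval₂_C _ _
    · exact Polynomial.eval₂_X _ _
  rw [h2] at h1
  have h3 : PrimeSpectrum.comap g o = p := by
    ext f
    change g f ∈ (⊥ : Ideal p.asIdeal.ResidueField) ↔ _
    rw [Ideal.mem_bot, hker]
  have h4 := congrArg (fun f : Spec (.of p.asIdeal.ResidueField) ⟶ relLine k B => f o) h1
  have h5 : relChart k B 0 (PrimeSpectrum.comap
      (Polynomial.eval₂RingHom (g.comp Polynomial.C) (g Polynomial.X)⁻¹) o) =
      relChart k B 1 p := h4.trans (congrArg (relChart k B 1) h3)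
  rw [h] at h5
  have h6 := (relChart k B 0).isOpenEmbedding.injective h5
  rw [← h6]
  change Polynomial.eval₂ _ _ _ ∈ (⊥ : Ideal p.asIdeal.ResidueField) ↔ _
  rw [Ideal.mem_bot, ← hker]
  simp only [Polynomial.eval₂_sub, Polynomial.eval₂_X, Polynomial.eval₂_C, map_sub, map_one,
    map_mul, RingHom.comp_apply]
  rw [sub_eq_zero, sub_eq_zero]
  constructor
  · intro h
    rw [← h, inv_mul_cancel₀ hX]
  · intro h
    exact (eq_inv_of_mul_eq_one_left h.symm).symm

section

variable (k : Type u) {B : Type u} [Field k] [CommRing B] [Algebra k B] {d : ℕ} (p : Fin d → B)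

/-- The first marking lies in the chart at infinity, the others in the affine line. -/
def chartIndex {d : ℕ} : Fin (d + 1) → Fin (1 + 1) := Fin.cases 1 fun _ => 0

/-- The coordinates of the markings. -/
def center : Fin (d + 1) → B := Fin.cases 0 p

/-- The lattice vectors `-∑ e_i, e_1, …, e_d` attached to the markings. -/
def slope {d : ℕ} : Fin (d + 1) → Fin d → ℤ := Fin.cases (fun _ => -1) fun j => Pi.single j 1

open Polynomial in
/-- The local equations near a marking of the other markings in the affine line. -/
def factor : Fin (d + 1) → Fin d → Polynomial B :=
  Fin.cases (fun i => 1 - C (p i) * X) fun j i => if i = j then 1 else X - C (p i)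

/-- The equation of the locus that is removed around a marking. -/
def denom (j : Fin (d + 1)) : Polynomial B := ∏ i, factor p j i

/-- The local equation of a marking. -/
def localParam (j : Fin (d + 1)) : Polynomial B := Polynomial.X - Polynomial.C (center p j)

/-- The coordinate ring of a neighbourhood of a marking. -/
abbrev MarkRing (j : Fin (d + 1)) : Type u := Localization.Away (denom p j)

/-- The markings. -/
def marking (j : Fin (d + 1)) : Spec (.of B) ⟶ relLine k B :=
  Spec.map (CommRingCat.ofHom (Polynomial.evalRingHom (center p j))) ≫
    relChart k B (chartIndex j)

/-- The neighbourhoods of the markings. -/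
def markChart (j : Fin (d + 1)) : Spec (.of (MarkRing p j)) ⟶ relLine k B :=
  Spec.map (CommRingCat.ofHom (algebraMap (Polynomial B) (MarkRing p j))) ≫
    relChart k B (chartIndex j)

instance (j : Fin (d + 1)) : IsOpenImmersion (markChart k p j) := by
  have : IsOpenImmersion
      (Spec.map (CommRingCat.ofHom (algebraMap (Polynomial B) (MarkRing p j)))) :=
    IsOpenImmersion.of_isLocalization (denom p j)
  unfold markChart
  infer_instance

lemma marking_fst (j : Fin (d + 1)) : marking k p j ≫ pullback.fst _ _ = 𝟙 _ := by
  rw [marking, Category.assoc, relChart_fst, ← Spec.map_comp, ← CommRingCat.ofHom_comp]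
  have : (Polynomial.evalRingHom (center p j)).comp Polynomial.C = RingHom.id B :=
    RingHom.ext fun b => Polynomial.eval_C
  rw [this, CommRingCat.ofHom_id, Spec.map_id]

lemma mem_range_marking (j : Fin (d + 1)) (x : relLine k B) :
    x ∈ Set.range (marking k p j) ↔ ∃ q : PrimeSpectrum (Polynomial B),
      relChart k B (chartIndex j) q = x ∧ localParam p j ∈ q.asIdeal := by
  have h := range_comap_of_surjective _ (Polynomial.evalRingHom (center p j))
    (fun b => ⟨Polynomial.C b, Polynomial.eval_C⟩)
  rw [Polynomial.ker_evalRingHom, PrimeSpectrum.zeroLocus_span] at h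
  constructor
  · rintro ⟨y, rfl⟩
    exact ⟨PrimeSpectrum.comap (Polynomial.evalRingHom (center p j)) y, rfl,
      h.le ⟨y, rfl⟩ (Set.mem_singleton _)⟩
  · rintro ⟨q, rfl, hq⟩
    obtain ⟨y, rfl⟩ := h.ge (Set.singleton_subset_iff.2 hq)
    exact ⟨y, rfl⟩

lemma mem_range_markChart (j : Fin (d + 1)) (x : relLine k B) :
    x ∈ Set.range (markChart k p j) ↔ ∃ q : PrimeSpectrum (Polynomial B),
      relChart k B (chartIndex j) q = x ∧ denom p j ∉ q.asIdeal := by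
  have h := PrimeSpectrum.localization_away_comap_range (MarkRing p j) (denom p j)
  constructor
  · rintro ⟨y, rfl⟩
    exact ⟨PrimeSpectrum.comap (algebraMap (Polynomial B) (MarkRing p j)) y, rfl, h.le ⟨y, rfl⟩⟩
  · rintro ⟨q, rfl, hq⟩
    obtain ⟨y, rfl⟩ := h.ge hq
    exact ⟨y, rfl⟩

lemma denom_mem_of_factor_mem {j : Fin (d + 1)} {q : Ideal (Polynomial B)} (i : Fin d)
    (h : factor p j i ∈ q) : denom p j ∈ q :=
  Ideal.mem_of_dvd _ (Finset.dvd_prod_of_mem _ (Finset.mem_univ i)) h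

lemma relChart_mem_range_marking_iff (l j : Fin (d + 1)) (q : PrimeSpectrum (Polynomial B))
    (hq : denom p j ∉ q.asIdeal) :
    relChart k B (chartIndex j) q ∈ Set.range (marking k p l) ↔
      l = j ∧ localParam p j ∈ q.asIdeal := by
  rw [mem_range_marking]
  constructor
  · rintro ⟨q', h, hq'⟩
    by_cases hlj : l = j
    · subst hlj
      obtain rfl := (relChart k B (chartIndex l)).isOpenEmbedding.injective h
      exact ⟨rfl, hq'⟩
    exfalso
    revert h hq' hlj hq
    refine Fin.cases ?_ (fun l => ?_) l <;> refine Fin.cases ?_ (fun j => ?_) j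
    · exact fun _ _ _ h => absurd rfl h
    · intro _ h hq' _
      change relChart k B 1 q' = relChart k B 0 q at h
      refine (relChart_one_mem_range_zero k B q').1 ⟨q, h.symm⟩ ?_
      have h0 : localParam p 0 = Polynomial.X := by simp [localParam, center]
      rwa [h0] at hq'
    · intro hq h hq' _
      change relChart k B 0 q' = relChart k B 1 q at h
      exact hq (denom_mem_of_factor_mem p l
        ((X_sub_C_mem_iff_of_relChart_eq k B h.symm (p l)).1 hq'))
    · intro hq h hq' hlj
      obtain rfl := (relChart k B 0).isOpenEmbedding.injective h
      refine hq (denom_mem_of_factor_mem p l ?_)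
      change (if l = j then (1 : Polynomial B) else _) ∈ _
      rw [if_neg fun h => hlj (congrArg _ h)]
      exact hq'
  · rintro ⟨rfl, h⟩
    exact ⟨q, rfl, h⟩

variable (hp : ∀ i j, i ≠ j → IsUnit (p i - p j))

include hp in
lemma isUnit_eval_denom (j : Fin (d + 1)) : IsUnit ((denom p j).eval (center p j)) := by
  rw [denom, Polynomial.eval_prod]
  refine IsUnit.prod_univ_iff.2 fun i => ?_
  refine Fin.cases ?_ (fun j => ?_) j
  · simp [factor, center]
  · change IsUnit (Polynomial.eval (p j) (if i = j then 1 else Polynomial.X - Polynomial.C (p i)))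
    split_ifs with h
    · simp
    · simpa using hp j i (Ne.symm h)

include hp in
lemma denom_notMem (j : Fin (d + 1)) {q : Ideal (Polynomial B)} (hq : q ≠ ⊤)
    (h : localParam p j ∈ q) : denom p j ∉ q := by
  intro hd
  have h1 : Polynomial.C ((denom p j).eval (center p j)) ∈ q := by
    have := Ideal.mem_of_dvd q
      (Polynomial.X_sub_C_dvd_sub_C_eval (a := center p j) (p := denom p j)) h
    have h2 := q.sub_mem hd this
    rwa [sub_sub_cancel] at h2
  exact hq (Ideal.eq_top_of_isUnit_mem _ h1 ((isUnit_eval_denom p hp j).map Polynomial.C))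

include hp in
lemma marking_disjoint (j l : Fin (d + 1)) (hjl : j ≠ l) :
    Disjoint (Set.range (marking k p j)) (Set.range (marking k p l)) := by
  rw [Set.disjoint_left]
  intro x hx hx'
  obtain ⟨q, rfl, hq⟩ := (mem_range_marking k p j x).1 hx
  exact hjl ((relChart_mem_range_marking_iff k p l j q
    (denom_notMem p hp j q.isPrime.ne_top hq)).1 hx').1.symm

include hp in
lemma exists_mem_range_markChart (hd : 0 < d) (x : relLine k B) :
    ∃ j, x ∈ Set.range (markChart k p j) := by
  simp_rw [mem_range_markChart]
  by_cases hx : x ∈ Set.range (relChart k B 0)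
  · obtain ⟨q, rfl⟩ := hx
    let q' : PrimeSpectrum (Polynomial B) := q
    by_cases h : ∃ l : Fin d, localParam p l.succ ∈ q'.asIdeal
    · obtain ⟨l, hl⟩ := h
      exact ⟨l.succ, q', rfl, denom_notMem p hp l.succ q'.isPrime.ne_top hl⟩
    · push Not at h
      refine ⟨Fin.succ ⟨0, hd⟩, q', rfl, fun h' => ?_⟩
      obtain ⟨i, -, hi⟩ := q'.isPrime.prod_mem_iff.1 h'
      change (if i = _ then (1 : Polynomial B) else _) ∈ _ at hi
      split_ifs at hi with h0
      · exact (Ideal.ne_top_iff_one _).1 q'.isPrime.ne_top hi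
      · exact h i hi
  · obtain ⟨q, rfl⟩ := (mem_range_relChart k B x).resolve_left hx
    let q' : PrimeSpectrum (Polynomial B) := q
    have hX : localParam p 0 ∈ q'.asIdeal := by
      have := (relChart_one_mem_range_zero k B q').not.1 hx
      simpa [localParam, center] using this
    exact ⟨0, q', rfl, denom_notMem p hp 0 q'.isPrime.ne_top hX⟩

lemma preimage_range_marking_of_ne {l j : Fin (d + 1)} (h : l ≠ j) :
    markChart k p j ⁻¹' Set.range (marking k p l) = ∅ := by
  rw [Set.eq_empty_iff_forall_notMem]
  intro w hw
  obtain ⟨q, hq, hd⟩ := (mem_range_markChart k p j _).1 ⟨w, rfl⟩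
  rw [Set.mem_preimage, ← hq] at hw
  exact h ((relChart_mem_range_marking_iff k p l j q hd).1 hw).1

lemma preimage_range_marking (j : Fin (d + 1)) :
    markChart k p j ⁻¹' Set.range (marking k p j) = (PrimeSpectrum.zeroLocus
      {algebraMap (Polynomial B) (MarkRing p j) (localParam p j)} :
        Set (PrimeSpectrum (MarkRing p j))) := by
  ext w
  have h := PrimeSpectrum.localization_away_comap_range (MarkRing p j) (denom p j)
  have := relChart_mem_range_marking_iff k p j j
    (PrimeSpectrum.comap (algebraMap (Polynomial B) (MarkRing p j)) w) (h.le ⟨w, rfl⟩)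
  refine this.trans ?_
  exact ⟨fun h => Set.singleton_subset_iff.2 h.2, fun h => ⟨rfl, h rfl⟩⟩

variable [IsDomain B]

include hp in
lemma denom_ne_zero (j : Fin (d + 1)) : denom p j ≠ 0 := by
  intro h
  have := isUnit_eval_denom p hp j
  rw [h, Polynomial.eval_zero] at this
  exact not_isUnit_zero this

include hp in
lemma isDomain_markRing (j : Fin (d + 1)) : IsDomain (MarkRing p j) :=
  IsLocalization.isDomain_localization
    (powers_le_nonZeroDivisors_of_noZeroDivisors (denom_ne_zero p hp j))

include hp in
lemma prime_localParam (j : Fin (d + 1)) :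
    Prime (algebraMap (Polynomial B) (MarkRing p j) (localParam p j)) := by
  have hpr : Prime (localParam p j) := Polynomial.prime_X_sub_C _
  have hI : (Ideal.span {localParam p j}).IsPrime :=
    (Ideal.span_singleton_prime hpr.ne_zero).2 hpr
  have h := IsLocalization.isPrime_of_isPrime_disjoint (Submonoid.powers (denom p j))
    (MarkRing p j) _ hI (by
      rw [Set.disjoint_left]
      rintro _ ⟨n, rfl⟩ hn
      exact denom_notMem p hp j hI.ne_top (Ideal.mem_span_singleton_self _)
        (hI.mem_of_pow_mem n hn))
  rw [Ideal.map_span, Set.image_singleton] at h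
  refine (Ideal.span_singleton_prime fun h0 => hpr.ne_zero ?_).1 h
  exact IsLocalization.injective (MarkRing p j)
    (powers_le_nonZeroDivisors_of_noZeroDivisors (denom_ne_zero p hp j)) (h0.trans (map_zero _).symm)

/-- The generic coordinate in the chart of a marking. -/
def genericCoord {d : ℕ} : Fin (d + 1) → FractionRing (Polynomial B) :=
  Fin.cases (algebraMap _ _ (Polynomial.X : Polynomial B))⁻¹ fun _ =>
    algebraMap _ _ (Polynomial.X : Polynomial B)

/-- The generic point in the chart of a marking. -/
def genericHom (j : Fin (d + 1)) : Polynomial B →+* FractionRing (Polynomial B) :=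
  Polynomial.eval₂RingHom (algebraMap B (FractionRing (Polynomial B))) (genericCoord j)

lemma algebraMap_X_ne_zero :
    algebraMap (Polynomial B) (FractionRing (Polynomial B)) Polynomial.X ≠ 0 :=
  (map_ne_zero_iff _ (IsFractionRing.injective _ _)).2 Polynomial.X_ne_zero

lemma genericHom_succ (j : Fin d) : genericHom (B := B) j.succ =
    algebraMap (Polynomial B) (FractionRing (Polynomial B)) := by
  refine Polynomial.ringHom_ext (fun c => ?_) ?_
  · exact (Polynomial.eval₂_C _ _).trans (IsScalarTower.algebraMap_apply B (Polynomial B) _ c)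
  · exact Polynomial.eval₂_X _ _

lemma genericHom_injective (j : Fin (d + 1)) : Function.Injective (genericHom (B := B) j) := by
  refine Fin.cases ?_ (fun j => ?_) j
  · rw [injective_iff_map_eq_zero]
    intro f hf
    have h0 : genericCoord (B := B) (0 : Fin (d + 1)) =
      (algebraMap (Polynomial B) (FractionRing (Polynomial B)) Polynomial.X)⁻¹ := rfl
    let _ : Invertible (genericCoord (B := B) (0 : Fin (d + 1))) :=
      invertibleOfNonzero (inv_ne_zero (algebraMap_X_ne_zero (B := B)))
    have h1 := (Polynomial.eval₂_reverse_eq_zero_iff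
      (algebraMap B (FractionRing (Polynomial B))) _ f).2 hf
    rw [invOf_eq_inv, h0, inv_inv] at h1
    have h2 : algebraMap (Polynomial B) (FractionRing (Polynomial B)) f.reverse = 0 := by
      rw [← genericHom_succ (d := 1) 0]
      exact h1
    rw [← Polynomial.reverse_eq_zero]
    exact (map_eq_zero_iff _ (IsFractionRing.injective _ _)).1 h2
  · rw [genericHom_succ]
    exact IsFractionRing.injective _ _

/-- The generic point in the neighbourhood of a marking. -/
def markGeneric (j : Fin (d + 1)) : MarkRing p j →+* FractionRing (Polynomial B) :=
  IsLocalization.Away.lift (denom p j) (g := genericHom j)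
    (((map_ne_zero_iff _ (genericHom_injective j)).2 (denom_ne_zero p hp j)).isUnit)

lemma markGeneric_comp (j : Fin (d + 1)) :
    (markGeneric p hp j).comp (algebraMap (Polynomial B) (MarkRing p j)) = genericHom j :=
  IsLocalization.Away.lift_comp _ _

lemma markGeneric_algebraMap (j : Fin (d + 1)) (f : Polynomial B) :
    markGeneric p hp j (algebraMap (Polynomial B) (MarkRing p j) f) = genericHom j f :=
  IsLocalization.Away.lift_eq _ _ _

lemma markGeneric_injective (j : Fin (d + 1)) : Function.Injective (markGeneric p hp j) :=
  IsLocalization.lift_injective_iff (M := Submonoid.powers (denom p j)) _ |>.2 fun x y => by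
    rw [(genericHom_injective j).eq_iff, (IsLocalization.injective (MarkRing p j)
      (powers_le_nonZeroDivisors_of_noZeroDivisors (denom_ne_zero p hp j))).eq_iff]

instance (j : Fin (d + 1)) :
    IsDominant (Spec.map (CommRingCat.ofHom (markGeneric p hp j))) := by
  refine ⟨(PrimeSpectrum.denseRange_comap_iff_ker_le_nilRadical _).2 ?_⟩
  exact ((RingHom.injective_iff_ker_eq_bot _).1 (markGeneric_injective p hp j)).le.trans bot_le

lemma SpecMap_genericHom_relChart (j l : Fin (d + 1)) :
    Spec.map (CommRingCat.ofHom (genericHom (B := B) j)) ≫ relChart k B (chartIndex j) =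
      Spec.map (CommRingCat.ofHom (genericHom (B := B) l)) ≫ relChart k B (chartIndex l) := by
  have h := SpecMap_eval₂_relChart k B (algebraMap B (FractionRing (Polynomial B)))
    (mul_inv_cancel₀ (algebraMap_X_ne_zero (B := B)))
  refine Fin.cases ?_ (fun j => ?_) j <;> refine Fin.cases ?_ (fun l => ?_) l
  · rfl
  · exact h.symm
  · exact h
  · rfl

lemma markGeneric_markChart (j l : Fin (d + 1)) :
    Spec.map (CommRingCat.ofHom (markGeneric p hp j)) ≫ markChart k p j =
      Spec.map (CommRingCat.ofHom (markGeneric p hp l)) ≫ markChart k p l := by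
  rw [markChart, markChart, ← Category.assoc, ← Category.assoc, ← Spec.map_comp, ← Spec.map_comp,
    ← CommRingCat.ofHom_comp, ← CommRingCat.ofHom_comp, markGeneric_comp, markGeneric_comp,
    SpecMap_genericHom_relChart k j l]

end

/-! ## The family of log maps -/

section

variable {k B : Type u} [Field k] [CommRing B] [Algebra k B] {d : ℕ} (p : Fin d → B)
  (τ : Fin d → Bˣ) (N : ℕ)

lemma isUnit_factor (j : Fin (d + 1)) (i : Fin d) :
    IsUnit (algebraMap (Polynomial B) (MarkRing p j) (factor p j i)) :=
  isUnit_of_dvd_unit (map_dvd _ (Finset.dvd_prod_of_mem _ (Finset.mem_univ i)))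
    (IsLocalization.Away.algebraMap_isUnit (denom p j))

/-- The unit part near a marking of the coordinates `τ_i (t - p_i) ^ N`. -/
def markUnit (j : Fin (d + 1)) (i : Fin d) : (MarkRing p j)ˣ :=
  Units.map (algebraMap B (MarkRing p j)) (τ i) * (isUnit_factor p j i).unit ^ N

lemma val_markUnit (j : Fin (d + 1)) (i : Fin d) : (markUnit p τ N j i : MarkRing p j) =
    algebraMap B (MarkRing p j) (τ i) *
      algebraMap (Polynomial B) (MarkRing p j) (factor p j i) ^ N := by
  simp [markUnit]

/-- The vanishing part near a marking of the coordinates `τ_i (t - p_i) ^ N`. -/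
def markParam (j : Fin (d + 1)) : MarkRing p j :=
  algebraMap (Polynomial B) (MarkRing p j) (localParam p j) ^ N

variable [IsDomain B] (hp : ∀ i j, i ≠ j → IsUnit (p i - p j))

lemma X_sub_C_ne_zero (i : Fin d) : algebraMap (Polynomial B) (FractionRing (Polynomial B))
    (Polynomial.X - Polynomial.C (p i)) ≠ 0 :=
  (map_ne_zero_iff _ (IsFractionRing.injective _ _)).2 (Polynomial.X_sub_C_ne_zero _)

/-- The coordinates `τ_i (t - p_i) ^ N`. -/
def genericUnit (i : Fin d) : (FractionRing (Polynomial B))ˣ :=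
  Units.map (algebraMap B (FractionRing (Polynomial B))) (τ i) *
    (Units.mk0 _ (X_sub_C_ne_zero p i)) ^ N

lemma val_genericUnit (i : Fin d) : (genericUnit p τ N i : FractionRing (Polynomial B)) =
    algebraMap B _ (τ i) * algebraMap (Polynomial B) (FractionRing (Polynomial B))
      (Polynomial.X - Polynomial.C (p i)) ^ N := by
  simp [genericUnit]

lemma genericHom_C {d : ℕ} (j : Fin (d + 1)) (b : B) : genericHom j (Polynomial.C b) =
    algebraMap B (FractionRing (Polynomial B)) b := Polynomial.eval₂_C _ _

lemma genericHom_X {d : ℕ} (j : Fin (d + 1)) :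
    genericHom j (Polynomial.X : Polynomial B) = genericCoord j := Polynomial.eval₂_X _ _

lemma genericHom_localParam_ne_zero (j : Fin (d + 1)) : genericHom j (localParam p j) ≠ 0 :=
  (map_ne_zero_iff _ (genericHom_injective j)).2 (Polynomial.X_sub_C_ne_zero _)

lemma genericHom_factor (j : Fin (d + 1)) (i : Fin d) :
    genericHom j (factor p j i) * genericHom j (localParam p j) ^ slope j i =
      algebraMap (Polynomial B) (FractionRing (Polynomial B))
        (Polynomial.X - Polynomial.C (p i)) := by
  have hC : ∀ b : B, algebraMap (Polynomial B) (FractionRing (Polynomial B)) (Polynomial.C b) =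
      algebraMap B _ b := fun b => (IsScalarTower.algebraMap_apply B (Polynomial B) _ b).symm
  have hX := algebraMap_X_ne_zero (B := B)
  refine Fin.cases ?_ (fun j => ?_) j
  · change genericHom 0 (1 - Polynomial.C (p i) * Polynomial.X) *
      genericHom 0 (Polynomial.X - Polynomial.C 0) ^ (-1 : ℤ) = _
    rw [Polynomial.C_0, sub_zero, map_sub, map_one, map_mul, genericHom_C, genericHom_X, zpow_neg,
      zpow_one, map_sub, hC]
    change (1 - _ * (algebraMap (Polynomial B) (FractionRing (Polynomial B)) Polynomial.X)⁻¹) *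
      (algebraMap (Polynomial B) (FractionRing (Polynomial B)) Polynomial.X)⁻¹⁻¹ = _
    rw [inv_inv, sub_mul, one_mul, mul_assoc, inv_mul_cancel₀ hX, mul_one]
  · change genericHom j.succ (if i = j then 1 else Polynomial.X - Polynomial.C (p i)) *
      genericHom j.succ (Polynomial.X - Polynomial.C (p j)) ^ (Pi.single j 1 : Fin d → ℤ) i = _
    rw [genericHom_succ]
    split_ifs with h
    · subst h
      rw [Pi.single_eq_same, zpow_one, map_one, one_mul]
    · rw [Pi.single_eq_of_ne h, zpow_zero, mul_one]

/-- The generic point in the neighbourhood of a marking. -/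
def markGenericAlg (j : Fin (d + 1)) : MarkRing p j →ₐ[k] FractionRing (Polynomial B) :=
  { markGeneric p hp j with
    commutes' := fun c => by
      change markGeneric p hp j (algebraMap k (MarkRing p j) c) = _
      rw [IsScalarTower.algebraMap_apply k (Polynomial B) (MarkRing p j), markGeneric_algebraMap,
        IsScalarTower.algebraMap_apply k B (Polynomial B), Polynomial.algebraMap_eq, genericHom_C,
        ← IsScalarTower.algebraMap_apply] }

lemma markGenericAlg_toRingHom (j : Fin (d + 1)) :
    (markGenericAlg (k := k) p hp j).toRingHom = markGeneric p hp j := rfl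

variable (F : Fan d) {X : Scheme.{u}} (e : X ≅ F.toricVariety k)

lemma markGeneric_familyMap (σ : F.cones) (j : Fin (d + 1))
    (hu : ∀ m ∈ dualMonoid σ.1, 0 ≤ intPairing m (slope j)) :
    Spec.map (CommRingCat.ofHom (markGeneric p hp j)) ≫
      familyMap F e σ (slope j) hu (markUnit p τ N j) (markParam p N j) =
      torusMap (k := k) F e (genericUnit p τ N) := by
  rw [← markGenericAlg_toRingHom (k := k)]
  have hparam : markGenericAlg (k := k) p hp j (markParam p N j) =
      genericHom j (localParam p j) ^ N := by
    change markGeneric p hp j _ = _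
    rw [markParam, map_pow, markGeneric_algebraMap]
  refine familyMap_eq_torusMap F e _ σ _ hu _ _ _ ?_ fun i => ?_
  · rw [hparam]
    exact pow_ne_zero _ (genericHom_localParam_ne_zero p j)
  · rw [hparam, val_genericUnit, ← genericHom_factor p j i, val_markUnit, map_mul, map_pow]
    change _ = markGeneric p hp j _ * markGeneric p hp j _ ^ N * _
    rw [markGeneric_algebraMap, IsScalarTower.algebraMap_apply B (Polynomial B) (MarkRing p j),
      markGeneric_algebraMap, Polynomial.algebraMap_eq, genericHom_C, mul_pow, mul_assoc]
    congr 2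
    rw [← zpow_natCast (genericHom j (localParam p j) ^ slope j i), ← zpow_mul,
      ← zpow_natCast (genericHom j (localParam p j)), ← zpow_mul, mul_comm]

include hp in
lemma exists_ev {str : X ⟶ Spec (.of k)} [IsSeparated str] (he : e.hom ≫ F.toricStr k = str)
    (hd : 0 < d) (σ : Fin (d + 1) → F.cones)
    (hu : ∀ j, ∀ m ∈ dualMonoid (σ j).1, 0 ≤ intPairing m (slope j)) :
    ∃ ev : relLine k B ⟶ X,
      (∀ j, markChart k p j ≫ ev =
        familyMap F e (σ j) (slope j) (hu j) (markUnit p τ N j) (markParam p N j)) ∧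
      ev ≫ str = pullback.fst _ _ ≫ baseStr k B := by
  have := isDomain_markRing p hp
  refine exists_glue (markChart k p) (exists_mem_range_markChart k p hp hd)
    (fun j => Spec.map (CommRingCat.ofHom (markGeneric p hp j)))
    (fun i j => markGeneric_markChart k p hp i j) str (pullback.fst _ _ ≫ baseStr k B) _
    (fun j => ?_) fun i j => ?_
  · rw [familyMap_str F e he, markChart, Category.assoc, ← Category.assoc (relChart _ _ _),
      relChart_fst, ← Spec.map_comp, ← Spec.map_comp, ← CommRingCat.ofHom_comp,
      ← CommRingCat.ofHom_comp]
  · rw [markGeneric_familyMap, markGeneric_familyMap]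

lemma stalkIdeal_zeroLocus_of_prime {R : Type u} [CommRing R] {q : R} (hq : Prime q)
    (w : Spec (.of R)) :
    stalkIdeal (X := Spec (.of R)) (PrimeSpectrum.zeroLocus {q} : Set (PrimeSpectrum R)) w =
      (Ideal.span {q}).map (specToStalk R w) := by
  rw [stalkIdeal_spec (PrimeSpectrum.isClosed_zeroLocus (R := R) _)]
  congr 1
  change PrimeSpectrum.vanishingIdeal (PrimeSpectrum.zeroLocus {q}) = _
  rw [← PrimeSpectrum.zeroLocus_span, PrimeSpectrum.vanishingIdeal_zeroLocus_eq_radical]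
  exact ((Ideal.span_singleton_prime hq.ne_zero).2 hq).isRadical.radical

lemma map_stalkMap_injective {Y X : Scheme.{u}} (f : Y ⟶ X) [IsOpenImmersion f] (y : Y) :
    Function.Injective (Ideal.map (f.stalkMap y).hom) := by
  let E : X.presheaf.stalk (f y) ≃+* Y.presheaf.stalk y :=
    (asIso (f.stalkMap y)).commRingCatIsoToRingEquiv
  intro I J h
  change I.map (E : X.presheaf.stalk (f y) →+* Y.presheaf.stalk y) = J.map _ at h
  have h1 := congrArg (Ideal.map (E.symm : Y.presheaf.stalk y →+* X.presheaf.stalk (f y))) h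
  rw [Ideal.map_of_equiv] at h1
  exact h1.trans (Ideal.map_of_equiv E)

include hp in
lemma contact_formula (σ : Fin (d + 1) → F.cones)
    (hu : ∀ j, ∀ m ∈ dualMonoid (σ j).1, 0 ≤ intPairing m (slope j)) (hd : 0 < d)
    {ev : relLine k B ⟶ X} (hev : ∀ j, markChart k p j ≫ ev =
        familyMap F e (σ j) (slope j) (hu j) (markUnit p τ N j) (markParam p N j))
    {Z : Set X} (hZ : IsClosed Z) (c : Fin (d + 1) → ℕ)
    (hc : ∀ j, (idealOn (chartTo F e (σ j) ⁻¹' Z)).map (oneParam k (σ j).1 _ (hu j)).toRingHom =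
      Ideal.span {Polynomial.X ^ c j})
    (x : relLine k B) :
    (stalkIdeal Z (ev x)).map (ev.stalkMap x).hom =
      ∏ j, stalkIdeal (Set.range (marking k p j)) x ^ (N * c j) := by
  obtain ⟨j, w, rfl⟩ := exists_mem_range_markChart k p hp hd x
  apply map_stalkMap_injective (markChart k p j) w
  have h1 := pulledIdeal_familyMap F e (σ j) (slope j) (hu j) (markUnit p τ N j) (markParam p N j)
    hZ (hc j) w
  rw [← hev, pulledIdeal_comp] at h1
  refine h1.trans ?_
  have h2 : ∀ l, (stalkIdeal (Set.range (marking k p l)) (markChart k p j w)).map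
      ((markChart k p j).stalkMap w).hom =
      stalkIdeal (markChart k p j ⁻¹' Set.range (marking k p l)) w := fun l =>
    pulledIdeal_of_isOpenImmersion (markChart k p j) _ w
  refine Eq.trans ?_ (map_prod (Ideal.mapHom ((markChart k p j).stalkMap w).hom)
    (fun l => stalkIdeal (Set.range (marking k p l)) (markChart k p j w) ^ (N * c l))
    Finset.univ).symm
  simp_rw [map_pow, Ideal.mapHom_apply, h2]
  rw [Finset.prod_eq_single j, preimage_range_marking,
    stalkIdeal_zeroLocus_of_prime (prime_localParam p hp j), markParam, ← Ideal.span_singleton_pow,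
    Ideal.map_pow, pow_mul]
  · intro l _ hl
    rw [preimage_range_marking_of_ne k p hl, stalkIdeal_eq_top isClosed_empty (Set.notMem_empty w),
      Ideal.top_pow, Ideal.one_eq_top]
  · exact fun h => absurd (Finset.mem_univ j) h

end

/-- A morphism with given contact orders meets a component of the boundary exactly in the markings
with positive contact order. -/
lemma mem_iff_of_contact {Y X : Scheme.{u}} {f : Y ⟶ X} {Z : Set X} (hZ : IsClosed Z) {n : ℕ}
    {D : Fin n → Set Y} (hD : ∀ j, IsClosed (D j)) {c : Fin n → ℕ} {y : Y}
    (h : (stalkIdeal Z (f y)).map (f.stalkMap y).hom = ∏ j, stalkIdeal (D j) y ^ c j) :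
    f y ∈ Z ↔ ∃ j, y ∈ D j ∧ c j ≠ 0 := by
  constructor
  · intro hy
    by_contra! hno
    have h1 : ∏ j, stalkIdeal (D j) y ^ c j = ⊤ := by
      refine (Finset.prod_eq_one fun j _ => ?_).trans Ideal.one_eq_top
      by_cases hj : y ∈ D j
      · rw [hno j hj, pow_zero]
      · rw [stalkIdeal_eq_top (hD j) hj, Ideal.top_pow, Ideal.one_eq_top]
    rw [h1] at h
    have hloc := (IsLocalRing.local_hom_TFAE (f.stalkMap y).hom).out 0 2 rfl rfl
    have h2 : (stalkIdeal Z (f y)).map (f.stalkMap y).hom ≤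
        IsLocalRing.maximalIdeal (Y.presheaf.stalk y) :=
      (Ideal.map_mono (IsLocalRing.le_maximalIdeal (stalkIdeal_ne_top hy))).trans
        (hloc.1 inferInstance)
    rw [h, top_le_iff] at h2
    exact (IsLocalRing.maximalIdeal.isMaximal _).ne_top h2
  · rintro ⟨j, hj, hcj⟩
    by_contra hy
    rw [stalkIdeal_eq_top hZ hy, Ideal.map_top] at h
    have h1 : ∏ j, stalkIdeal (D j) y ^ c j ≤ stalkIdeal (D j) y :=
      (Ideal.prod_le_inf.trans (Finset.inf_le (Finset.mem_univ j))).trans (Ideal.pow_le_self hcj)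
    rw [← h, top_le_iff] at h1
    exact stalkIdeal_ne_top hj h1

lemma isLogMorphism_of_preimage_subset {Y X : Scheme.{u}} {f : Y ⟶ X} {E : Set Y} {D : Set X}
    (h : f ⁻¹' D ⊆ E) : IsLogMorphism f E D := by
  intro U s hs x hxU hxE
  have h1 : f x ∈ X.basicOpen s := hs (f x) hxU fun hx => hxE (h hx)
  have h2 : x ∈ f ⁻¹ᵁ X.basicOpen s := h1
  rwa [Scheme.preimage_basicOpen] at h2

section

variable {k B : Type u} [Field k] [CommRing B] [Algebra k B] {d : ℕ} (p : Fin d → B)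

lemma isClosed_range_marking (j : Fin (d + 1)) : IsClosed (Set.range (marking k p j)) := by
  have h : IsClosedImmersion (marking k p j ≫ pullback.fst (baseStr k B) (projectiveStr 1 k)) := by
    rw [marking_fst]; infer_instance
  have : IsClosedImmersion (marking k p j) := IsClosedImmersion.of_comp _ (pullback.fst _ _)
  exact (marking k p j).isClosedEmbedding.isClosed_range

/-- The section `t = b` of the projective line. -/
def affineSection (k : Type u) [Field k] [Algebra k B] (b : B) : Spec (.of B) ⟶ relLine k B :=
  Spec.map (CommRingCat.ofHom (Polynomial.evalRingHom b)) ≫ relChart k B 0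

lemma affineSection_fst (b : B) : affineSection k b ≫ pullback.fst _ _ = 𝟙 _ := by
  rw [affineSection, Category.assoc, relChart_fst, ← Spec.map_comp, ← CommRingCat.ofHom_comp]
  have : (Polynomial.evalRingHom b).comp Polynomial.C = RingHom.id B :=
    RingHom.ext fun b => Polynomial.eval_C
  rw [this, CommRingCat.ofHom_id, Spec.map_id]

lemma affineSection_mem_range_marking {b : B} {j : Fin (d + 1)} {w : Spec (.of B)}
    (h : affineSection k b w ∈ Set.range (marking k p j)) : ¬ IsUnit (b - center p j) ∧ j ≠ 0 := by
  obtain ⟨q, hq, hmem⟩ := (mem_range_marking k p j _).1 h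
  let w' : PrimeSpectrum B := w
  change relChart k B (chartIndex j) q = relChart k B 0 (PrimeSpectrum.comap
    (Polynomial.evalRingHom b) w') at hq
  revert hq hmem
  refine Fin.cases ?_ (fun j => ?_) j
  · intro hmem hq
    have h0 : localParam p 0 = Polynomial.X := by simp [localParam, center]
    rw [h0] at hmem
    exact absurd hmem ((relChart_one_mem_range_zero k B q).1 ⟨_, hq.symm⟩)
  · intro hmem hq
    refine ⟨fun hu => ?_, Fin.succ_ne_zero j⟩
    obtain rfl := (relChart k B 0).isOpenEmbedding.injective hq
    have h1 : Polynomial.eval b (localParam p j.succ) ∈ w'.asIdeal := hmem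
    rw [localParam, Polynomial.eval_sub, Polynomial.eval_X, Polynomial.eval_C] at h1
    exact w'.isPrime.ne_top (Ideal.eq_top_of_isUnit_mem _ h1 hu)

/-- The family of log maps on the projective line over `Spec B` given by an evaluation morphism
with prescribed contact orders. -/
def logFamily [IsDomain B] [Algebra.FiniteType k B]
    (hp : ∀ i j, i ≠ j → IsUnit (p i - p j)) (hd : 0 < d) {O : Orbifold k} (ev : relLine k B ⟶ O.X)
    (hev : ev ≫ O.str = pullback.fst _ _ ≫ baseStr k B) (c : Fin (d + 1) → O.ι → ℕ)
    (hcontact : ∀ i, ∀ x : relLine k B,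
      (stalkIdeal (O.Δ i : Set O.X) (ev x)).map (ev.stalkMap x).hom =
        ∏ j, stalkIdeal (Set.range (marking k p j)) x ^ c j i)
    (hc : ∀ j, c j ≠ 0) : O.LogFamily c where
  W := Spec (.of B)
  strW := baseStr k B
  isIntegral := inferInstance
  isSeparated := inferInstance
  locallyOfFiniteType := by
    rw [HasRingHomProperty.Spec_iff (P := @LocallyOfFiniteType)]
    exact RingHom.finiteType_algebraMap.2 inferInstance
  quasiCompact := inferInstance
  mark := marking k p
  mark_fst := marking_fst k p
  mark_disjoint := marking_disjoint k p hp
  ev := ev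
  ev_str := hev
  isLogMorphism := by
    refine isLogMorphism_of_preimage_subset fun x hx => ?_
    obtain ⟨i, hi⟩ := Set.mem_iUnion.1 hx
    obtain ⟨j, hj, -⟩ := (mem_iff_of_contact (O.Δ i).isClosed
      (isClosed_range_marking p) (hcontact i x)).1 hi
    exact Set.mem_iUnion.2 ⟨j, hj⟩
  contact := hcontact
  stable := by
    intro w
    by_cases h : 2 ≤ d
    · exact Or.inl (by omega)
    obtain rfl : d = 1 := by omega
    refine Or.inr fun hsub => ?_
    obtain ⟨i, hi⟩ := Function.ne_iff.1 (hc 0)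
    have hiff := fun x => mem_iff_of_contact (O.Δ i).isClosed
      (isClosed_range_marking p) (hcontact i x)
    have h1 : ev (marking k p 0 w) ∈ (O.Δ i : Set O.X) := (hiff _).2 ⟨0, ⟨w, rfl⟩, hi⟩
    have h2 : ev (affineSection k (p 0 + 1) w) ∉ (O.Δ i : Set O.X) := by
      rw [hiff]
      rintro ⟨j, hj, -⟩
      obtain ⟨hu, hj0⟩ := affineSection_mem_range_marking p hj
      obtain rfl : j = Fin.succ 0 := (by decide : ∀ j : Fin 2, j ≠ 0 → j = Fin.succ 0) j hj0
      refine hu ?_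
      change IsUnit (p 0 + 1 - p 0)
      rw [add_sub_cancel_left]
      exact isUnit_one
    have h3 : ∀ s : Spec (.of B) ⟶ relLine k B, s ≫ pullback.fst _ _ = 𝟙 _ →
        ev (s w) ∈ ev '' (pullback.fst (baseStr k B) (projectiveStr 1 k) ⁻¹' {w}) := by
      intro s hs
      refine ⟨s w, ?_, rfl⟩
      rw [Set.mem_preimage, ← Scheme.Hom.comp_apply, hs]
      rfl
    have h4 := hsub (h3 _ (marking_fst k p 0)) (h3 _ (affineSection_fst (p 0 + 1)))
    rw [h4] at h1
    exact h2 h1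

end

/-! ## Function fields and dominant morphisms -/

/-- The function field of an integral scheme is the fraction field of each affine chart. -/
lemma exists_functionField_hom {R : Type u} [CommRing R] [IsDomain R] {Y : Scheme.{u}}
    [IsIntegral Y] (j : Spec (.of R) ⟶ Y) [IsOpenImmersion j] :
    ∃ α : R →+* Y.functionField, (let _ := α.toAlgebra; IsFractionRing R Y.functionField) ∧
      Spec.map (CommRingCat.ofHom α) ≫ j = Y.fromSpecStalk (genericPoint Y) := by
  have key : ∀ y, j (genericPoint (Spec (.of R))) = y → ∃ α : R →+* Y.presheaf.stalk y,
      (let _ := α.toAlgebra; IsFractionRing R (Y.presheaf.stalk y)) ∧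
      Spec.map (CommRingCat.ofHom α) ≫ j = Y.fromSpecStalk y := by
    rintro _ rfl
    set g := genericPoint (Spec (.of R))
    let E : (Spec (.of R)).presheaf.stalk g ≃+* Y.presheaf.stalk (j g) :=
      (asIso (j.stalkMap g)).symm.commRingCatIsoToRingEquiv
    refine ⟨E.toRingHom.comp (specToStalk R g), ?_, ?_⟩
    · let _ := (specToStalk R g).toAlgebra
      let _ := (E.toRingHom.comp (specToStalk R g)).toAlgebra
      have h : IsFractionRing R ((Spec (.of R)).presheaf.stalk g) :=
        functionField_isFractionRing_of_affine (.of R)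
      exact IsLocalization.isLocalization_of_algEquiv (nonZeroDivisors R)
        (AlgEquiv.ofRingEquiv (f := E) fun r => rfl)
    · have h1 : CommRingCat.ofHom (E.toRingHom.comp (specToStalk R g)) =
        CommRingCat.ofHom (specToStalk R g) ≫ inv (j.stalkMap g) := rfl
      rw [h1, Spec.map_comp, ← fromSpecStalk_spec, Category.assoc,
        ← Scheme.SpecMap_stalkMap_fromSpecStalk, ← Category.assoc, ← Spec.map_comp,
        IsIso.hom_inv_id, Spec.map_id]
      exact Category.id_comp _
  exact key _ (genericPoint_eq_of_isOpenImmersion j)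

lemma isDominant_SpecMap_of_injective {R S : Type u} [CommRing R] [CommRing S] {f : R →+* S}
    (hf : Function.Injective f) : IsDominant (Spec.map (CommRingCat.ofHom f)) :=
  ⟨(PrimeSpectrum.denseRange_comap_iff_ker_le_nilRadical f).2
    ((RingHom.injective_iff_ker_eq_bot f).1 hf ▸ bot_le)⟩

lemma isDominant_of_isOpenImmersion {Y Z : Scheme.{u}} [Nonempty Y] [IrreducibleSpace Z]
    (j : Y ⟶ Z) [IsOpenImmersion j] : IsDominant j :=
  ⟨(j.isOpenEmbedding.isOpen_range).dense (Set.range_nonempty j)⟩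

lemma SpecMap_functionFieldMap {Y Z : Scheme.{u}} [IsIntegral Y] [IsIntegral Z] (f : Y ⟶ Z)
    [IsDominant f] : Spec.map (CommRingCat.ofHom (functionFieldMap f)) ≫
      Z.fromSpecStalk (genericPoint Z) = Y.fromSpecStalk (genericPoint Y) ≫ f := by
  have h : CommRingCat.ofHom (functionFieldMap f) =
    Z.presheaf.stalkSpecializes (genericPoint_specializes_genericPoint f) ≫
    f.stalkMap (genericPoint Y) := rfl
  rw [h, Spec.map_comp, Category.assoc, Scheme.SpecMap_stalkSpecializes_fromSpecStalk,
    Scheme.SpecMap_stalkMap_fromSpecStalk]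

/-- A criterion for a morphism to be dominant and separable in terms of charts. -/
lemma isDominantSeparable_of_chart {Y Z : Scheme.{u}} [IsIntegral Y] [IsIntegral Z] (f : Y ⟶ Z)
    {R T : Type u} [CommRing R] [IsDomain R] [CommRing T] [IsDomain T]
    (jY : Spec (.of R) ⟶ Y) [IsOpenImmersion jY] (jZ : Spec (.of T) ⟶ Z) [IsOpenImmersion jZ]
    (h : ∀ (L : Type u) [Field L] [Algebra R L] [IsFractionRing R L], ∃ ψ : T →+* L,
      Function.Injective ψ ∧
      Spec.map (CommRingCat.ofHom (algebraMap R L)) ≫ jY ≫ f = Spec.map (CommRingCat.ofHom ψ) ≫ jZ ∧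
      ∀ (K : Type u) [Field K] [Algebra T K] [IsFractionRing T K] (φ : K →+* L),
        φ.comp (algebraMap T K) = ψ → IsSeparablyGenerated K L φ) :
    IsDominantSeparable f := by
  obtain ⟨α, hα, hα'⟩ := exists_functionField_hom jY
  obtain ⟨β, hβ, hβ'⟩ := exists_functionField_hom jZ
  let _ := α.toAlgebra
  let _ := β.toAlgebra
  obtain ⟨ψ, hψ, hψ', hsep⟩ := h Y.functionField
  have h1 : Y.fromSpecStalk (genericPoint Y) ≫ f = Spec.map (CommRingCat.ofHom ψ) ≫ jZ := by
    rw [← hα', Category.assoc]; exact hψ'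
  have hf : IsDominant f := by
    have := isDominant_SpecMap_of_injective hψ
    have := isDominant_of_isOpenImmersion jZ
    have : IsDominant (Y.fromSpecStalk (genericPoint Y) ≫ f) := by rw [h1]; infer_instance
    exact IsDominant.of_comp (Y.fromSpecStalk (genericPoint Y)) f
  refine ⟨inferInstance, inferInstance, hf, hsep _ _ ?_⟩
  have h2 := SpecMap_functionFieldMap f
  rw [h1, ← hβ', ← Category.assoc, ← Spec.map_comp, cancel_mono] at h2
  exact congrArg CommRingCat.Hom.hom (Spec.map_injective h2)

/-! ## Self-products of integral schemes -/

section

variable {S : Type u} [CommRing S] {Y : Scheme.{u}} (f : Y ⟶ Spec (.of S))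

/-- The product of two affine charts. -/
def prodChart {A A' : Type u} [CommRing A] [CommRing A'] [Algebra S A] [Algebra S A']
    (j : Spec (.of A) ⟶ Y) (j' : Spec (.of A') ⟶ Y)
    (hj : j ≫ f = Spec.map (CommRingCat.ofHom (algebraMap S A)))
    (hj' : j' ≫ f = Spec.map (CommRingCat.ofHom (algebraMap S A'))) :
    Spec (.of (A ⊗[S] A')) ⟶ pullback f f :=
  (pullbackSpecIso S A A').inv ≫ pullback.map _ _ f f j j' (𝟙 _)
    (by rw [Category.comp_id, hj]) (by rw [Category.comp_id, hj'])

variable {A A' : Type u} [CommRing A] [CommRing A'] [Algebra S A] [Algebra S A']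
    {j : Spec (.of A) ⟶ Y} {j' : Spec (.of A') ⟶ Y}
    (hj : j ≫ f = Spec.map (CommRingCat.ofHom (algebraMap S A)))
    (hj' : j' ≫ f = Spec.map (CommRingCat.ofHom (algebraMap S A')))

instance [IsOpenImmersion j] [IsOpenImmersion j'] : IsOpenImmersion (prodChart f j j' hj hj') := by
  unfold prodChart; infer_instance

lemma prodChart_fst : prodChart f j j' hj hj' ≫ pullback.fst f f =
    Spec.map (CommRingCat.ofHom Algebra.TensorProduct.includeLeftRingHom) ≫ j := by
  rw [prodChart, Category.assoc, pullback.map, pullback.lift_fst, ← Category.assoc,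
    pullbackSpecIso_inv_fst]

lemma prodChart_snd : prodChart f j j' hj hj' ≫ pullback.snd f f =
    Spec.map (CommRingCat.ofHom
      (Algebra.TensorProduct.includeRight : A' →ₐ[S] A ⊗[S] A').toRingHom) ≫ j' := by
  rw [prodChart, Category.assoc, pullback.map, pullback.lift_snd, ← Category.assoc,
    pullbackSpecIso_inv_snd]
  rfl

lemma range_prodChart : Set.range (prodChart f j j' hj hj') =
    pullback.fst f f ⁻¹' Set.range j ∩ pullback.snd f f ⁻¹' Set.range j' := by
  have hsurj : Function.Surjective (pullbackSpecIso S A A').inv :=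
    (pullbackSpecIso S A A').inv.surjective
  have h : ⇑(prodChart f j j' hj hj') = pullback.map _ _ f f j j' (𝟙 _)
    (by rw [Category.comp_id, hj]) (by rw [Category.comp_id, hj']) ∘
      (pullbackSpecIso S A A').inv := by
    rw [prodChart]; exact funext fun x => Scheme.Hom.comp_apply _ _ _
  rw [h, hsurj.range_comp]
  exact Scheme.Pullback.range_map _ _ _ _ _ _ _ _ _

lemma isIntegral_pullback_self [IsIntegral Y] {J : Type*} [Nonempty J] {A : J → Type u}
    [∀ i, CommRing (A i)] [∀ i, Algebra S (A i)] (j : ∀ i, Spec (.of (A i)) ⟶ Y)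
    [∀ i, IsOpenImmersion (j i)] (hcov : ∀ y, ∃ i, y ∈ Set.range (j i))
    [∀ i, Nontrivial (A i)]
    (hj : ∀ i, j i ≫ f = Spec.map (CommRingCat.ofHom (algebraMap S (A i))))
    (hdom : ∀ i i', IsDomain (A i ⊗[S] A i')) : IsIntegral (pullback f f) := by
  have : ∀ q : J × J, IsIntegral (Spec (.of (A q.1 ⊗[S] A q.2))) := fun q => by
    have := hdom q.1 q.2
    infer_instance
  refine isIntegral_of_cover (fun q : J × J => prodChart f (j q.1) (j q.2) (hj q.1) (hj q.2))
    (fun y => ?_) fun q q' => ?_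
  · obtain ⟨i, hi⟩ := hcov (pullback.fst f f y)
    obtain ⟨i', hi'⟩ := hcov (pullback.snd f f y)
    exact ⟨(i, i'), (range_prodChart f _ _).ge ⟨hi, hi'⟩⟩
  · have hgen : ∀ i, genericPoint Y ∈ Set.range (j i) := fun i =>
      ((genericPoint_spec Y).mem_open_set_iff (j i).isOpenEmbedding.isOpen_range).2
        (by rw [Set.univ_inter]; exact Set.range_nonempty _)
    refine ⟨pullback.diagonal f (genericPoint Y), ?_⟩
    rw [range_prodChart, range_prodChart]
    have h1 : pullback.fst f f (pullback.diagonal f (genericPoint Y)) = genericPoint Y := by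
      rw [← Scheme.Hom.comp_apply, pullback.diagonal_fst]; rfl
    have h2 : pullback.snd f f (pullback.diagonal f (genericPoint Y)) = genericPoint Y := by
      rw [← Scheme.Hom.comp_apply, pullback.diagonal_snd]; rfl
    simp only [Set.mem_inter_iff, Set.mem_preimage, h1, h2, hgen, and_self]

end

lemma isDomain_tensor_addMonoidAlgebra (k A : Type u) (M : Type*) [Field k] [CommRing A] [IsDomain A]
    [Algebra k A] [AddCommMonoid M] [UniqueSums M] : IsDomain (A ⊗[k] AddMonoidAlgebra k M) :=
  (AddMonoidAlgebra.scalarTensorEquiv k A (M := M)).toMulEquiv.isDomain _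

lemma isDomain_tensor_polynomial (S A : Type u) [CommRing S] [CommRing A] [IsDomain A]
    [Algebra S A] : IsDomain (A ⊗[S] Polynomial S) :=
  (polyEquivTensor S A).symm.toMulEquiv.isDomain _

/-! ## Field extensions generated by coordinates and roots -/

/-- Laurent monomials in algebraically independent elements are linearly independent. -/
lemma linearIndependent_prod_zpow {k L ι : Type*} [Field k] [Field L] [Algebra k L] [Fintype ι]
    {v : ι → L} (hv : AlgebraicIndependent k v) :
    LinearIndependent k fun m : ι → ℤ => ∏ i, v i ^ m i := by
  classical
  have hv0 : ∀ i, v i ≠ 0 := fun i => hv.ne_zero i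
  rw [linearIndependent_iff']
  intro s g hg m hm
  obtain ⟨n, hn⟩ : ∃ n : ι → ℤ, ∀ m ∈ s, ∀ i, 0 ≤ m i + n i := by
    refine ⟨fun i => ∑ m ∈ s, |m i|, fun m hm i => ?_⟩
    have := Finset.single_le_sum (f := fun m : ι → ℤ => |m i|) (fun _ _ => abs_nonneg _) hm
    have h2 := neg_abs_le (m i)
    change |m i| ≤ _ at this
    linarith
  let E : (ι → ℤ) → ι →₀ ℕ := fun m => Finsupp.equivFunOnFinite.symm fun i => (m i + n i).toNat
  have hE : ∀ m ∈ s, ∀ m' ∈ s, E m = E m' → m = m' := by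
    intro m hm m' hm' h
    ext i
    have h1 : (m i + n i).toNat = (m' i + n i).toNat := DFunLike.congr_fun h i
    have := hn m hm i
    have := hn m' hm' i
    omega
  let P : MvPolynomial ι k := ∑ m ∈ s, MvPolynomial.monomial (E m) (g m)
  have hP : MvPolynomial.aeval v P = 0 := by
    have : MvPolynomial.aeval v P =
        (∏ i, v i ^ n i) * ∑ m ∈ s, g m • ∏ i, v i ^ m i := by
      rw [map_sum, Finset.mul_sum]
      refine Finset.sum_congr rfl fun m hm => ?_
      rw [MvPolynomial.aeval_monomial, Finsupp.prod_fintype _ _ fun i => pow_zero _,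
        Algebra.smul_def, mul_left_comm, ← Finset.prod_mul_distrib]
      congr 1
      refine Finset.prod_congr rfl fun i _ => ?_
      change v i ^ (m i + n i).toNat = _
      rw [← zpow_natCast, Int.toNat_of_nonneg (hn m hm i), add_comm, zpow_add₀ (hv0 i)]
    rw [this, hg, mul_zero]
  have hP0 : P = 0 := (injective_iff_map_eq_zero _).1 hv P hP
  have hc : MvPolynomial.coeff (E m) P = g m := by
    rw [MvPolynomial.coeff_sum, Finset.sum_eq_single m]
    · rw [MvPolynomial.coeff_monomial, if_pos rfl]
    · intro m' hm' hne
      rw [MvPolynomial.coeff_monomial, if_neg fun h => hne (hE m' hm' m hm h)]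
    · exact fun h => absurd hm h
  rw [← hc, hP0, MvPolynomial.coeff_zero]

section

variable {L : Type u} [Field L] {d : ℕ} (N : ℕ) (τ p : Fin d → L) (t : Fin 2 → L)

/-- The coordinates `τ_i (t_l - p_i) ^ N`. -/
def coord (l : Fin 2) (i : Fin d) : L := τ i * (t l - p i) ^ N

variable (hτ : ∀ i, τ i ≠ 0) (htp : ∀ l i, t l ≠ p i) (ht : t 0 ≠ t 1)

include hτ htp ht

lemma isSeparable_of_coord_mem {E : Type u} [Field E] [Algebra E L] (hN : (N : E) ≠ 0)
    (htE : ∀ l, t l ∈ (algebraMap E L).range)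
    (hcE : ∀ l i, coord N τ p t l i ∈ (algebraMap E L).range)
    (hgen : ∀ S : Subfield L, (∀ x, algebraMap E L x ∈ S) → (∀ i, p i ∈ S) → (∀ i, τ i ∈ S) →
      S = ⊤) : Algebra.IsSeparable E L := by
  have htp' : ∀ l i, t l - p i ≠ 0 := fun l i => sub_ne_zero.2 (htp l i)
  have hmem : ∀ x ∈ (algebraMap E L).range, x ∈ separableClosure E L := by
    rintro _ ⟨x, rfl⟩
    exact (separableClosure E L).algebraMap_mem x
  let x : Fin d → L := fun i => (t 1 - p i) / (t 0 - p i)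
  have hx1 : ∀ i, x i - 1 ≠ 0 := by
    intro i h
    rw [sub_eq_zero, div_eq_one_iff_eq (htp' 0 i)] at h
    exact ht (sub_left_injective h).symm
  have hx : ∀ i, x i ∈ separableClosure E L := by
    intro i
    obtain ⟨a, ha⟩ := hcE 0 i
    obtain ⟨b, hb⟩ := hcE 1 i
    have hne : ∀ l, coord N τ p t l i ≠ 0 := fun l =>
      mul_ne_zero (hτ i) (pow_ne_zero _ (htp' l i))
    have hba : b / a ≠ 0 := by
      refine div_ne_zero ?_ ?_
      · rintro rfl; exact hne 1 (by rw [← hb, map_zero])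
      · rintro rfl; exact hne 0 (by rw [← ha, map_zero])
    refine mem_separableClosure_iff.2
      ((Polynomial.separable_X_pow_sub_C (b / a) hN hba).of_dvd (minpoly.dvd E (x i) ?_))
    rw [map_sub, map_pow, Polynomial.aeval_X, Polynomial.aeval_C, map_div₀, ha, hb, coord, coord,
      mul_div_mul_left _ _ (hτ i), ← div_pow, sub_self]
  have hp : ∀ i, p i ∈ separableClosure E L := by
    intro i
    have : p i = (x i * t 0 - t 1) / (x i - 1) := by
      rw [eq_div_iff (hx1 i)]
      have h : x i * (t 0 - p i) = t 1 - p i := div_mul_cancel₀ _ (htp' 0 i)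
      linear_combination -h
    rw [this]
    exact div_mem (sub_mem (mul_mem (hx i) (hmem _ (htE 0))) (hmem _ (htE 1)))
      (sub_mem (hx i) (one_mem _))
  have hτ' : ∀ i, τ i ∈ separableClosure E L := by
    intro i
    have : τ i = coord N τ p t 0 i / (t 0 - p i) ^ N := by
      rw [coord, mul_div_cancel_right₀ _ (pow_ne_zero _ (htp' 0 i))]
    rw [this]
    exact div_mem (hmem _ (hcE 0 i)) (pow_mem (sub_mem (hmem _ (htE 0)) (hp i)) N)
  have htop := hgen (separableClosure E L).toSubfield
    (fun x => (separableClosure E L).algebraMap_mem x) hp hτ'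
  refine ⟨fun y => mem_separableClosure_iff.1 ?_⟩
  change y ∈ (separableClosure E L).toSubfield
  rw [htop]
  exact Subfield.mem_top y

variable {k : Type u} [Field k] [Algebra k L] (hN : (N : k) ≠ 0)
  (hgen : ∀ S : Subfield L, (∀ x, algebraMap k L x ∈ S) → (∀ l, t l ∈ S) → (∀ i, p i ∈ S) →
    (∀ i, τ i ∈ S) → S = ⊤)

include hN hgen

open scoped IntermediateField.algebraAdjoinAdjoin in
lemma algebraicIndependent_coord (htrdeg : Algebra.trdeg k L = (2 + (d + d) : ℕ)) :
    AlgebraicIndependent k (Sum.elim t (Sum.elim (coord N τ p t 0) (coord N τ p t 1))) := by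
  set v := Sum.elim t (Sum.elim (coord N τ p t 0) (coord N τ p t 1))
  let E := IntermediateField.adjoin k (Set.range v)
  have hv : ∀ a, v a ∈ (algebraMap E L).range := fun a =>
    ⟨⟨v a, IntermediateField.subset_adjoin _ _ ⟨a, rfl⟩⟩, rfl⟩
  have hsep : Algebra.IsSeparable E L := by
    refine isSeparable_of_coord_mem N τ p t hτ htp ht ?_ (fun l => hv (Sum.inl l)) (fun l i => ?_)
      fun S hS hp hτ => hgen S (fun x => ?_) (fun l => ?_) hp hτ
    · rw [← map_natCast (algebraMap k E)]
      exact (map_ne_zero _).2 hN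
    · refine Fin.cases (hv (Sum.inr (Sum.inl i))) (fun l => ?_) l
      rw [Subsingleton.elim l 0]
      exact hv (Sum.inr (Sum.inr i))
    · exact hS (algebraMap k E x)
    · obtain ⟨y, hy⟩ := hv (Sum.inl l)
      have h := hS y
      rwa [hy] at h
  have halg : Algebra.IsAlgebraic (Algebra.adjoin k (Set.range v)) L :=
    IntermediateField.isAlgebraic_adjoin_iff_top.1 inferInstance
  refine (Algebra.IsAlgebraic.isTranscendenceBasis_of_lift_le_trdeg_of_finite k v ?_).1
  rw [htrdeg]
  simp

open scoped IntermediateField.algebraAdjoinAdjoin in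
/-- The field generated by `τ_i`, `p_i` and `t_l` is separable over the one generated by the
coordinates. -/
lemma isSeparablyGenerated_coord (htrdeg : Algebra.trdeg k L = (2 + (d + d) : ℕ))
    {K : Type u} [Field K] (φ : K →+* L) (hk : ∀ c, algebraMap k L c ∈ φ.range)
    (hcoord : ∀ l i, coord N τ p t l i ∈ φ.range)
    (hφ : ∀ x, φ x ∈ IntermediateField.adjoin k
      (Set.range (Sum.elim (coord N τ p t 0) (coord N τ p t 1)))) :
    IsSeparablyGenerated K L φ := by
  have hind := AlgebraicIndependent.sumElim_iff.1
    (algebraicIndependent_coord N τ p t hτ htp ht hN hgen htrdeg)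
  set v := Sum.elim (coord N τ p t 0) (coord N τ p t 1)
  have h1 : AlgebraicIndependent (IntermediateField.adjoin k (Set.range v)) t :=
    hind.2.extendScalars _
  let φ' : K →+* IntermediateField.adjoin k (Set.range v) := φ.codRestrict _ hφ
  let _ := φ.toAlgebra
  let _ := φ'.toAlgebra
  have : IsScalarTower K (IntermediateField.adjoin k (Set.range v)) L :=
    IsScalarTower.of_algebraMap_eq fun x => rfl
  have h2 : AlgebraicIndependent K t := h1.restrictScalars φ'.injective
  let E := IntermediateField.adjoin K (Set.range t)
  have hE : ∀ x : K, φ x ∈ (algebraMap E L).range := fun x => ⟨algebraMap K E x, rfl⟩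
  have hNK : (N : K) ≠ 0 := by
    intro h
    apply hN
    apply (algebraMap k L).injective
    rw [map_natCast, ← map_natCast φ, h, map_zero, map_zero]
  have htE : ∀ l, t l ∈ (algebraMap E L).range := fun l =>
    ⟨⟨t l, IntermediateField.subset_adjoin _ _ ⟨l, rfl⟩⟩, rfl⟩
  have hsep : Algebra.IsSeparable E L := by
    refine isSeparable_of_coord_mem N τ p t hτ htp ht ?_ htE (fun l i => ?_)
      fun S hS hp hτ => hgen S (fun x => ?_) (fun l => ?_) hp hτ
    · rw [← map_natCast (algebraMap K E)]
      exact (map_ne_zero _).2 hNK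
    · obtain ⟨x, hx⟩ := hcoord l i
      exact hx ▸ hE x
    · obtain ⟨y, hy⟩ := hk x
      exact hy ▸ hS (algebraMap K E y)
    · obtain ⟨y, hy⟩ := htE l
      exact hy ▸ hS y
  have halg : Algebra.IsAlgebraic (Algebra.adjoin K (Set.range t)) L :=
    IntermediateField.isAlgebraic_adjoin_iff_top.1 inferInstance
  refine ⟨Set.range t, ?_, hsep⟩
  have h3 := h2.to_subtype_range
  rw [h3.isTranscendenceBasis_iff_isAlgebraic, Subtype.range_val]
  exact halg

end

/-! ## Pairs of points of the torus -/

section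

variable {k : Type u} [Field k] {d : ℕ} {L : Type u} [Field L] [Algebra k L]

lemma charHom_mem (σ : PointedCone ℝ (Fin d → ℝ)) (χ : Multiplicative (dualMonoid σ) →* L)
    (S : Subalgebra k L) (h : ∀ m, χ m ∈ S) : (charHom σ χ).range ≤ S := by
  rintro _ ⟨x, rfl⟩
  change charHom σ χ x ∈ S
  induction x using AddMonoidAlgebra.induction_on with
  | of m =>
    have := charHom_single (k := k) σ χ m
    change charHom σ χ (AddMonoidAlgebra.single m 1) ∈ S
    rw [this]; exact h _
  | add x y hx hy => rw [map_add]; exact add_mem hx hy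
  | smul r x hx => rw [map_smul]; exact S.smul_mem hx r

lemma val_unitChar (v : Fin d → Lˣ) (m : Fin d → ℤ) :
    unitChar v (Multiplicative.ofAdd m) = ∏ i, (v i : L) ^ m i := by
  change ((∏ i, v i ^ m i : Lˣ) : L) = _
  rw [Units.coe_prod]
  exact Finset.prod_congr rfl fun i _ => Units.val_zpow_eq_zpow_val _ _

variable (F : Fan d)

/-- The homomorphism on the characters of the torus given by units. -/
def unitHom (v : Fin d → Lˣ) : AddMonoidAlgebra k (dualMonoid F.zeroCone.1) →ₐ[k] L :=
  charHom F.zeroCone.1 (restrictChar F.zeroCone.1 (unitChar v))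

lemma unitHom_single (v : Fin d → Lˣ) (m : dualMonoid F.zeroCone.1) :
    unitHom (k := k) F v (AddMonoidAlgebra.single m 1) = ∏ i, (v i : L) ^ m.1 i :=
  (charHom_single _ _ _).trans (val_unitChar v m.1)

lemma mem_dualMonoid_zeroCone (m : Fin d → ℤ) : m ∈ dualMonoid F.zeroCone.1 := by
  intro v hv
  obtain rfl : v = 0 := hv
  rw [pairing_zero_right]

lemma mem_range_unitHom (v : Fin d → Lˣ) (i : Fin d) :
    (v i : L) ∈ (unitHom (k := k) F v).range := by
  refine ⟨AddMonoidAlgebra.single ⟨Pi.single i 1, mem_dualMonoid_zeroCone F _⟩ 1, ?_⟩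
  refine (unitHom_single F v _).trans ?_
  rw [Finset.prod_eq_single i]
  · change (v i : L) ^ (Pi.single i 1 : Fin d → ℤ) i = _
    rw [Pi.single_eq_same, zpow_one]
  · intro j _ hj
    change (v j : L) ^ (Pi.single i 1 : Fin d → ℤ) j = _
    rw [Pi.single_eq_of_ne hj, zpow_zero]
  · exact fun h => absurd (Finset.mem_univ i) h

/-- The homomorphism on the functions on the square of the torus given by two tuples of units. -/
def unitHom₂ (v w : Fin d → Lˣ) : AddMonoidAlgebra k (dualMonoid F.zeroCone.1) ⊗[k]
    AddMonoidAlgebra k (dualMonoid F.zeroCone.1) →ₐ[k] L :=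
  Algebra.TensorProduct.productMap (unitHom F v) (unitHom F w)

lemma unitHom₂_injective {v w : Fin d → Lˣ}
    (h : AlgebraicIndependent k (Sum.elim (fun i => (v i : L)) fun i => (w i : L))) :
    Function.Injective (unitHom₂ (k := k) F v w) := by
  let b := AddMonoidAlgebra.basis (dualMonoid F.zeroCone.1) k
  let B := b.tensorProduct b
  let E : dualMonoid F.zeroCone.1 × dualMonoid F.zeroCone.1 → Fin d ⊕ Fin d → ℤ :=
    fun m => Sum.elim m.1.1 m.2.1
  have hE : Function.Injective E := by
    rintro ⟨m, n⟩ ⟨m', n'⟩ hmn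
    exact Prod.ext (Subtype.ext (funext fun i => congrFun hmn (Sum.inl i)))
      (Subtype.ext (funext fun i => congrFun hmn (Sum.inr i)))
  have hli := (linearIndependent_prod_zpow h).comp E hE
  have hB : (unitHom₂ (k := k) F v w).toLinearMap ∘ B =
      (fun m : Fin d ⊕ Fin d → ℤ => ∏ i, Sum.elim (fun i => (v i : L)) (fun i => (w i : L)) i ^ m i)
        ∘ E := by
    funext m
    have h1 : B m = AddMonoidAlgebra.single m.1 1 ⊗ₜ AddMonoidAlgebra.single m.2 1 := by
      rw [Module.Basis.tensorProduct_apply]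
      simp [b]
    change unitHom₂ (k := k) F v w (B m) = _
    rw [h1, unitHom₂, Algebra.TensorProduct.productMap_apply_tmul, unitHom_single, unitHom_single]
    simp [E]
  rw [← hB] at hli
  intro x y hxy
  apply B.repr.injective
  apply hli
  rw [← Finsupp.apply_linearCombination, ← Finsupp.apply_linearCombination,
    B.linearCombination_repr, B.linearCombination_repr]
  exact hxy

lemma unitHom₂_range_le (v w : Fin d → Lˣ) (E : IntermediateField k L) (hv : ∀ i, (v i : L) ∈ E)
    (hw : ∀ i, (w i : L) ∈ E) : (unitHom₂ (k := k) F v w).range ≤ E.toSubalgebra := by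
  rw [unitHom₂, Algebra.TensorProduct.productMap_range]
  have key : ∀ v : Fin d → Lˣ, (∀ i, (v i : L) ∈ E) →
      (unitHom (k := k) F v).range ≤ E.toSubalgebra := by
    intro v hv
    refine charHom_mem _ _ _ fun m => ?_
    change unitChar v (Multiplicative.ofAdd (m.toAdd : Fin d → ℤ)) ∈ E
    rw [val_unitChar]
    exact prod_mem fun i _ => zpow_mem (hv i) _
  exact sup_le (key v hv) (key w hw)

lemma torusMap_comp {R : Type u} [CommRing R] [Algebra k R] (g : R →ₐ[k] L) {X : Scheme.{u}}
    (e : X ≅ F.toricVariety k) (v : Fin d → Rˣ) :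
    Spec.map (CommRingCat.ofHom g.toRingHom) ≫ torusMap (k := k) F e v =
      Spec.map (CommRingCat.ofHom
        (unitHom (k := k) F fun i => Units.map (g : R →* L) (v i)).toRingHom) ≫
        chartTo F e F.zeroCone := by
  rw [torusMap, ← Category.assoc, ← Spec.map_comp, ← CommRingCat.ofHom_comp]
  congr 3
  have : g.comp (charHom F.zeroCone.1 (restrictChar F.zeroCone.1 (unitChar v))) =
      unitHom F fun i => Units.map (g : R →* L) (v i) := by
    refine algHom_ext_single fun m => ?_
    rw [AlgHom.comp_apply, charHom_single, unitHom, charHom_single]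
    exact map_unitChar g.toRingHom v _
  exact congrArg AlgHom.toRingHom this

end

/-! ## The function field of the square of the universal curve -/

section

variable (B : Type u) [CommRing B] (L : Type u) [Field L]
  [Algebra (Polynomial B ⊗[B] Polynomial B) L]

/-- The two coordinates on the square of the affine line. -/
def pairCoord (l : Fin 2) : L :=
  algebraMap (Polynomial B ⊗[B] Polynomial B) L
    (![Polynomial.X ⊗ₜ 1, 1 ⊗ₜ Polynomial.X] l)

lemma algebraMap_pair_mem (S : Subring L)
    (hB : ∀ b : B, algebraMap _ L (algebraMap B (Polynomial B ⊗[B] Polynomial B) b) ∈ S)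
    (hT : ∀ l, pairCoord B L l ∈ S) (z : Polynomial B ⊗[B] Polynomial B) :
    algebraMap _ L z ∈ S := by
  have key : ∀ f : Polynomial B →ₐ[B] Polynomial B ⊗[B] Polynomial B,
      algebraMap _ L (f Polynomial.X) ∈ S → ∀ q, algebraMap _ L (f q) ∈ S := by
    intro f hf q
    induction q using Polynomial.induction_on with
    | C b =>
      have : f (Polynomial.C b) = algebraMap B _ b := f.commutes b
      rw [this]; exact hB b
    | add q r hq hr => rw [map_add, map_add]; exact add_mem hq hr
    | monomial n b h =>
      rw [pow_succ, ← mul_assoc, map_mul, map_mul]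
      exact mul_mem h hf
  induction z using TensorProduct.induction_on with
  | zero => rw [map_zero]; exact zero_mem _
  | add x y hx hy => rw [map_add]; exact add_mem hx hy
  | tmul x y =>
    have : x ⊗ₜ[B] y = (Algebra.TensorProduct.includeLeft : _ →ₐ[B] _) x *
        Algebra.TensorProduct.includeRight y := by simp
    rw [this, map_mul]
    exact mul_mem (key _ (hT 0) x) (key Algebra.TensorProduct.includeRight (hT 1) y)

lemma pair_generates [IsFractionRing (Polynomial B ⊗[B] Polynomial B) L] (S : Subfield L)
    (hB : ∀ b : B, algebraMap _ L (algebraMap B (Polynomial B ⊗[B] Polynomial B) b) ∈ S)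
    (hT : ∀ l, pairCoord B L l ∈ S) : S = ⊤ := by
  rw [eq_top_iff]
  rintro y -
  obtain ⟨a, b, hb, rfl⟩ := IsFractionRing.div_surjective (A := Polynomial B ⊗[B] Polynomial B) y
  exact div_mem (algebraMap_pair_mem B L S.toSubring hB hT a)
    (algebraMap_pair_mem B L S.toSubring hB hT b)

/-- The square of the affine line as an iterated affine line. -/
def pairEquiv : Polynomial (Polynomial B) ≃ₐ[Polynomial B] Polynomial B ⊗[B] Polynomial B :=
  AlgEquiv.ofRingEquiv (f := (polyEquivTensor B (Polynomial B)).toRingEquiv) fun q => by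
    change polyEquivTensor B (Polynomial B) (Polynomial.C q) = q ⊗ₜ 1
    rw [← AlgEquiv.eq_symm_apply, polyEquivTensor_symm_apply_tmul_eq_smul, Polynomial.map_one,
      Polynomial.smul_eq_C_mul, mul_one]

lemma trdeg_pair [IsDomain B] [IsFractionRing (Polynomial B ⊗[B] Polynomial B) L]
    (k : Type u) [Field k] [Algebra k B] [Algebra k L]
    [IsScalarTower k (Polynomial B ⊗[B] Polynomial B) L] {n : ℕ}
    (h : Algebra.trdeg k B = n) : Algebra.trdeg k L = (2 + n : ℕ) := by
  have hdom : IsDomain (Polynomial B ⊗[B] Polynomial B) := isDomain_tensor_polynomial B _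
  have hinj : Function.Injective (algebraMap (Polynomial B) (Polynomial B ⊗[B] Polynomial B)) := by
    have := (pairEquiv B).injective.comp (Polynomial.C_injective (R := Polynomial B))
    intro x y hxy
    apply this
    have h1 : ∀ x, pairEquiv B (Polynomial.C x) = algebraMap _ _ x := (pairEquiv B).commutes
    change pairEquiv B (Polynomial.C x) = pairEquiv B (Polynomial.C y)
    rw [h1, h1, hxy]
  have : FaithfulSMul (Polynomial B) (Polynomial B ⊗[B] Polynomial B) :=
    (faithfulSMul_iff_algebraMap_injective _ _).2 hinj
  have h1 := trdeg_add_eq k B (A := Polynomial B)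
  have h2 := trdeg_add_eq k (Polynomial B) (A := Polynomial B ⊗[B] Polynomial B)
  have h3 := trdeg_add_eq k (Polynomial B ⊗[B] Polynomial B) (A := L)
  have : Algebra.IsAlgebraic (Polynomial B ⊗[B] Polynomial B) L :=
    IsLocalization.isAlgebraic L (nonZeroDivisors _)
  rw [← h3, ← h2, ← h1, h, ← (pairEquiv B).trdeg_eq,
    Polynomial.trdeg_of_isDomain, Polynomial.trdeg_of_isDomain, trdeg_eq_zero, add_zero,
    add_assoc, add_comm]
  norm_num

end

/-! ## Separability of the two-point evaluation morphism -/

section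

variable {k B : Type u} [Field k] [CommRing B] [Algebra k B] [IsDomain B]

instance : IsIntegral (relLine k B) := by
  refine isIntegral_of_cover (relChart k B) (fun x => ?_) fun i i' => ?_
  · rcases mem_range_relChart k B x with h | h
    exacts [⟨0, h⟩, ⟨1, h⟩]
  · have key : ∀ i, relChart k B 1 (⊥ : PrimeSpectrum (Polynomial B)) ∈
        Set.range (relChart k B i) := by
      have h0 := (relChart_one_mem_range_zero k B ⊥).2 (fun h => Polynomial.X_ne_zero
        ((Submodule.mem_bot _).1 h))
      intro i
      refine Fin.cases h0 (fun i => ?_) i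
      rw [Subsingleton.elim i 0]
      exact ⟨_, rfl⟩
    exact ⟨_, key i, key i'⟩

variable {d : ℕ} (p : Fin d → B) (τ : Fin d → Bˣ) (N : ℕ) (hp : ∀ i j, i ≠ j → IsUnit (p i - p j))
  (F : Fan d) {X : Scheme.{u}} (e : X ≅ F.toricVariety k) {σ : Fin (d + 1) → F.cones}
  {hu : ∀ j, ∀ m ∈ dualMonoid (σ j).1, 0 ≤ intPairing m (slope j)} {ev : relLine k B ⟶ X}
  (hd : 0 < d)
  (hev : ∀ j, markChart k p j ≫ ev =
    familyMap F e (σ j) (slope j) (hu j) (markUnit p τ N j) (markParam p N j))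

include hp hd hev

lemma generic_relChart_ev :
    Spec.map (CommRingCat.ofHom (algebraMap (Polynomial B) (FractionRing (Polynomial B)))) ≫
      relChart k B 0 ≫ ev = torusMap (k := k) F e (genericUnit p τ N) := by
  let j : Fin d := ⟨0, hd⟩
  rw [← markGeneric_familyMap p τ N hp F e (σ j.succ) j.succ (hu j.succ), ← hev, markChart,
    Category.assoc, ← Category.assoc (Spec.map _) (Spec.map _), ← Spec.map_comp,
    ← CommRingCat.ofHom_comp, markGeneric_comp, genericHom_succ]
  rfl

lemma exists_units_of_injective {L : Type u} [Field L] [Algebra k L] (f : Polynomial B →ₐ[k] L)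
    (hf : Function.Injective f) : ∃ v : Fin d → Lˣ,
      (∀ i, (v i : L) = f (Polynomial.C (τ i : B)) *
        (f Polynomial.X - f (Polynomial.C (p i))) ^ N) ∧
      Spec.map (CommRingCat.ofHom f.toRingHom) ≫ relChart k B 0 ≫ ev =
        Spec.map (CommRingCat.ofHom (unitHom (k := k) F v).toRingHom) ≫ chartTo F e F.zeroCone := by
  let g : FractionRing (Polynomial B) →ₐ[k] L := IsFractionRing.liftAlgHom hf
  have hg : ∀ q, g (algebraMap (Polynomial B) _ q) = f q := fun q =>
    IsFractionRing.lift_algebraMap (g := f.toRingHom) hf q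
  refine ⟨fun i => Units.map (g : _ →* L) (genericUnit p τ N i), fun i => ?_, ?_⟩
  · change g (genericUnit p τ N i : FractionRing (Polynomial B)) = _
    rw [val_genericUnit, IsScalarTower.algebraMap_apply B (Polynomial B), map_mul, map_pow, hg, hg,
      map_sub]
    rfl
  · rw [← torusMap_comp, ← generic_relChart_ev p τ N hp F e hd hev, ← Category.assoc (Spec.map _)
      (Spec.map _), ← Spec.map_comp, ← CommRingCat.ofHom_comp]
    congr 3
    exact RingHom.ext fun q => (hg q).symm

/-- The two-point evaluation morphism is dominant and separable. -/
theorem isDominantSeparable_lift [IsIntegral X] {str : X ⟶ Spec (.of k)}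
    (he : e.hom ≫ F.toricStr k = str) (hN : (N : k) ≠ 0)
    (htrdeg : Algebra.trdeg k B = (d + d : ℕ))
    (hgen : ∀ (L : Type u) [Field L] (S : Subfield L) (f : B →+* L),
      (∀ c, f (algebraMap k B c) ∈ S) → (∀ i, f (p i) ∈ S) → (∀ i, f (τ i) ∈ S) → ∀ b, f b ∈ S)
    (h : (pullback.fst _ _ ≫ ev) ≫ str = (pullback.snd _ _ ≫ ev) ≫ str) :
    IsDominantSeparable (pullback.lift (f := str) (g := str)
      (pullback.fst (pullback.fst (baseStr k B) (projectiveStr 1 k))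
        (pullback.fst (baseStr k B) (projectiveStr 1 k)) ≫ ev) (pullback.snd _ _ ≫ ev) h) := by
  have hdom : IsDomain (Polynomial B ⊗[B] Polynomial B) := isDomain_tensor_polynomial B _
  have hrel : ∀ i, relChart k B i ≫ pullback.fst _ _ =
    Spec.map (CommRingCat.ofHom (algebraMap B (Polynomial B))) := relChart_fst k B
  have hchart := chartTo_comp F e he
  have hdom' : ∀ σ σ' : F.cones, IsDomain (AddMonoidAlgebra k (dualMonoid σ.1) ⊗[k]
      AddMonoidAlgebra k (dualMonoid σ'.1)) := fun σ σ' => by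
    have : UniqueSums (dualMonoid σ'.1) := UniqueSums.of_injective_addHom
      (dualMonoid σ'.1).subtype.toAddHom Subtype.val_injective inferInstance
    exact isDomain_tensor_addMonoidAlgebra k _ _
  have hY : IsIntegral (pullback (pullback.fst (baseStr k B) (projectiveStr 1 k))
      (pullback.fst (baseStr k B) (projectiveStr 1 k))) := by
    refine isIntegral_pullback_self _ (relChart k B) (fun x => ?_) hrel fun _ _ => hdom
    rcases mem_range_relChart k B x with h | h
    exacts [⟨0, h⟩, ⟨1, h⟩]
  have hZ : IsIntegral (pullback str str) := by
    have : Nonempty F.cones := ⟨F.zeroCone⟩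
    refine isIntegral_pullback_self _ (chartTo F e) (fun x => ?_) hchart hdom'
    obtain ⟨σ, q, hq⟩ := exists_chartTo_eq F e x
    exact ⟨σ, q, hq⟩
  have := hdom' F.zeroCone F.zeroCone
  refine isDominantSeparable_of_chart _ (prodChart _ (relChart k B 0) (relChart k B 0) (hrel 0)
    (hrel 0)) (prodChart _ (chartTo F e F.zeroCone) (chartTo F e F.zeroCone) (hchart _) (hchart _))
    fun L _ _ _ => ?_
  let _ : Algebra k L := ((algebraMap (Polynomial B ⊗[B] Polynomial B) L).comp
    (algebraMap k (Polynomial B ⊗[B] Polynomial B))).toAlgebra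
  have : IsScalarTower k (Polynomial B ⊗[B] Polynomial B) L :=
    @IsScalarTower.of_algebraMap_eq k (Polynomial B ⊗[B] Polynomial B) L _ _ _ _ _ _ fun _ => rfl
  have hinj := IsFractionRing.injective (Polynomial B ⊗[B] Polynomial B) L
  let q : Polynomial B ⊗[B] Polynomial B →ₐ[k] L := IsScalarTower.toAlgHom k _ L
  let inc : Fin 2 → Polynomial B →ₐ[B] Polynomial B ⊗[B] Polynomial B :=
    ![Algebra.TensorProduct.includeLeft, Algebra.TensorProduct.includeRight]
  have hinc : ∀ l, Function.Injective (inc l) := by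
    refine Fin.cases ?_ fun l => ?_
    · exact Algebra.TensorProduct.includeLeft_injective Polynomial.C_injective
    · rw [Subsingleton.elim l 0]
      exact Algebra.TensorProduct.includeRight_injective Polynomial.C_injective
  let f : Fin 2 → Polynomial B →ₐ[k] L := fun l => q.comp ((inc l).restrictScalars k)
  have hf : ∀ l, Function.Injective (f l) := fun l => hinj.comp (hinc l)
  let t := pairCoord B L
  let ι : B →+* L := (algebraMap (Polynomial B ⊗[B] Polynomial B) L).comp (algebraMap B _)
  have hfC : ∀ l b, f l (Polynomial.C b) = ι b := fun l b => congrArg q ((inc l).commutes b)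
  have hfX : ∀ l, f l Polynomial.X = t l := by
    refine Fin.cases rfl fun l => ?_
    rw [Subsingleton.elim l 0]
    rfl
  have hιinj : Function.Injective ι := fun x y hxy => by
    rw [← hfC 0, ← hfC 0] at hxy
    exact Polynomial.C_injective (hf 0 hxy)
  choose v hv hv' using fun l => exists_units_of_injective p τ N hp F e hd hev (f l) (hf l)
  have hvc : ∀ l i, (v l i : L) = coord N (fun i => ι (τ i)) (fun i => ι (p i)) t l i := by
    intro l i
    rw [hv, hfC, hfC, hfX]; rfl
  have hτ : ∀ i, ι (τ i) ≠ 0 := fun i => (map_ne_zero_iff _ hιinj).2 (τ i).ne_zero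
  have htp : ∀ l i, t l ≠ ι (p i) := by
    intro l i h
    rw [← hfX, ← hfC l] at h
    exact Polynomial.X_sub_C_ne_zero (p i) (sub_eq_zero.2 (hf l h))
  have ht : t 0 ≠ t 1 := by
    intro h
    have h1 := congrArg (pairEquiv B).symm (hinj h)
    change (polyEquivTensor B (Polynomial B)).symm (Polynomial.X ⊗ₜ 1) =
      (polyEquivTensor B (Polynomial B)).symm (1 ⊗ₜ Polynomial.X) at h1
    rw [polyEquivTensor_symm_apply_tmul_eq_smul, polyEquivTensor_symm_apply_tmul_eq_smul,
      Polynomial.map_one, Polynomial.map_X, one_smul, Polynomial.smul_eq_C_mul, mul_one] at h1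
    have h2 := congrArg Polynomial.natDegree h1
    rw [Polynomial.natDegree_C, Polynomial.natDegree_X] at h2
    exact zero_ne_one h2
  have hgenL : ∀ S : Subfield L, (∀ x, algebraMap k L x ∈ S) → (∀ l, t l ∈ S) →
      (∀ i, ι (p i) ∈ S) → (∀ i, ι (τ i) ∈ S) → S = ⊤ := fun S h1 h2 h3 h4 =>
    pair_generates B L S (hgen L S ι (fun c => by
      have : ι (algebraMap k B c) = algebraMap k L c := by
        change algebraMap _ L (algebraMap B _ (algebraMap k B c)) = _
        rw [← IsScalarTower.algebraMap_apply k B]; rfl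
      rw [this]; exact h1 c) h3 h4) h2
  have htr := trdeg_pair B L k htrdeg
  have hvfun : ∀ l, (fun i => (v l i : L)) =
      coord N (fun i => ι (τ i)) (fun i => ι (p i)) t l := fun l => funext (hvc l)
  have hind := (AlgebraicIndependent.sumElim_iff.1 (algebraicIndependent_coord N _ _ t hτ htp ht
    hN hgenL htr)).1
  rw [← hvfun, ← hvfun] at hind
  refine ⟨(unitHom₂ (k := k) F (v 0) (v 1)).toRingHom, unitHom₂_injective F hind, ?_, ?_⟩
  · refine pullback.hom_ext ?_ ?_
    · rw [Category.assoc, Category.assoc, pullback.lift_fst, Category.assoc,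
        ← Category.assoc (prodChart _ _ _ _ _), prodChart_fst, prodChart_fst, Category.assoc,
        ← Category.assoc (Spec.map _), ← Category.assoc (Spec.map _) (Spec.map _), ← Spec.map_comp,
        ← Spec.map_comp, ← CommRingCat.ofHom_comp, ← CommRingCat.ofHom_comp]
      refine (hv' 0).trans ?_
      congr 3
      exact congrArg AlgHom.toRingHom
        (Algebra.TensorProduct.productMap_left (unitHom (k := k) F (v 0)) (unitHom F (v 1))).symm
    · rw [Category.assoc, Category.assoc, pullback.lift_snd, Category.assoc,
        ← Category.assoc (prodChart _ _ _ _ _), prodChart_snd, prodChart_snd, Category.assoc,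
        ← Category.assoc (Spec.map _), ← Category.assoc (Spec.map _) (Spec.map _), ← Spec.map_comp,
        ← Spec.map_comp, ← CommRingCat.ofHom_comp, ← CommRingCat.ofHom_comp]
      refine (hv' 1).trans ?_
      congr 3
      exact congrArg AlgHom.toRingHom
        (Algebra.TensorProduct.productMap_right (unitHom (k := k) F (v 0)) (unitHom F (v 1))).symm
  · intro K _ _ _ φ hφ
    have hφ' : ∀ z, φ (algebraMap _ K z) = unitHom₂ (k := k) F (v 0) (v 1) z :=
      fun z => RingHom.congr_fun hφ z
    have hr : ∀ z, unitHom₂ (k := k) F (v 0) (v 1) z ∈ φ.range := fun z => ⟨_, hφ' z⟩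
    refine isSeparablyGenerated_coord N _ _ t hτ htp ht hN hgenL htr φ (fun c => ?_) (fun l i => ?_)
      fun x => ?_
    · rw [← (unitHom₂ (k := k) F (v 0) (v 1)).commutes]
      exact hr _
    · rw [← hvc]
      have hle := Algebra.TensorProduct.productMap_range (unitHom (k := k) F (v 0))
        (unitHom F (v 1))
      have hmem : (v l i : L) ∈ (unitHom₂ (k := k) F (v 0) (v 1)).range := by
        rw [unitHom₂, hle]
        refine Fin.cases ?_ (fun l => ?_) l
        · exact le_sup_left (a := (unitHom (k := k) F (v 0)).range) (mem_range_unitHom F (v 0) i)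
        · rw [Subsingleton.elim l 0]
          exact le_sup_right (b := (unitHom (k := k) F (v 1)).range) (mem_range_unitHom F (v 1) i)
      obtain ⟨z, hz⟩ := hmem
      exact hz ▸ hr z
    · obtain ⟨a, b, -, rfl⟩ := IsFractionRing.div_surjective
        (A := AddMonoidAlgebra k (dualMonoid F.zeroCone.1) ⊗[k]
          AddMonoidAlgebra k (dualMonoid F.zeroCone.1)) x
      rw [map_div₀, hφ', hφ']
      set E := IntermediateField.adjoin k (Set.range (Sum.elim
        (coord N (fun i => ι (τ i)) (fun i => ι (p i)) t 0)
        (coord N (fun i => ι (τ i)) (fun i => ι (p i)) t 1)))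
      have hle := unitHom₂_range_le (k := k) F (v 0) (v 1) E
        (fun i => IntermediateField.subset_adjoin _ _ ⟨Sum.inl i, (hvc 0 i).symm⟩)
        (fun i => IntermediateField.subset_adjoin _ _ ⟨Sum.inr i, (hvc 1 i).symm⟩)
      exact div_mem (hle ⟨a, rfl⟩) (hle ⟨b, rfl⟩)

end

/-! ## The parameter space of the family -/

section

variable (k : Type u) [Field k] (d : ℕ)

/-- The equation of the complement of the parameter space in affine space. -/
def paramDenom : MvPolynomial (Fin d ⊕ Fin d) k :=
  (∏ i, MvPolynomial.X (Sum.inl i)) * ∏ q ∈ Finset.univ.offDiag,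
    (MvPolynomial.X (Sum.inr q.1) - MvPolynomial.X (Sum.inr q.2))

lemma paramDenom_ne_zero : paramDenom k d ≠ 0 := by
  refine mul_ne_zero (Finset.prod_ne_zero_iff.2 fun i _ => MvPolynomial.X_ne_zero _)
    (Finset.prod_ne_zero_iff.2 fun q hq h => ?_)
  exact (Finset.mem_offDiag.1 hq).2.2 (Sum.inr_injective (MvPolynomial.X_injective (sub_eq_zero.1 h)))

/-- The coordinate ring of the parameter space: units `τ_i` and elements `p_i` with invertible
differences. -/
abbrev ParamRing : Type u := Localization.Away (paramDenom k d)

instance : IsDomain (ParamRing k d) :=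
  IsLocalization.isDomain_localization
    (powers_le_nonZeroDivisors_of_noZeroDivisors (paramDenom_ne_zero k d))

instance : Algebra.FiniteType k (ParamRing k d) :=
  have := IsLocalization.Away.finitePresentation (S := ParamRing k d) (paramDenom k d)
  have : Algebra.FiniteType (MvPolynomial (Fin d ⊕ Fin d) k) (ParamRing k d) := inferInstance
  Algebra.FiniteType.trans (S := MvPolynomial (Fin d ⊕ Fin d) k) inferInstance inferInstance

lemma isUnit_of_dvd_paramDenom {a : MvPolynomial (Fin d ⊕ Fin d) k} (h : a ∣ paramDenom k d) :
    IsUnit (algebraMap _ (ParamRing k d) a) :=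
  isUnit_of_dvd_unit (map_dvd _ h) (IsLocalization.Away.algebraMap_isUnit (paramDenom k d))

/-- The universal units `τ_i`. -/
def paramUnit (i : Fin d) : (ParamRing k d)ˣ :=
  (isUnit_of_dvd_paramDenom k d (a := MvPolynomial.X (Sum.inl i))
    (Dvd.dvd.mul_right (Finset.dvd_prod_of_mem _ (Finset.mem_univ i)) _)).unit

/-- The universal points `p_i`. -/
def paramPoint (i : Fin d) : ParamRing k d :=
  algebraMap _ _ (MvPolynomial.X (Sum.inr i) : MvPolynomial (Fin d ⊕ Fin d) k)

lemma isUnit_paramPoint_sub (i j : Fin d) (h : i ≠ j) :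
    IsUnit (paramPoint k d i - paramPoint k d j) := by
  rw [paramPoint, paramPoint, ← map_sub]
  exact isUnit_of_dvd_paramDenom k d (Dvd.dvd.mul_left
    (Finset.dvd_prod_of_mem (fun q : Fin d × Fin d => MvPolynomial.X (Sum.inr q.1) -
      MvPolynomial.X (Sum.inr q.2)) (Finset.mem_offDiag.2
      ⟨Finset.mem_univ i, Finset.mem_univ j, h⟩ : (i, j) ∈ _)) _)

lemma trdeg_paramRing : Algebra.trdeg k (ParamRing k d) = (d + d : ℕ) := by
  have hinj : Function.Injective (algebraMap (MvPolynomial (Fin d ⊕ Fin d) k) (ParamRing k d)) :=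
    IsLocalization.injective _
      (powers_le_nonZeroDivisors_of_noZeroDivisors (paramDenom_ne_zero k d))
  have := (faithfulSMul_iff_algebraMap_injective _ _).2 hinj
  have h := trdeg_add_eq k (MvPolynomial (Fin d ⊕ Fin d) k) (A := ParamRing k d)
  have : Algebra.IsAlgebraic (MvPolynomial (Fin d ⊕ Fin d) k) (ParamRing k d) :=
    IsLocalization.isAlgebraic _ (Submonoid.powers (paramDenom k d))
  rw [MvPolynomial.trdeg_of_isDomain, trdeg_eq_zero, add_zero] at h
  rw [← h]
  simp

lemma paramRing_generates {L : Type u} [Field L] (S : Subfield L) (f : ParamRing k d →+* L)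
    (hk : ∀ c, f (algebraMap k _ c) ∈ S) (hp : ∀ i, f (paramPoint k d i) ∈ S)
    (hτ : ∀ i, f (paramUnit k d i) ∈ S) (b : ParamRing k d) : f b ∈ S := by
  have key : ∀ a : MvPolynomial (Fin d ⊕ Fin d) k, f (algebraMap _ _ a) ∈ S := by
    intro a
    induction a using MvPolynomial.induction_on with
    | C c =>
      have := hk c
      rwa [IsScalarTower.algebraMap_apply k (MvPolynomial (Fin d ⊕ Fin d) k)] at this
    | add a b ha hb => rw [map_add, map_add]; exact add_mem ha hb
    | mul_X a i h =>
      rw [map_mul, map_mul]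
      refine mul_mem h ?_
      cases i with
      | inl i => exact hτ i
      | inr i => exact hp i
  obtain ⟨a, s, rfl⟩ := IsLocalization.exists_mk'_eq (Submonoid.powers (paramDenom k d)) b
  have hs := (IsLocalization.map_units (ParamRing k d) s).map f
  have h1 := congrArg f (IsLocalization.mk'_spec (ParamRing k d) a s)
  rw [map_mul] at h1
  rw [eq_div_of_mul_eq hs.ne_zero h1]
  exact div_mem (key a) (key s)

end

/-! ## The main construction -/

lemma exists_intPairing_slope_eq_one {d : ℕ} (hd : 0 < d) (j : Fin (d + 1)) :
    ∃ m, intPairing m (slope j) = 1 := by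
  refine Fin.cases ?_ (fun j => ?_) j
  · refine ⟨Pi.single ⟨0, hd⟩ (-1), ?_⟩
    simp [intPairing, slope, Pi.single_apply]
  · refine ⟨Pi.single j 1, ?_⟩
    simp [intPairing, slope, Pi.single_apply]

section

variable {k : Type u} [Field k] {d : ℕ} (F : Fan d) (O : Orbifold k)
  (e : O.X ≅ F.toricVariety k) (he : e.hom ≫ F.toricStr k = O.str)
  (hΔ : e.hom ⁻¹' F.toricBoundary k = O.boundary)

include he hΔ

/-- A projective toric variety is separably rationally connected with respect to contact orders
which are multiples of any given number prime to the characteristic. -/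
lemma exists_isSeparablyRationallyConnected (hd : 0 < d) {N : ℕ} (hN : (N : k) ≠ 0) :
    ∃ c : Fin (d + 1) → O.ι → ℕ, (∀ j, ¬ ∀ i, ringChar k ∣ N * c j i) ∧
      O.IsSeparablyRationallyConnected fun j i => N * c j i := by
  have := O.isIntegral
  have hproper := O.projective.isProper
  have : IsSeparated O.str := inferInstance
  choose σ hu c hc hchar using fun j : Fin (d + 1) => exists_contact F O e he hΔ (slope j)
  have hgood : ∀ j, ¬ ∀ i, ringChar k ∣ N * c j i := by
    intro j h
    have h1 : ∀ i, (c j i : k) = 0 := fun i => by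
      have := (ringChar.spec k _).2 (h i)
      rw [Nat.cast_mul] at this
      exact (mul_eq_zero.1 this).resolve_left hN
    have h2 := hchar j h1
    obtain ⟨m, hm⟩ := exists_intPairing_slope_eq_one hd j
    have h3 := h2 m
    rw [hm, Int.cast_one] at h3
    exact one_ne_zero h3
  refine ⟨c, hgood, ?_⟩
  let B := ParamRing k d
  obtain ⟨ev, hev, hstr⟩ := exists_ev (paramPoint k d) (paramUnit k d) N
    (isUnit_paramPoint_sub k d) F e he hd σ hu
  refine ⟨logFamily (paramPoint k d) (isUnit_paramPoint_sub k d) hd ev hstr _ (fun i x => ?_)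
    fun j h => hgood j fun i => ?_, ?_⟩
  · exact contact_formula (paramPoint k d) (paramUnit k d) N (isUnit_paramPoint_sub k d) F e σ hu hd
      hev (O.Δ i).isClosed (fun j => c j i) (fun j => hc j i) x
  · have := congrFun h i
    change N * c j i = 0 at this
    rw [this]
    exact dvd_zero _
  · exact isDominantSeparable_lift (paramPoint k d) (paramUnit k d) N (isUnit_paramPoint_sub k d) F e
      hd hev he hN (trdeg_paramRing k d) (fun L _ S f => paramRing_generates k d S f) _

end

lemma exists_natCast_ne_zero (k : Type u) [Field k] (M : ℕ) : ∃ N, M ≤ N ∧ (N : k) ≠ 0 := by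
  by_cases h : (M : k) = 0
  · refine ⟨M + 1, Nat.le_succ M, ?_⟩
    rw [Nat.cast_succ, h, zero_add]
    exact one_ne_zero
  · exact ⟨M, le_rfl, h⟩

end

end Campana

theorem corollary7p3 {k : Type*} [Field k] [IsAlgClosed k] {d : ℕ} (hd : 0 < d)
    (F : Campana.Fan d) (O : Campana.Orbifold k) (hklt : O.IsKlt)
    (e : O.X ≅ F.toricVariety k) (he : e.hom ≫ F.toricStr k = O.str)
    (hΔ : e.hom ⁻¹' F.toricBoundary k = O.boundary) :
    O.IsSeparablyCampanaRationallyConnectedByGoodContactOrders := by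
  have := O.finite
  obtain ⟨M, hM⟩ : ∃ M : ℕ, ∀ i, O.mult i ≤ M := by
    obtain ⟨M, hM⟩ := (Set.finite_range fun i => (O.mult i).toNat).bddAbove
    refine ⟨M, fun i => ?_⟩
    rw [← ENat.natCast_toNat (hklt i)]
    exact_mod_cast hM ⟨i, rfl⟩
  obtain ⟨N, hMN, hN⟩ := Campana.exists_natCast_ne_zero k M
  obtain ⟨c, hgood, hc⟩ := Campana.exists_isSeparablyRationallyConnected F O e he hΔ hd hN
  refine ⟨d + 1, _, fun j h => hgood j fun i => ?_, fun i => ⟨fun _ j => ?_, fun h => ?_⟩, hgood, hc⟩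
  · rw [congrFun h i]
    exact dvd_zero _
  · refine (Nat.eq_zero_or_pos (c j i)).imp (fun h => by rw [h, mul_zero]) fun h => ?_
    refine (hM i).trans ?_
    exact_mod_cast hMN.trans (Nat.le_mul_of_pos_right N h)
  · exact absurd h (hklt i)
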